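/- Fix $\rho\in(-\infty,-2)$ and $T\in\mathbb R$, and put $$w_t=\frac{2\rho}{\rho+2}\arcsin\bigl(e^{\frac{\rho+2}{4}(T-t)}\bigr),\qquad t\in(-\infty,T).$$ For $t<T$ let $D_t\subset\mathbb C$ be the set of points $z$ for which the whole-plane Loewner equation $$\partial_s g_s(z)=g_s(z)\,\frac{e^{iw_s}+g_s(z)}{e^{iw_s}-g_s(z)},\qquad \lim_{s\to-\infty}e^{-s}g_s(z)=z,$$ has a solution with values in the open unit disk for all $s\le t$. The positively oriented whole-plane SLE$_0(\rho)$ started at $\infty$ in the direction $1$, with reference point $0$ and force point $\infty$ (and conformal radius parameter $T$), is the simple curve $\gamma:(-\infty,T)\to\mathbb C$ with $|\gamma(t)|\to\infty$ as $t\to-\infty$ and $D_t=\mathbb C\setminus\gamma((-\infty,t])$ for all $t<T$. Let $M_0=\{(r,\theta):r>0,\ \theta\in\mathbb R\}$ be the logarithmic Riemann surface centered at $0$, with projection $(r,\theta)\mapsto re^{i\theta}$ and single-valued argument $\arg(r,\theta)=\theta$. A $C^1$ curve $\tilde\eta$ in $M_0$ is a flow line of a field $h:M_0\to\mathbb R$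 if $\tilde\eta'(s)=e^{ih(\tilde\eta(s))}$, where the derivative is taken in the local coordinate $re^{i\theta}$. **Proposition.** The curve $\gamma$ exists and has an arc-length parametrization $\eta:(-\infty,S)\to\mathbb C$, $S\in(-\infty,\infty]$ (an increasing reparametrization of $\gamma$ whose length between the parameters $a\le b$ is $b-a$). For every such $\eta$: 1. $\eta$ has a continuous lift $\tilde\eta$ to $M_0$ such that $\arg(\tilde\eta(s))\to0$ as $s\to-\infty$, and this lift is a flow line of $h(z)=\frac{6+\rho}{4}\arg(z)+\pi$ on $M_0$; 2. there are $y_0>0$ and $x_0\in[-\infty,\infty)$ such that $\eta((-\infty,S))$ is the image of $\{x+iy_0:x\in(x_0,\infty)\}$ under $z\mapsto z^{-\frac{4}{2+\rho}}$, where the branch is chosen so that $\arg\bigl((x+iy_0)^{-\frac4{2+\rho}}\bigr)\to0$ as $x\to+\infty$, that is, $z^{-\frac4{2+\rho}}=\exp\bigl(-\tfrac4{2+\rho}\log z\bigr)$ with the principal logarithm. -/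

import Mathlib

open Set Filter Topology

noncomputable section

/-! ### Whole-plane Loewner chains from `∞`, seen from the reference point `0` -/

/-- `u s = g_s(z)`, for `s ≤ t`, is the trajectory of the point `z` under the whole-plane Loewner
equation `∂ₛ g_s(z) = g_s(z) (W_s + g_s(z)) / (W_s - g_s(z))` with driving function
`W_s = exp (i w_s)` and initial condition `e^{-s} g_s(z) → z` as `s → -∞`; it stays in the open
unit disk up to and including the time `t`. -/
structure IsWholePlaneLoewnerTrajectory (w : ℝ → ℝ) (t : ℝ) (z : ℂ) (u : ℝ → ℂ) : Prop where
  norm_lt_one : ∀ s ≤ t, ‖u s‖ < 1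
  hasDeriv : ∀ s ≤ t, HasDerivWithinAt u
    (u s * ((Complex.exp (Complex.I * (w s : ℂ)) + u s) /
      (Complex.exp (Complex.I * (w s : ℂ)) - u s))) (Iic t) s
  initial : Tendsto (fun s : ℝ => (Real.exp (-s) : ℂ) * u s) atBot (𝓝 z)

/-- The domain of the mapping-out function `g_t : D_t → 𝔻` (with `g_t(0) = 0`, `g_t'(0) = e^t`) of
the whole-plane Loewner chain from `∞` driven by `exp (i w)`: the points `z` for which the Loewner
equation can be solved up to and including time `t`. The hull at time `t` is the complement. -/
def wholePlaneLoewnerDomain (w : ℝ → ℝ) (t : ℝ) : Set ℂ :=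
  {z | ∃ u : ℝ → ℂ, IsWholePlaneLoewnerTrajectory w t z u}

/-- The whole-plane Loewner chain driven by `exp (i w)`, `t ∈ (-∞, T)`, is the simple curve
`γ : (-∞, T) → ℂ` starting at `∞`: the domain of the mapping-out function at each time `t < T` is
the complement of `γ((-∞, t])`. -/
structure IsWholePlaneLoewnerCurve (w : ℝ → ℝ) (T : ℝ) (γ : ℝ → ℂ) : Prop where
  continuousOn : ContinuousOn γ (Iio T)
  injOn : InjOn γ (Iio T)
  start : Tendsto (fun t => ‖γ t‖) atBot atTop
  domain_eq : ∀ t < T, wholePlaneLoewnerDomain w t = (γ '' Iic t)ᶜ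

/-! ### Whole-plane SLE₀(ρ), `ρ < -2` -/

/-- The driving angle `w_t`, `t < T`, of the positively oriented whole-plane SLE₀(ρ) started at `∞`
in the direction `exp (i θ)`, with reference point `0` and force point `∞`; `T` is the parameter of
the conformal radius. -/
def wholePlaneSLEDriving (ρ T θ t : ℝ) : ℝ :=
  2 * ρ / (ρ + 2) * Real.arcsin (Real.exp ((ρ + 2) / 4 * (T - t))) + θ

/-- The interval `(-∞, S)`, where `S ∈ [-∞, ∞]`. -/
def belowEReal (S : EReal) : Set ℝ := {s : ℝ | (s : EReal) < S}

/-- `η : (-∞, S) → ℂ` is an arc-length parametrization of the positively oriented whole-plane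
SLE₀(ρ) started at `∞` in the direction `exp (i θ)`, with reference point `0` and force point `∞`:
it is an increasing reparametrization of the Loewner curve, and the length of `η` between the
parameters `a ≤ b` is `b - a`. -/
def IsArcLengthWholePlaneSLE (ρ T θ : ℝ) (S : EReal) (η : ℝ → ℂ) : Prop :=
  HasUnitSpeedOn η (belowEReal S) ∧
    ∃ (γ : ℝ → ℂ) (σ : ℝ → ℝ),
      IsWholePlaneLoewnerCurve (wholePlaneSLEDriving ρ T θ) T γ ∧
      StrictMonoOn σ (Iio T) ∧ σ '' Iio T = belowEReal S ∧
      ∀ t < T, η (σ t) = γ t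

/-! ### The logarithmic Riemann surface centred at `0` and flow lines on it -/

/-- The logarithmic Riemann surface `M₀ = {(r, θ) : r > 0, θ ∈ ℝ}`. The product topology is the one
for which the projection `(r, θ) ↦ r exp (i θ)` is a local homeomorphism. -/
abbrev LogSurface : Type := {r : ℝ // 0 < r} × ℝ

namespace LogSurface

/-- The projection `(r, θ) ↦ r exp (i θ)`. -/
def proj (p : LogSurface) : ℂ := ((p.1 : ℝ) : ℂ) * Complex.exp (Complex.I * (p.2 : ℂ))

/-- The single-valued argument on `M₀`. -/
def arg (p : LogSurface) : ℝ := p.2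

end LogSurface

/-- `η'` is a (continuous) lift to `M₀` of the curve `η` defined on `J`. -/
def IsLiftOn (η' : ℝ → LogSurface) (η : ℝ → ℂ) (J : Set ℝ) : Prop :=
  ContinuousOn η' J ∧ ∀ s ∈ J, (η' s).proj = η s

/-- A curve `η'` in `M₀` with parameter set `J` (an open set) is a flow line of the field
`h : M₀ → ℝ`: it is `C¹` and `η'(s)' = exp (i h(η'(s)))`, the derivative being taken in the
coordinate `LogSurface.proj`. In particular it is parametrized by arc length. -/
structure IsFlowLineOn (h : LogSurface → ℝ) (η' : ℝ → LogSurface) (J : Set ℝ) : Prop where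
  continuousOn : ContinuousOn η' J
  contDiffOn : ContDiffOn ℝ 1 (fun s => (η' s).proj) J
  hasDerivAt : ∀ s ∈ J,
    HasDerivAt (fun s => (η' s).proj) (Complex.exp (Complex.I * (h (η' s) : ℂ))) s

end

open Set Filter Topology

noncomputable section

/-! ### Integrals depending on a complex parameter -/

/-! The Loewner chain is integrated explicitly. Put p = -(ρ+2)/4 > 0, sin α = e^{-p(T-t)} and τ =
tan α, so that the driving angle is (2 + 1/p)α. Rotate the disk by e^{-iα/p} and map it to the right
half-plane by a Cayley transform; the driving point becomes -iτ. In this coordinate c the inverse of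
g_t is f_t(c) = (e^{-T}/4)(1 - c²)(1/τ + iB(c))^{1/p}, where B solves (1 - c²)B' = -2p(1 - cB) and
is regular at c = 1. The equation for B makes f_t constant along trajectories
(`hasDerivWithinAt_sleF_comp`), and the limit at t = -∞ identifies the constant with the starting
point (`tendsto_sleF_atBot`, `sleF_trajectory`).

The integrating factor (1 - c²)^p extends B to the imaginary axis. At c = -iτ it gives f_t = (X +
iY)^{1/p} with Y > 0 independent of t and X strictly decreasing in t: the tip runs along the image
of a horizontal line.

That the hull is exactly the set of tips rests on ODE theory for v = u/r, r = e^s, which removes the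
singularity at s = -∞. Backward solvability from every point of the disk makes the domain the image
of the half-plane under f_t, and uniqueness makes f_t injective. A tip in the domain would
contradict injectivity, since f_t is open and tends to the tip at the boundary
(`sleTip_notMem_domain`). A point outside the domain has trajectories coming arbitrarily close to
the driving point, and passing to the limit shows that it is a tip (`mem_domain_or_eq_sleTip`).

For p < 1/2 the full power curve crosses itself, so simplicity needs the domain: if the curve closed
up, the connected domain containing 0 would be trapped inside the loop, and a whole circle would
have to lie on the curve, which meets each circle about 0 at most twice (`arctan_sleAbscissa_lt`).

Finally, arc-length parametrizations are unique up to a shift. With a = 1/p, the argument of the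
curve is a·arg(X + iY), while its direction, traversed with X decreasing, is (a - 1)·arg(X + iY) +
π. The ratio (a - 1)/a = 1 - p = (6+ρ)/4 is the coefficient of the flow line field. -/

theorem hasDerivAt_integral_of_continuousOn_prod {F F' : ℂ → ℝ → ℂ} {U : Set ℂ} (hU : IsOpen U)
    (hF : ContinuousOn (fun x : ℂ × ℝ => F x.1 x.2) (U ×ˢ Icc (0 : ℝ) 1))
    (hF' : ContinuousOn (fun x : ℂ × ℝ => F' x.1 x.2) (U ×ˢ Icc (0 : ℝ) 1))
    (hd : ∀ c ∈ U, ∀ q ∈ Icc (0 : ℝ) 1, HasDerivAt (fun x => F x q) (F' c q) c)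
    {c : ℂ} (hc : c ∈ U) :
    HasDerivAt (fun x => ∫ q in (0 : ℝ)..1, F x q) (∫ q in (0 : ℝ)..1, F' c q) c := by
  obtain ⟨ε, hε, hball⟩ := Metric.nhds_basis_closedBall.mem_iff.1 (hU.mem_nhds hc)
  have hK : IsCompact (Metric.closedBall c ε ×ˢ Icc (0 : ℝ) 1) :=
    (isCompact_closedBall c ε).prod isCompact_Icc
  obtain ⟨C, hC⟩ := hK.exists_bound_of_continuousOn
    (hF'.mono (prod_mono hball Subset.rfl))
  have slice : ∀ {G : ℂ → ℝ → ℂ}, ContinuousOn (fun x : ℂ × ℝ => G x.1 x.2) (U ×ˢ Icc (0 : ℝ) 1) →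
      ∀ x ∈ U, ContinuousOn (G x) (Icc (0 : ℝ) 1) := fun hG x hx =>
    hG.comp (f := fun q : ℝ => (x, q)) (by fun_prop) (fun q hq => ⟨hx, hq⟩)
  have int : ∀ {G : ℂ → ℝ → ℂ}, ContinuousOn (fun x : ℂ × ℝ => G x.1 x.2) (U ×ˢ Icc (0 : ℝ) 1) →
      ∀ x ∈ U, IntervalIntegrable (G x) MeasureTheory.volume 0 1 := fun {G} hG x hx =>
    ContinuousOn.intervalIntegrable (by rw [uIcc_of_le zero_le_one]; exact slice hG x hx)
  refine (intervalIntegral.hasDerivAt_integral_of_dominated_loc_of_deriv_le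
    (s := Metric.closedBall c ε) (bound := fun _ => C) (Metric.closedBall_mem_nhds c hε) ?_
    (int hF c hc) (intervalIntegrable_iff.1 (int hF' c hc)).aestronglyMeasurable ?_ (by simp) ?_).2
  · filter_upwards [hU.mem_nhds hc] with x hx
    exact (intervalIntegrable_iff.1 (int hF x hx)).aestronglyMeasurable
  · refine Eventually.of_forall fun q hq x hx => hC (x, q) ⟨hx, ?_⟩
    rw [uIoc_of_le zero_le_one] at hq
    exact ⟨hq.1.le, hq.2⟩
  · refine Eventually.of_forall fun q hq x hx => hd x (hball hx) q ?_
    rw [uIoc_of_le zero_le_one] at hq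
    exact ⟨hq.1.le, hq.2⟩

/-! ### The function `B` on the right half-plane -/

/-- The open right half-plane. -/
def rightHalfPlane : Set ℂ := {c | 0 < c.re}

theorem isOpen_rightHalfPlane : IsOpen rightHalfPlane :=
  isOpen_lt continuous_const Complex.continuous_re

theorem convex_rightHalfPlane : Convex ℝ rightHalfPlane :=
  convex_halfSpace_re_gt 0

/-- The radicand in the definition of `sleB`. -/
def sleRad (p : ℝ) (c : ℂ) (q : ℝ) : ℂ := 1 - ((q ^ (1 / p) : ℝ) : ℂ) * (1 - c ^ 2)

/-- The solution of `(1 - c²) B' = -2p (1 - c B)` that is regular in the right half-plane. -/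
def sleB (p : ℝ) (c : ℂ) : ℂ := ∫ q in (0 : ℝ)..1, (sleRad p c q) ^ (-1 / 2 : ℂ)

theorem sq_mem_slitPlane {c : ℂ} (hc : c ∈ rightHalfPlane) : c ^ 2 ∈ Complex.slitPlane := by
  have h : 0 < c.re := hc
  rw [Complex.mem_slitPlane_iff]
  by_cases him : c.im = 0
  · left
    have : (c ^ 2).re = c.re ^ 2 - c.im ^ 2 := by simp [pow_two]
    rw [this, him]; nlinarith
  · right
    have : (c ^ 2).im = 2 * c.re * c.im := by simp [pow_two]; ring
    rw [this]; exact mul_ne_zero (mul_ne_zero two_ne_zero h.ne') him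

/-- The radicand is a convex combination of 1 and c², and the slit plane is star-shaped about 1. -/
theorem sleRad_mem_slitPlane {p : ℝ} (hp : 0 < p) {c : ℂ} (hc : c ∈ rightHalfPlane) {q : ℝ}
    (hq : q ∈ Icc (0 : ℝ) 1) : sleRad p c q ∈ Complex.slitPlane := by
  have h0 : 0 ≤ q ^ (1 / p) := Real.rpow_nonneg hq.1 _
  have h1 : q ^ (1 / p) ≤ 1 := Real.rpow_le_one hq.1 hq.2 (by positivity)
  have := Complex.starConvex_one_slitPlane (sq_mem_slitPlane hc)
    (a := 1 - q ^ (1 / p)) (b := q ^ (1 / p)) (by linarith) h0 (by ring)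
  convert this using 1
  simp only [sleRad, Complex.real_smul]
  push_cast; ring

theorem continuous_sleRad {p : ℝ} (hp : 0 < p) :
    Continuous fun x : ℂ × ℝ => sleRad p x.1 x.2 := by
  have : Continuous fun x : ℂ × ℝ => x.2 ^ (1 / p) :=
    (Real.continuous_rpow_const (by positivity)).comp continuous_snd
  unfold sleRad
  fun_prop

theorem continuousOn_sleRad_cpow {p : ℝ} (hp : 0 < p) (s : ℂ) :
    ContinuousOn (fun x : ℂ × ℝ => sleRad p x.1 x.2 ^ s) (rightHalfPlane ×ˢ Icc (0 : ℝ) 1) :=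
  (continuous_sleRad hp).continuousOn.cpow continuousOn_const
    fun _ hx => sleRad_mem_slitPlane hp hx.1 hx.2

theorem hasDerivAt_sleRad (p : ℝ) (c : ℂ) (q : ℝ) :
    HasDerivAt (fun x => sleRad p x q) (2 * ((q ^ (1 / p) : ℝ) : ℂ) * c) c := by
  have := ((hasDerivAt_pow 2 c).const_sub 1).const_mul ((q ^ (1 / p) : ℝ) : ℂ) |>.const_sub 1
  refine this.congr_deriv ?_
  push_cast; ring

theorem hasDerivAt_sleB_aux {p : ℝ} (hp : 0 < p) {c : ℂ} (hc : c ∈ rightHalfPlane) :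
    HasDerivAt (sleB p) (∫ q in (0 : ℝ)..1,
      (-1 / 2 : ℂ) * sleRad p c q ^ (-1 / 2 - 1 : ℂ) * (2 * ((q ^ (1 / p) : ℝ) : ℂ) * c)) c := by
  have hq : Continuous fun x : ℂ × ℝ => ((x.2 ^ (1 / p) : ℝ) : ℂ) :=
    Complex.continuous_ofReal.comp
      ((Real.continuous_rpow_const (by positivity)).comp continuous_snd)
  refine hasDerivAt_integral_of_continuousOn_prod (F' := fun c q => (-1 / 2 : ℂ) *
    sleRad p c q ^ (-1 / 2 - 1 : ℂ) * (2 * ((q ^ (1 / p) : ℝ) : ℂ) * c)) isOpen_rightHalfPlane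
    (continuousOn_sleRad_cpow hp _) ?_ ?_ hc
  · exact (continuousOn_const.mul (continuousOn_sleRad_cpow hp _)).mul
      (by fun_prop)
  · intro c hc q hq
    exact (hasDerivAt_sleRad p c q).cpow_const (sleRad_mem_slitPlane hp hc hq)

/-- The q-derivative of c·q·(radicand)^{-1/2} is a combination of the integrands of `sleB` and of
its derivative, so the differential equation is the fundamental theorem of calculus on [0, 1]. -/
theorem sleB_integral_by_parts {p : ℝ} (hp : 0 < p) {c : ℂ} (hc : c ∈ rightHalfPlane) :
    (1 - c ^ 2) * (∫ q in (0 : ℝ)..1,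
      (-1 / 2 : ℂ) * sleRad p c q ^ (-1 / 2 - 1 : ℂ) * (2 * ((q ^ (1 / p) : ℝ) : ℂ) * c)) =
      -2 * p * (1 - c * sleB p c) := by
  have hpc : (p : ℂ) ≠ 0 := by exact_mod_cast hp.ne'
  have hc0 : c ≠ 0 := fun h => by simp [rightHalfPlane, h] at hc
  have slice : ∀ s : ℂ, ContinuousOn (fun q : ℝ => sleRad p c q ^ s) (Icc (0 : ℝ) 1) := fun s =>
    (continuousOn_sleRad_cpow hp s).comp (f := fun q : ℝ => (c, q)) (by fun_prop)
      (fun q hq => ⟨hc, hq⟩)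
  have hcq : Continuous fun q : ℝ => ((q ^ (1 / p) : ℝ) : ℂ) :=
    Complex.continuous_ofReal.comp (Real.continuous_rpow_const (by positivity))
  have cont1 : ContinuousOn (fun q : ℝ => sleRad p c q ^ (-1 / 2 : ℂ)) (Icc (0 : ℝ) 1) := slice _
  have cont2 : ContinuousOn (fun q : ℝ => (-1 / 2 : ℂ) * sleRad p c q ^ (-1 / 2 - 1 : ℂ) *
      (2 * ((q ^ (1 / p) : ℝ) : ℂ) * c)) (Icc (0 : ℝ) 1) :=
    (continuousOn_const.mul (slice _)).mul
      ((continuous_const.mul hcq).mul continuous_const).continuousOn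
  have int1 : IntervalIntegrable (fun q : ℝ => sleRad p c q ^ (-1 / 2 : ℂ))
      MeasureTheory.volume 0 1 :=
    ContinuousOn.intervalIntegrable (by rwa [uIcc_of_le zero_le_one])
  have int2 := ContinuousOn.intervalIntegrable (μ := MeasureTheory.volume)
    (by rwa [uIcc_of_le (zero_le_one' ℝ)] : ContinuousOn _ (uIcc (0 : ℝ) 1))
    |> fun h : IntervalIntegrable (fun q : ℝ => (-1 / 2 : ℂ) * sleRad p c q ^ (-1 / 2 - 1 : ℂ) *
      (2 * ((q ^ (1 / p) : ℝ) : ℂ) * c)) MeasureTheory.volume 0 1 => h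
  have key := intervalIntegral.integral_eq_sub_of_hasDerivAt_of_le (zero_le_one' ℝ)
    (f := fun q : ℝ => c * ((q : ℂ) * sleRad p c q ^ (-1 / 2 : ℂ)))
    (f' := fun q : ℝ => c * sleRad p c q ^ (-1 / 2 : ℂ) - (1 - c ^ 2) / (2 * p) *
      ((-1 / 2 : ℂ) * sleRad p c q ^ (-1 / 2 - 1 : ℂ) * (2 * ((q ^ (1 / p) : ℝ) : ℂ) * c)))
    (continuousOn_const.mul (Complex.continuous_ofReal.continuousOn.mul cont1)) ?_
    ((int1.const_mul c).sub (int2.const_mul _))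
  · rw [intervalIntegral.integral_sub (int1.const_mul c) (int2.const_mul _),
      intervalIntegral.integral_const_mul, intervalIntegral.integral_const_mul] at key
    have hend : c * (((1 : ℝ) : ℂ) * sleRad p c 1 ^ (-1 / 2 : ℂ)) = 1 := by
      have : sleRad p c 1 = c ^ 2 := by simp [sleRad]
      rw [this]
      -- The principal root of c² is c because |arg c| < π/2; this fixes the boundary term at q = 1.
      have h1 : (c ^ 2) ^ (-1 / 2 : ℂ) = c⁻¹ := by
        have harg := Complex.abs_arg_lt_pi_div_two_iff.2 (Or.inl (show 0 < c.re from hc))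
        rw [abs_lt] at harg
        have h2 : ((2 : ℕ) : ℂ) * (-1 / 2 : ℂ) = -1 := by push_cast; ring
        have h3 := Complex.pow_cpow_nat_inv (x := c) (n := 2) (by norm_num)
          (by push_cast; linarith [harg.1]) (by push_cast; linarith [harg.2])
        have h4 : (-1 / 2 : ℂ) = -(((2 : ℕ) : ℂ)⁻¹) := by push_cast; ring
        rw [h4, Complex.cpow_neg, h3]
      rw [h1]; simp [hc0]
    simp only [hend] at key
    have hB : ∫ q in (0 : ℝ)..1, sleRad p c q ^ (-1 / 2 : ℂ) = sleB p c := rfl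
    rw [hB] at key
    simp only [Complex.ofReal_zero, zero_mul, mul_zero, sub_zero] at key
    generalize (∫ q in (0 : ℝ)..1, (-1 / 2 : ℂ) * sleRad p c q ^ (-1 / 2 - 1 : ℂ) *
      (2 * ((q ^ (1 / p) : ℝ) : ℂ) * c)) = I at key ⊢
    field_simp at key
    linear_combination (-1 : ℂ) * key
  · intro q hq
    have hq' : q ∈ Icc (0 : ℝ) 1 := ⟨hq.1.le, hq.2.le⟩
    have hr : HasDerivAt (fun q : ℝ => sleRad p c q)
        (-(((1 / p * q ^ (1 / p - 1) : ℝ) : ℂ) * (1 - c ^ 2))) q := by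
      have h := (Real.hasDerivAt_rpow_const (x := q) (p := 1 / p) (Or.inl hq.1.ne')).ofReal_comp
      exact (h.mul_const (1 - c ^ 2)).const_sub 1
    have h1 : HasDerivAt (fun q : ℝ => sleRad p c q ^ (-1 / 2 : ℂ)) _ q :=
      HasDerivAt.comp q
        (((hasDerivAt_id (sleRad p c q)).cpow_const (c := (-1 / 2 : ℂ))
          (sleRad_mem_slitPlane hp hc hq'))) hr
    have h2 := ((Complex.ofRealCLM.hasDerivAt (x := q)).mul h1).const_mul c
    refine h2.congr_deriv ?_
    have hqp : q ^ (1 / p) = q * q ^ (1 / p - 1) := by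
      rw [← Real.rpow_one_add' hq.1.le (by simp [hp.ne'])]; ring_nf
    rw [hqp]
    simp only [Complex.ofRealCLM_apply, id]
    push_cast
    field_simp
    ring

theorem hasDerivAt_sleB {p : ℝ} (hp : 0 < p) {c : ℂ} (hc : c ∈ rightHalfPlane) :
    ∃ B' : ℂ, HasDerivAt (sleB p) B' c ∧ (1 - c ^ 2) * B' = -2 * p * (1 - c * sleB p c) :=
  ⟨_, hasDerivAt_sleB_aux hp hc, sleB_integral_by_parts hp hc⟩

/-- The power -1/2 halves an argument in (-π, π), so the integrand has positive real part. This
keeps 1/τ + iB in the upper half-plane, where the principal logarithm is analytic. -/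
theorem sleB_re_pos {p : ℝ} (hp : 0 < p) {c : ℂ} (hc : c ∈ rightHalfPlane) :
    0 < (sleB p c).re := by
  have slice : ContinuousOn (fun q : ℝ => sleRad p c q ^ (-1 / 2 : ℂ)) (Icc (0 : ℝ) 1) :=
    (continuousOn_sleRad_cpow hp _).comp (f := fun q : ℝ => (c, q)) (by fun_prop)
      (fun q hq => ⟨hc, hq⟩)
  have hint : IntervalIntegrable (fun q : ℝ => sleRad p c q ^ (-1 / 2 : ℂ))
      MeasureTheory.volume 0 1 :=
    ContinuousOn.intervalIntegrable (by rwa [uIcc_of_le zero_le_one])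
  have hre : (sleB p c).re = ∫ q in (0 : ℝ)..1, (sleRad p c q ^ (-1 / 2 : ℂ)).re := by
    have := Complex.reCLM.intervalIntegral_comp_comm hint
    simpa [sleB] using this.symm
  rw [hre]
  refine intervalIntegral.intervalIntegral_pos_of_pos_on ?_ ?_ zero_lt_one
  · exact ContinuousOn.intervalIntegrable (by
      rw [uIcc_of_le zero_le_one]; exact Complex.continuous_re.comp_continuousOn slice)
  · intro q hq
    have hs := sleRad_mem_slitPlane hp hc (Ioo_subset_Icc_self hq)
    have harg := Complex.mem_slitPlane_iff_arg.1 hs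
    have h1 := Complex.neg_pi_lt_arg (sleRad p c q)
    have h2 := Complex.arg_le_pi (sleRad p c q)
    have h2' := lt_of_le_of_ne h2 harg.1
    rw [Complex.cpow_def_of_ne_zero harg.2, Complex.exp_re]
    refine mul_pos (Real.exp_pos _) (Real.cos_pos_of_mem_Ioo ?_)
    have him : (Complex.log (sleRad p c q) * (-1 / 2 : ℂ)).im = -(sleRad p c q).arg / 2 := by
      have : (-1 / 2 : ℂ) = ((-1 / 2 : ℝ) : ℂ) := by push_cast; ring
      rw [this, Complex.im_mul_ofReal, Complex.log_im]; ring
    rw [him]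
    constructor <;> linarith

theorem sleB_ofReal_im {p : ℝ} (hp : 0 < p) {x : ℝ} (hx : 0 < x) : (sleB p x).im = 0 := by
  have h : ∀ q ∈ uIcc (0 : ℝ) 1, sleRad p x q ^ (-1 / 2 : ℂ) =
      (((1 - q ^ (1 / p) * (1 - x ^ 2)) ^ (-1 / 2 : ℝ) : ℝ) : ℂ) := by
    intro q hq
    rw [uIcc_of_le zero_le_one] at hq
    have hs := sleRad_mem_slitPlane hp (c := x) (by simpa [rightHalfPlane] using hx) hq
    have he : sleRad p x q = ((1 - q ^ (1 / p) * (1 - x ^ 2) : ℝ) : ℂ) := by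
      simp [sleRad]
    rw [he] at hs ⊢
    rw [Complex.ofReal_mem_slitPlane] at hs
    rw [Complex.ofReal_cpow hs.le]
    push_cast; rfl
  have : sleB p x = ((∫ q in (0 : ℝ)..1, (1 - q ^ (1 / p) * (1 - x ^ 2)) ^ (-1 / 2 : ℝ) : ℝ) : ℂ) := by
    rw [sleB, intervalIntegral.integral_congr h, intervalIntegral.integral_ofReal]
  rw [this, Complex.ofReal_im]

theorem sleB_one (p : ℝ) : sleB p 1 = 1 := by
  simp [sleB, sleRad]

/-! ### Boundary values of `B` on the imaginary axis -/

/-- The vertical strip `|Re c| < 1`. -/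
def unitStrip : Set ℂ := {c | -1 < c.re ∧ c.re < 1}

theorem isOpen_unitStrip : IsOpen unitStrip :=
  (isOpen_lt continuous_const Complex.continuous_re).inter
    (isOpen_lt Complex.continuous_re continuous_const)

theorem convex_unitStrip : Convex ℝ unitStrip :=
  (convex_halfSpace_re_gt (-1)).inter (convex_halfSpace_re_lt 1)

theorem one_sub_sq_mem_slitPlane {c : ℂ} (hc : c ∈ unitStrip) : 1 - c ^ 2 ∈ Complex.slitPlane := by
  obtain ⟨h1, h2⟩ := hc
  rw [Complex.mem_slitPlane_iff]
  have hre : (1 - c ^ 2).re = 1 - c.re ^ 2 + c.im ^ 2 := by simp [pow_two]; ring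
  have him : (1 - c ^ 2).im = -(2 * c.re * c.im) := by simp [pow_two]; ring
  by_cases h : 2 * c.re * c.im = 0
  · left
    rw [hre]; nlinarith [sq_nonneg c.im]
  · right
    rw [him]; exact neg_ne_zero.2 h

theorem mul_mem_unitStrip {c : ℂ} (hc : c ∈ unitStrip) {x : ℝ} (hx : x ∈ Icc (0 : ℝ) 1) :
    (x : ℂ) * c ∈ unitStrip := by
  obtain ⟨h1, h2⟩ := hc
  obtain ⟨h3, h4⟩ := hx
  have hre : ((x : ℂ) * c).re = x * c.re := by simp
  constructor <;> rw [hre] <;> nlinarith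

/-- The primitive of `-2p (1 - c²) ^ (p - 1)` vanishing at `0`. -/
def sleP (p : ℝ) (c : ℂ) : ℂ :=
  -2 * p * ∫ x in (0 : ℝ)..1, c * (1 - ((x : ℂ) * c) ^ 2) ^ ((p : ℂ) - 1)

theorem hasDerivAt_one_sub_mul_sq (x : ℝ) (c : ℂ) :
    HasDerivAt (fun y : ℂ => 1 - ((x : ℂ) * y) ^ 2) (-2 * (x : ℂ) ^ 2 * c) c := by
  have := (((hasDerivAt_id c).const_mul (x : ℂ)).pow 2).const_sub 1
  refine this.congr_deriv ?_
  simp; ring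

theorem hasDerivAt_one_sub_sq_cpow (s : ℂ) {c : ℂ} (hc : c ∈ unitStrip) :
    HasDerivAt (fun y : ℂ => (1 - y ^ 2) ^ s) (s * (1 - c ^ 2) ^ (s - 1) * (-2 * c)) c := by
  have h := ((hasDerivAt_pow 2 c).const_sub 1)
  have := h.cpow_const (c := s) (one_sub_sq_mem_slitPlane hc)
  refine this.congr_deriv ?_
  push_cast; ring

theorem hasDerivAt_sleP (p : ℝ) {c : ℂ} (hc : c ∈ unitStrip) :
    HasDerivAt (sleP p) (-2 * p * (1 - c ^ 2) ^ ((p : ℂ) - 1)) c := by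
  have hcont : ∀ s : ℂ, ContinuousOn (fun x : ℂ × ℝ => (1 - ((x.2 : ℂ) * x.1) ^ 2) ^ s)
      (unitStrip ×ˢ Icc (0 : ℝ) 1) := fun s =>
    (by fun_prop : Continuous fun x : ℂ × ℝ => 1 - ((x.2 : ℂ) * x.1) ^ 2).continuousOn.cpow
      continuousOn_const
      fun x hx => one_sub_sq_mem_slitPlane (mul_mem_unitStrip hx.1 hx.2)
  have hF' : ContinuousOn (fun x : ℂ × ℝ => (1 - ((x.2 : ℂ) * x.1) ^ 2) ^ ((p : ℂ) - 1) +
      x.1 * (((p : ℂ) - 1) * (1 - ((x.2 : ℂ) * x.1) ^ 2) ^ ((p : ℂ) - 1 - 1) *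
        (-2 * (x.2 : ℂ) ^ 2 * x.1))) (unitStrip ×ˢ Icc (0 : ℝ) 1) :=
    (hcont _).add (continuousOn_fst.mul ((continuousOn_const.mul (hcont _)).mul
      (by fun_prop : Continuous fun x : ℂ × ℝ => -2 * (x.2 : ℂ) ^ 2 * x.1).continuousOn))
  have h := hasDerivAt_integral_of_continuousOn_prod (U := unitStrip)
    (F := fun c x => c * (1 - ((x : ℂ) * c) ^ 2) ^ ((p : ℂ) - 1))
    (F' := fun c x => (1 - ((x : ℂ) * c) ^ 2) ^ ((p : ℂ) - 1) +
      c * (((p : ℂ) - 1) * (1 - ((x : ℂ) * c) ^ 2) ^ ((p : ℂ) - 1 - 1) *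
        (-2 * (x : ℂ) ^ 2 * c))) isOpen_unitStrip
    (continuousOn_fst.mul (hcont _)) hF' ?_ hc
  · refine (h.const_mul (-2 * p : ℂ)).congr_deriv ?_
    congr 1
    have hcts : ContinuousOn (fun x : ℝ => (1 - ((x : ℂ) * c) ^ 2) ^ ((p : ℂ) - 1) +
      c * (((p : ℂ) - 1) * (1 - ((x : ℂ) * c) ^ 2) ^ ((p : ℂ) - 1 - 1) *
        (-2 * (x : ℂ) ^ 2 * c))) (uIcc (0 : ℝ) 1) := by
      rw [uIcc_of_le (zero_le_one' ℝ)]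
      exact hF'.comp (f := fun q : ℝ => (c, q)) (by fun_prop) (fun q hq => ⟨hc, hq⟩)
    -- The differentiated integrand is itself the x-derivative of x(1 - (xc)²)^{p-1}.
    rw [intervalIntegral.integral_eq_sub_of_hasDerivAt
      (f := fun x : ℝ => (x : ℂ) * (1 - ((x : ℂ) * c) ^ 2) ^ ((p : ℂ) - 1))
      ?_ hcts.intervalIntegrable]
    · simp
    · intro x hx
      rw [uIcc_of_le (zero_le_one' ℝ)] at hx
      have h1 : HasDerivAt (fun y : ℝ => 1 - ((y : ℂ) * c) ^ 2) (-2 * (x : ℂ) * c ^ 2) x := by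
        have := (((Complex.ofRealCLM.hasDerivAt (x := x)).mul_const c).pow 2).const_sub 1
        refine this.congr_deriv ?_
        simp; ring
      have h2 : HasDerivAt (fun y : ℝ => (1 - ((y : ℂ) * c) ^ 2) ^ ((p : ℂ) - 1)) _ x :=
        HasDerivAt.comp x (h₂ := fun z : ℂ => z ^ ((p : ℂ) - 1))
          (h := fun y : ℝ => 1 - ((y : ℂ) * c) ^ 2)
          ((hasDerivAt_id (1 - ((x : ℂ) * c) ^ 2)).cpow_const
          (c := (p : ℂ) - 1) (one_sub_sq_mem_slitPlane (mul_mem_unitStrip hc hx))) h1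
      refine ((Complex.ofRealCLM.hasDerivAt (x := x)).mul h2).congr_deriv ?_
      simp; ring
  · intro c hc x hx
    have h1 := (hasDerivAt_one_sub_mul_sq x c).cpow_const (c := (p : ℂ) - 1)
      (one_sub_sq_mem_slitPlane (mul_mem_unitStrip hc hx))
    refine ((hasDerivAt_id c).mul h1).congr_deriv ?_
    simp

/-- The constant of integration relating `sleB` and `sleP`. -/
def sleK (p : ℝ) : ℝ := ((1 - (1 / 2 : ℂ) ^ 2) ^ (p : ℂ) * sleB p (1 / 2) - sleP p (1 / 2)).re

/-- (1 - c²)^p is an integrating factor for the equation of B, and both sides are analytic on the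
convex overlap of the half-plane and the strip; the constant is read off at the base point 1/2. -/
theorem one_sub_sq_cpow_mul_sleB {p : ℝ} (hp : 0 < p) {c : ℂ} (hc : c ∈ rightHalfPlane)
    (hc' : c ∈ unitStrip) : (1 - c ^ 2) ^ (p : ℂ) * sleB p c =
      ((1 - (1 / 2 : ℂ) ^ 2) ^ (p : ℂ) * sleB p (1 / 2) - sleP p (1 / 2)) + sleP p c := by
  have hd : ∀ x ∈ rightHalfPlane ∩ unitStrip,
      HasDerivAt (fun c => (1 - c ^ 2) ^ (p : ℂ) * sleB p c - sleP p c) 0 x := by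
    intro x hx
    obtain ⟨B', hB', hode⟩ := hasDerivAt_sleB hp hx.1
    refine (((hasDerivAt_one_sub_sq_cpow p hx.2).mul hB').sub (hasDerivAt_sleP p hx.2)).congr_deriv ?_
    have hne : (1 - x ^ 2) ≠ 0 := Complex.slitPlane_ne_zero (one_sub_sq_mem_slitPlane hx.2)
    have : (1 - x ^ 2) ^ (p : ℂ) = (1 - x ^ 2) ^ ((p : ℂ) - 1) * (1 - x ^ 2) := by
      rw [Complex.cpow_sub _ _ hne]; field_simp; simp [hne]
    rw [this]
    linear_combination (1 - x ^ 2) ^ ((p : ℂ) - 1) * hode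
  have hopen := isOpen_rightHalfPlane.inter isOpen_unitStrip
  have hconv := convex_rightHalfPlane.inter convex_unitStrip
  have hhalf : (1 / 2 : ℂ) ∈ rightHalfPlane ∩ unitStrip := by
    have : (1 / 2 : ℂ).re = 1 / 2 := by norm_num
    refine ⟨?_, ?_, ?_⟩ <;> simp only [rightHalfPlane, mem_ofPred_eq, this] <;> norm_num
  have := hopen.is_const_of_deriv_eq_zero hconv.isPreconnected
    (fun x hx => (hd x hx).differentiableAt.differentiableWithinAt)
    (fun x hx => (hd x hx).deriv) ⟨hc, hc'⟩ hhalf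
  linear_combination this

theorem sleP_ofReal {p x : ℝ} (hx0 : 0 ≤ x) (hx1 : x < 1) :
    sleP p x = ((-2 * p * ∫ y in (0 : ℝ)..1, x * (1 - (y * x) ^ 2) ^ (p - 1) : ℝ) : ℂ) := by
  rw [sleP]
  push_cast
  rw [← intervalIntegral.integral_ofReal]
  congr 1
  refine intervalIntegral.integral_congr fun y hy => ?_
  rw [uIcc_of_le (zero_le_one' ℝ)] at hy
  have : 0 ≤ 1 - (y * x) ^ 2 := by
    have : y * x ≤ 1 := by nlinarith [hy.1, hy.2]
    have : 0 ≤ y * x := mul_nonneg hy.1 hx0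
    nlinarith
  rw [Complex.ofReal_mul, Complex.ofReal_cpow this]
  push_cast; rfl

/-- At the base point the term with B is positive and the primitive is nonpositive. This constant
becomes the height of the horizontal line. -/
theorem sleK_pos {p : ℝ} (hp : 0 < p) : 0 < sleK p := by
  have hhalf : (1 / 2 : ℂ) ∈ rightHalfPlane := by
    simp [rightHalfPlane]
  have hB := sleB_re_pos hp hhalf
  have h34 : (1 - (1 / 2 : ℂ) ^ 2) ^ (p : ℂ) = (((3 / 4 : ℝ) ^ p : ℝ) : ℂ) := by
    rw [Complex.ofReal_cpow (by norm_num)]; norm_num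
  have hP := sleP_ofReal (p := p) (x := 1 / 2) (by norm_num) (by norm_num)
  have hI : 0 ≤ ∫ y in (0 : ℝ)..1, (1 / 2 : ℝ) * (1 - (y * (1 / 2)) ^ 2) ^ (p - 1) := by
    refine intervalIntegral.integral_nonneg zero_le_one fun y hy => ?_
    refine mul_nonneg (by norm_num) (Real.rpow_nonneg ?_ _)
    nlinarith [hy.1, hy.2]
  have hcast : ((1 / 2 : ℝ) : ℂ) = 1 / 2 := by norm_num
  rw [hcast] at hP
  rw [sleK, Complex.sub_re, hP, Complex.ofReal_re, h34, Complex.re_ofReal_mul]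
  have h1 : 0 < (3 / 4 : ℝ) ^ p := Real.rpow_pos_of_pos (by norm_num) _
  have h2 := mul_pos h1 hB
  have h3 := mul_nonneg hp.le hI
  linarith

theorem sleK_eq {p : ℝ} (hp : 0 < p) :
    ((1 - (1 / 2 : ℂ) ^ 2) ^ (p : ℂ) * sleB p (1 / 2) - sleP p (1 / 2)) = sleK p := by
  refine Complex.ext (by simp [sleK]) ?_
  have hB := sleB_ofReal_im hp (x := 1 / 2) (by norm_num)
  have h34 : (1 - (1 / 2 : ℂ) ^ 2) ^ (p : ℂ) = (((3 / 4 : ℝ) ^ p : ℝ) : ℂ) := by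
    rw [Complex.ofReal_cpow (by norm_num)]; norm_num
  have hP := sleP_ofReal (p := p) (x := 1 / 2) (by norm_num) (by norm_num)
  have hcast : ((1 / 2 : ℝ) : ℂ) = 1 / 2 := by norm_num
  rw [hcast] at hP hB
  rw [Complex.sub_im, hP, Complex.ofReal_im, h34, Complex.im_ofReal_mul, hB, Complex.ofReal_im]
  simp

/-- The continuous extension of `sleB` to the strip. -/
def sleBExt (p : ℝ) (c : ℂ) : ℂ := (1 - c ^ 2) ^ (-p : ℂ) * (sleK p + sleP p c)

/-- The right side still makes sense on the imaginary axis, where the driving point lies; it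
supplies the boundary values of B. -/
theorem sleB_eq_sleBExt {p : ℝ} (hp : 0 < p) {c : ℂ} (hc : c ∈ rightHalfPlane)
    (hc' : c ∈ unitStrip) : sleB p c = sleBExt p c := by
  have hne : (1 - c ^ 2) ≠ 0 := Complex.slitPlane_ne_zero (one_sub_sq_mem_slitPlane hc')
  have hne' : (1 - c ^ 2) ^ (p : ℂ) ≠ 0 := by simp [Complex.cpow_eq_zero_iff, hne]
  rw [sleBExt, ← sleK_eq hp, ← one_sub_sq_cpow_mul_sleB hp hc hc', Complex.cpow_neg]
  field_simp

theorem continuousAt_sleBExt (p : ℝ) {c : ℂ} (hc : c ∈ unitStrip) :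
    ContinuousAt (sleBExt p) c :=
  (hasDerivAt_one_sub_sq_cpow _ hc).continuousAt.mul
    (continuousAt_const.add (hasDerivAt_sleP p hc).continuousAt)

theorem neg_I_mul_mem_unitStrip (x : ℝ) : -(Complex.I * x) ∈ unitStrip := by
  constructor <;> simp

/-- `∫₀^x (1 + y²)^(p-1) dy`. -/
def sleI (p x : ℝ) : ℝ := ∫ y in (0 : ℝ)..x, (1 + y ^ 2) ^ (p - 1)

theorem continuous_one_add_sq_rpow (s : ℝ) : Continuous fun y : ℝ => (1 + y ^ 2) ^ s :=
  (by fun_prop : Continuous fun y : ℝ => 1 + y ^ 2).rpow_const fun y => Or.inl (by positivity)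

theorem hasDerivAt_sleI (p x : ℝ) : HasDerivAt (sleI p) ((1 + x ^ 2) ^ (p - 1)) x :=
  intervalIntegral.integral_hasDerivAt_right
    ((continuous_one_add_sq_rpow _).intervalIntegrable _ _)
    (continuous_one_add_sq_rpow _).aestronglyMeasurable.stronglyMeasurableAtFilter
    (continuous_one_add_sq_rpow _).continuousAt

/-- On the imaginary axis 1 - c² is real, so the primitive is purely imaginary and leaves the real
part of `sleK p + sleP p c` unchanged. This is why the height of the tip does not depend on time. -/
theorem sleP_neg_I_mul (p x : ℝ) : sleP p (-(Complex.I * x)) = 2 * p * sleI p x * Complex.I := by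
  have h1 : sleI p x = x * ∫ y in (0 : ℝ)..1, (1 + (x * y) ^ 2) ^ (p - 1) := by
    have := intervalIntegral.mul_integral_comp_mul_left (a := 0) (b := 1)
      (f := fun y : ℝ => (1 + y ^ 2) ^ (p - 1)) x
    simp only [mul_zero, mul_one] at this
    rw [sleI, this]
  have h2 : ∀ y ∈ uIcc (0 : ℝ) 1, -(Complex.I * x) *
      (1 - ((y : ℂ) * -(Complex.I * x)) ^ 2) ^ ((p : ℂ) - 1) =
      -(Complex.I * x) * (((1 + (x * y) ^ 2) ^ (p - 1) : ℝ) : ℂ) := by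
    intro y _
    rw [Complex.ofReal_cpow (by positivity)]
    congr 1
    push_cast
    congr 1
    linear_combination (-(x : ℂ) ^ 2 * y ^ 2) * Complex.I_sq
  rw [sleP, intervalIntegral.integral_congr h2, intervalIntegral.integral_const_mul,
    intervalIntegral.integral_ofReal, h1]
  push_cast
  ring

theorem sleBExt_neg_I_mul (p x : ℝ) : sleBExt p (-(Complex.I * x)) =
    (((1 + x ^ 2) ^ (-p) : ℝ) : ℂ) * (sleK p + 2 * p * sleI p x * Complex.I) := by
  rw [sleBExt, sleP_neg_I_mul, Complex.ofReal_cpow (by positivity)]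
  congr 2
  · push_cast
    linear_combination (-(x : ℂ) ^ 2) * Complex.I_sq
  · push_cast; rfl

/-! ### The inverse Loewner map in half-plane coordinates -/

/-- The quantity `1/τ + i B(c)`. -/
def sleQ (p τ : ℝ) (c : ℂ) : ℂ := ((1 / τ : ℝ) : ℂ) + Complex.I * sleB p c

/-- The inverse of the mapping-out function at the time with `tan α = τ`, in the coordinate `c`
of the right half-plane. -/
def sleF (p T τ : ℝ) (c : ℂ) : ℂ :=
  (Real.exp (-T) / 4 : ℝ) * ((1 - c ^ 2) * Complex.exp ((1 / p : ℝ) * Complex.log (sleQ p τ c)))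

theorem sleQ_im_pos {p : ℝ} (hp : 0 < p) (τ : ℝ) {c : ℂ} (hc : c ∈ rightHalfPlane) :
    0 < (sleQ p τ c).im := by
  have := sleB_re_pos hp hc
  simpa [sleQ] using this

theorem sleQ_mem_slitPlane {p : ℝ} (hp : 0 < p) (τ : ℝ) {c : ℂ} (hc : c ∈ rightHalfPlane) :
    sleQ p τ c ∈ Complex.slitPlane :=
  Complex.mem_slitPlane_iff.2 (Or.inr (sleQ_im_pos hp τ hc).ne')

theorem add_I_mul_ne_zero {c : ℂ} (hc : c ∈ rightHalfPlane) (τ : ℝ) :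
    c + Complex.I * τ ≠ 0 := fun h => by
  have h1 : 0 < c.re := hc
  have := congrArg Complex.re h
  simp at this
  linarith

/-- By the equation for B, the derivative has the factor c + iτ, which vanishes only at the driving
point, off the half-plane. Nonvanishing yields openness of the map later. -/
theorem hasDerivAt_sleF {p : ℝ} (hp : 0 < p) (T : ℝ) {τ : ℝ} (hτ : 0 < τ) {c : ℂ}
    (hc : c ∈ rightHalfPlane) : ∃ d : ℂ, d ≠ 0 ∧ HasDerivAt (sleF p T τ) d c := by
  obtain ⟨B', hB', hode⟩ := hasDerivAt_sleB hp hc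
  have hQs := sleQ_mem_slitPlane hp τ hc
  have hQ0 := Complex.slitPlane_ne_zero hQs
  have hQ : HasDerivAt (sleQ p τ) (Complex.I * B') c := by
    exact (hB'.const_mul Complex.I).const_add ((1 / τ : ℝ) : ℂ)
  have hE := ((hQ.clog hQs).const_mul ((1 / p : ℝ) : ℂ)).cexp
  have h := (((hasDerivAt_pow 2 c).const_sub 1).mul hE).const_mul ((Real.exp (-T) / 4 : ℝ) : ℂ)
  refine ⟨(Real.exp (-T) / 4 : ℝ) * (Complex.exp ((1 / p : ℝ) * Complex.log (sleQ p τ c)) *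
    (-2 * (c + Complex.I * τ) / (τ * sleQ p τ c))), ?_, ?_⟩
  · have h1 : ((Real.exp (-T) / 4 : ℝ) : ℂ) ≠ 0 := by
      exact_mod_cast (by positivity : Real.exp (-T) / 4 ≠ 0)
    have h2 : (τ : ℂ) ≠ 0 := by exact_mod_cast hτ.ne'
    have h3 := add_I_mul_ne_zero hc τ
    have h4 : -2 * (c + Complex.I * τ) / (τ * sleQ p τ c) ≠ 0 :=
      div_ne_zero (mul_ne_zero (by norm_num) h3) (mul_ne_zero h2 hQ0)
    exact mul_ne_zero h1 (mul_ne_zero (Complex.exp_ne_zero _) h4)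
  · refine h.congr_deriv ?_
    congr 1
    have h2 : (τ : ℂ) ≠ 0 := by exact_mod_cast hτ.ne'
    have h3 : (p : ℂ) ≠ 0 := by exact_mod_cast hp.ne'
    have hdef : τ * sleQ p τ c = 1 + Complex.I * τ * sleB p c := by
      simp only [sleQ]; push_cast; field_simp
    generalize hEx : Complex.exp ((1 / p : ℝ) * Complex.log (sleQ p τ c)) = E
    simp only [Nat.cast_ofNat]
    push_cast
    generalize sleQ p τ c = Q at *
    field_simp
    have : Q * τ = 1 + Complex.I * τ * sleB p c := by rw [mul_comm]; exact hdef
    linear_combination E * ((τ : ℂ) * Complex.I * hode - 2 * c * p * this)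

/-- The logarithmic derivatives of 1 - c² and of `sleQ` to the power 1/p are c(1 + τ²)/(c + iτ) and
its negative. The hypotheses on τ and c are the Loewner equation in the half-plane coordinate. -/
theorem hasDerivWithinAt_sleF_comp {p : ℝ} (hp : 0 < p) (T : ℝ) {τ : ℝ → ℝ} {c : ℝ → ℂ} {S : Set ℝ}
    {s : ℝ} (hτ : 0 < τ s) (hc : c s ∈ rightHalfPlane)
    (hdτ : HasDerivWithinAt τ (p * τ s * (1 + τ s ^ 2)) S s)
    (hdc : HasDerivWithinAt c ((c s ^ 2 - 1) * (1 + τ s ^ 2) / (2 * (c s + Complex.I * τ s))) S s) :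
    HasDerivWithinAt (fun s => sleF p T (τ s) (c s)) 0 S s := by
  obtain ⟨B', hB', hode⟩ := hasDerivAt_sleB hp hc
  have hQs := sleQ_mem_slitPlane hp (τ s) hc
  have hQ0 := Complex.slitPlane_ne_zero hQs
  have h2 : (τ s : ℂ) ≠ 0 := by exact_mod_cast hτ.ne'
  have h3 := add_I_mul_ne_zero hc (τ s)
  have hpc : (p : ℂ) ≠ 0 := by exact_mod_cast hp.ne'
  have hinv : HasDerivWithinAt (fun s => ((1 / τ s : ℝ) : ℂ))
      ((-(p * (1 + τ s ^ 2) / τ s) : ℝ) : ℂ) S s := by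
    have := (hdτ.inv hτ.ne').ofReal_comp
    simp only [one_div]
    refine this.congr_deriv ?_
    congr 1
    field_simp
  have hBc : HasDerivWithinAt (fun s => sleB p (c s)) _ S s := hB'.comp_hasDerivWithinAt s hdc
  -- The equation for B is what makes this derivative a multiple of `sleQ` itself.
  have hQ : HasDerivWithinAt (fun s => sleQ p (τ s) (c s))
      (-(p * (1 + τ s ^ 2) * c s / (c s + Complex.I * τ s)) * sleQ p (τ s) (c s)) S s := by
    refine (hinv.add (hBc.const_mul Complex.I)).congr_deriv ?_
    simp only [sleQ]
    push_cast
    generalize hD : c s + Complex.I * (τ s : ℂ) = D at h3 ⊢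
    field_simp
    linear_combination (1 + (τ s : ℂ) ^ 2) * (-(τ s : ℂ) * Complex.I * hode + 2 * p * hD)
  have hE := ((hQ.clog_real hQs).const_mul ((1 / p : ℝ) : ℂ)).cexp
  have h := (((hdc.pow 2).const_sub 1).mul hE).const_mul ((Real.exp (-T) / 4 : ℝ) : ℂ)
  refine h.congr_deriv ?_
  rw [mul_div_cancel_right₀ _ hQ0]
  generalize Complex.exp ((1 / p : ℝ) * Complex.log (sleQ p (τ s) (c s))) = E
  simp only [Pi.pow_apply, Nat.cast_ofNat]
  push_cast
  generalize c s + Complex.I * (τ s : ℂ) = D at h3 ⊢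
  field_simp
  ring

/-! ### The tip of the curve -/

/-- The real part of the image of the tip under `z ↦ z ^ p`. -/
def sleX (p T τ : ℝ) : ℝ :=
  Real.exp (-(p * T)) * 4 ^ (-p) * ((1 + τ ^ 2) ^ p / τ - 2 * p * sleI p τ)

/-- The (constant) imaginary part of the image of the tip under `z ↦ z ^ p`. -/
def sleY (p T : ℝ) : ℝ := Real.exp (-(p * T)) * 4 ^ (-p) * sleK p

theorem sleY_pos {p : ℝ} (hp : 0 < p) (T : ℝ) : 0 < sleY p T :=
  mul_pos (mul_pos (Real.exp_pos _) (Real.rpow_pos_of_pos (by norm_num) _)) (sleK_pos hp)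

/-- The terms 2p(1 + τ²)^{p-1} cancel, leaving a negative derivative. -/
theorem hasDerivAt_sleX (p T : ℝ) {τ : ℝ} (hτ : 0 < τ) : HasDerivAt (sleX p T)
    (-(Real.exp (-(p * T)) * 4 ^ (-p) * ((1 + τ ^ 2) ^ p / τ ^ 2))) τ := by
  have h1 : HasDerivAt (fun τ : ℝ => 1 + τ ^ 2) (2 * τ) τ := by
    simpa using (hasDerivAt_pow 2 τ).const_add 1
  have hpos : 0 < 1 + τ ^ 2 := by positivity
  have h2 := h1.rpow_const (p := p) (Or.inl hpos.ne')
  have h3 := ((h2.div (hasDerivAt_id τ) hτ.ne').sub ((hasDerivAt_sleI p τ).const_mul (2 * p))).const_mul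
    (Real.exp (-(p * T)) * 4 ^ (-p))
  refine h3.congr_deriv ?_
  have : (1 + τ ^ 2) ^ p = (1 + τ ^ 2) ^ (p - 1) * (1 + τ ^ 2) := by
    rw [Real.rpow_sub_one hpos.ne']; field_simp
  simp only [id]
  rw [this]
  field_simp
  ring

/-- The positive real factor is chosen so that its power 1/p cancels the prefactor (e^{-T}/4)(1 +
τ²) in the inverse map. -/
theorem sleQ_tip_eq {p τ : ℝ} (T : ℝ) (hτ : 0 < τ) :
    ((1 / τ : ℝ) : ℂ) + Complex.I * sleBExt p (-(Complex.I * τ)) =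
      (((1 + τ ^ 2) ^ (-p) * 4 ^ p * Real.exp (p * T) : ℝ) : ℂ) *
        (sleX p T τ + sleY p T * Complex.I) := by
  have hpos : 0 < 1 + τ ^ 2 := by positivity
  have h1 : (1 + τ ^ 2) ^ (-p) * (1 + τ ^ 2) ^ p = 1 := by
    rw [← Real.rpow_add hpos]; simp
  have h2 : (4 : ℝ) ^ p * 4 ^ (-p) = 1 := by
    rw [← Real.rpow_add (by norm_num)]; simp
  have h3 : Real.exp (p * T) * Real.exp (-(p * T)) = 1 := by
    rw [← Real.exp_add]; simp
  have hX : (1 + τ ^ 2) ^ (-p) * 4 ^ p * Real.exp (p * T) * sleX p T τ =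
      1 / τ - (1 + τ ^ 2) ^ (-p) * (2 * p * sleI p τ) := by
    rw [sleX]
    calc _ = ((4 : ℝ) ^ p * 4 ^ (-p)) * (Real.exp (p * T) * Real.exp (-(p * T))) *
        ((1 + τ ^ 2) ^ (-p) * (1 + τ ^ 2) ^ p / τ - (1 + τ ^ 2) ^ (-p) * (2 * p * sleI p τ)) := by
          ring
      _ = _ := by rw [h1, h2, h3]; ring
  have hY : (1 + τ ^ 2) ^ (-p) * 4 ^ p * Real.exp (p * T) * sleY p T =
      (1 + τ ^ 2) ^ (-p) * sleK p := by
    rw [sleY]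
    calc _ = ((4 : ℝ) ^ p * 4 ^ (-p)) * (Real.exp (p * T) * Real.exp (-(p * T))) *
        ((1 + τ ^ 2) ^ (-p) * sleK p) := by ring
      _ = _ := by rw [h2, h3]; ring
  rw [sleBExt_neg_I_mul, mul_add (Complex.ofReal (_ * _ * _)), ← mul_assoc _ (sleY p T : ℂ),
    ← Complex.ofReal_mul, ← Complex.ofReal_mul, hX, hY]
  push_cast
  linear_combination (((1 + τ ^ 2) ^ (-p) : ℝ) : ℂ) * 2 * p * sleI p τ * Complex.I_sq

/-- The tip of the curve at the time with `tan α = τ`. -/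
def sleTip (p T τ : ℝ) : ℂ := ((sleX p T τ : ℂ) + sleY p T * Complex.I) ^ ((1 / p : ℝ) : ℂ)

theorem add_mul_I_ne_zero (x : ℝ) {y : ℝ} (hy : 0 < y) : (x : ℂ) + y * Complex.I ≠ 0 := fun h => by
  have := congrArg Complex.im h
  simp at this
  exact hy.ne' this

/-- The limit is taken jointly in τ and c because it is later used along trajectories stopped at
varying times. Near the boundary point `sleB` is replaced by its continuous extension. -/
theorem tendsto_sleF_tip {p : ℝ} (hp : 0 < p) (T : ℝ) {τ : ℝ} (hτ : 0 < τ) :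
    Tendsto (fun x : ℝ × ℂ => sleF p T x.1 x.2)
      (𝓝 (τ, -(Complex.I * τ)) ⊓ 𝓟 (univ ×ˢ rightHalfPlane)) (𝓝 (sleTip p T τ)) := by
  have hstrip := neg_I_mul_mem_unitStrip τ
  have hl : 0 < (1 + τ ^ 2) ^ (-p) * 4 ^ p * Real.exp (p * T) := by positivity
  have hne := add_mul_I_ne_zero (sleX p T τ) (sleY_pos hp T)
  set g : ℝ × ℂ → ℂ := fun x => ((1 / x.1 : ℝ) : ℂ) + Complex.I * sleBExt p x.2 with hg
  have hgc : ContinuousAt g (τ, -(Complex.I * τ)) := by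
    have h1 : ContinuousAt (fun x : ℝ × ℂ => ((1 / x.1 : ℝ) : ℂ)) (τ, -(Complex.I * τ)) :=
      Complex.continuous_ofReal.continuousAt.comp (continuousAt_const.div continuousAt_fst hτ.ne')
    have h2 : ContinuousAt (fun x : ℝ × ℂ => sleBExt p x.2) (τ, -(Complex.I * τ)) :=
      ContinuousAt.comp (f := Prod.snd) (x := (τ, -(Complex.I * τ)))
        (continuousAt_sleBExt p hstrip) continuousAt_snd
    exact h1.add (continuousAt_const.mul h2)
  have hgv : g (τ, -(Complex.I * τ)) = (((1 + τ ^ 2) ^ (-p) * 4 ^ p * Real.exp (p * T) : ℝ) : ℂ) *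
        (sleX p T τ + sleY p T * Complex.I) := sleQ_tip_eq T hτ
  have hgs : g (τ, -(Complex.I * τ)) ∈ Complex.slitPlane := by
    rw [hgv]
    refine Complex.mem_slitPlane_iff.2 (Or.inr ?_)
    rw [Complex.im_ofReal_mul]
    have := (mul_pos hl (sleY_pos hp T)).ne'
    simpa using this
  have hF : ContinuousAt (fun x : ℝ × ℂ => ((Real.exp (-T) / 4 : ℝ) : ℂ) *
      ((1 - x.2 ^ 2) * Complex.exp ((1 / p : ℝ) * Complex.log (g x)))) (τ, -(Complex.I * τ)) :=
    continuousAt_const.mul ((continuousAt_const.sub (continuousAt_snd.pow 2)).mul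
      (continuousAt_const.mul (hgc.clog hgs)).cexp)
  have hval : ((Real.exp (-T) / 4 : ℝ) : ℂ) * ((1 - (-(Complex.I * τ)) ^ 2) *
      Complex.exp ((1 / p : ℝ) * Complex.log (g (τ, -(Complex.I * τ))))) = sleTip p T τ := by
    rw [hgv, Complex.log_ofReal_mul hl hne, mul_add, Complex.exp_add, sleTip,
      Complex.cpow_def_of_ne_zero hne, mul_comm (Complex.log (_ + _)), ← mul_assoc, ← mul_assoc]
    convert one_mul _ using 2
    have hpos : (0 : ℝ) < 1 + τ ^ 2 := by positivity
    have h5 : Real.exp (1 / p * Real.log ((1 + τ ^ 2) ^ (-p) * 4 ^ p * Real.exp (p * T))) =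
        (1 + τ ^ 2)⁻¹ * 4 * Real.exp T := by
      rw [mul_comm, ← Real.rpow_def_of_pos hl, Real.mul_rpow (by positivity) (Real.exp_pos _).le,
        Real.mul_rpow (by positivity) (by positivity), ← Real.rpow_mul hpos.le,
        ← Real.rpow_mul (by norm_num), ← Real.exp_mul]
      have e1 : -p * (1 / p) = -1 := by field_simp
      have e2 : p * (1 / p) = 1 := by field_simp
      have e3 : p * T * (1 / p) = T := by field_simp
      rw [e1, e2, e3, Real.rpow_neg_one, Real.rpow_one]
    have h6 : (1 - (-(Complex.I * (τ : ℂ))) ^ 2) = ((1 + τ ^ 2 : ℝ) : ℂ) := by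
      push_cast
      linear_combination (-(τ : ℂ) ^ 2) * Complex.I_sq
    rw [h6, ← Complex.ofReal_mul (1 / p), ← Complex.ofReal_exp, h5, ← Complex.ofReal_mul,
      ← Complex.ofReal_mul]
    norm_cast
    have h7 : Real.exp (-T) * Real.exp T = 1 := by rw [← Real.exp_add]; simp
    field_simp
    linear_combination h7
  have hlim := hF.tendsto
  simp only [hval] at hlim
  refine (hlim.mono_left inf_le_left).congr' ?_
  have hstr : ∀ᶠ x : ℝ × ℂ in 𝓝 (τ, -(Complex.I * τ)), x.2 ∈ unitStrip :=
    continuousAt_snd.eventually (isOpen_unitStrip.mem_nhds hstrip)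
  filter_upwards [hstr.filter_mono inf_le_left, mem_inf_of_right (mem_principal_self _)] with x h1 h2
  rw [sleF, sleQ, sleB_eq_sleBExt hp h2.2 h1]

/-! ### The Loewner equation in the variables `r = exp s`, `v = u / r` -/

/-- Coordinatewise truncation of a complex number. -/
def clip (M : ℝ) (v : ℂ) : ℂ := ⟨max (-M) (min M v.re), max (-M) (min M v.im)⟩

theorem abs_max_min_sub_le (M x y : ℝ) :
    |max (-M) (min M x) - max (-M) (min M y)| ≤ |x - y| := by
  refine (abs_max_sub_max_le_max _ _ _ _).trans ?_
  simp only [sub_self, abs_zero]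
  refine max_le (abs_nonneg _) ((abs_min_sub_min_le_max _ _ _ _).trans ?_)
  simp

theorem norm_clip_sub_le (M : ℝ) (v w : ℂ) : ‖clip M v - clip M w‖ ≤ ‖v - w‖ := by
  rw [← sq_le_sq₀ (norm_nonneg _) (norm_nonneg _), ← Complex.normSq_eq_norm_sq,
    ← Complex.normSq_eq_norm_sq, Complex.normSq_apply, Complex.normSq_apply]
  have h1 := sq_le_sq.2 (abs_max_min_sub_le M v.re w.re)
  have h2 := sq_le_sq.2 (abs_max_min_sub_le M v.im w.im)
  simp only [clip, Complex.sub_re, Complex.sub_im]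
  nlinarith

theorem clip_eq_self {M : ℝ} {v : ℂ} (h : ‖v‖ ≤ M) : clip M v = v := by
  have h1 := abs_le.1 ((Complex.abs_re_le_norm v).trans h)
  have h2 := abs_le.1 ((Complex.abs_im_le_norm v).trans h)
  refine Complex.ext ?_ ?_
  · simp [clip, h1.1, h1.2]
  · simp [clip, h2.1, h2.2]

theorem norm_clip_le {M : ℝ} (hM : 0 ≤ M) (v : ℂ) : ‖clip M v‖ ≤ 2 * M := by
  refine (Complex.norm_le_abs_re_add_abs_im _).trans ?_
  have : ∀ x : ℝ, |max (-M) (min M x)| ≤ M := fun x =>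
    abs_le.2 ⟨le_max_left _ _, max_le (by linarith) (min_le_left _ _)⟩
  have h1 := this v.re
  have h2 := this v.im
  simp only [clip]
  linarith

/-- A globally Lipschitz function equal to `y⁻¹` for `‖y‖ ≥ δ`. -/
def truncInv (δ : ℝ) (y : ℂ) : ℂ :=
  (starRingEnd ℂ y) * (((max ‖y‖ δ)⁻¹ : ℝ) : ℂ) * (((max ‖y‖ δ)⁻¹ : ℝ) : ℂ)

theorem truncInv_eq {δ : ℝ} (hδ : 0 < δ) {y : ℂ} (h : δ ≤ ‖y‖) : truncInv δ y = y⁻¹ := by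
  have hy : y ≠ 0 := norm_pos_iff.1 (hδ.trans_le h)
  rw [truncInv, max_eq_left h, Complex.inv_def, Complex.normSq_eq_norm_sq]
  push_cast
  ring

theorem norm_inv_max_sub_le {δ : ℝ} (hδ : 0 < δ) (y z : ℂ) :
    |(max ‖y‖ δ)⁻¹ - (max ‖z‖ δ)⁻¹| ≤ ‖y - z‖ * (max ‖y‖ δ)⁻¹ * (max ‖z‖ δ)⁻¹ := by
  have h1 : 0 < max ‖y‖ δ := lt_max_of_lt_right hδ
  have h2 : 0 < max ‖z‖ δ := lt_max_of_lt_right hδ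
  rw [inv_sub_inv h1.ne' h2.ne', abs_div, abs_of_pos (mul_pos h1 h2), mul_assoc, ← mul_inv,
    ← div_eq_mul_inv]
  gcongr
  refine (abs_max_sub_max_le_max _ _ _ _).trans ?_
  rw [sub_self, abs_zero, max_eq_left (abs_nonneg _)]
  rw [norm_sub_rev]
  exact abs_norm_sub_norm_le z y

theorem norm_truncInv_le {δ : ℝ} (hδ : 0 < δ) (y : ℂ) : ‖truncInv δ y‖ ≤ δ⁻¹ := by
  have h1 : 0 < max ‖y‖ δ := lt_max_of_lt_right hδ
  rw [truncInv, norm_mul, norm_mul, RCLike.norm_conj, Complex.norm_real,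
    Real.norm_of_nonneg (inv_nonneg.2 h1.le)]
  have h2 : ‖y‖ * (max ‖y‖ δ)⁻¹ ≤ 1 := by
    rw [← div_eq_mul_inv]; exact div_le_one_of_le₀ (le_max_left _ _) h1.le
  have h3 : (max ‖y‖ δ)⁻¹ ≤ δ⁻¹ := inv_anti₀ hδ (le_max_right _ _)
  calc _ ≤ 1 * δ⁻¹ := mul_le_mul h2 h3 (inv_nonneg.2 h1.le) zero_le_one
    _ = _ := one_mul _

/-- With A, B the two truncated inverse norms, the difference splits into a change of the conjugate
and a change of A² - B² = (A - B)(A + B); the factor ‖z‖ in the second is absorbed by ‖z‖B ≤ 1. -/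
theorem norm_truncInv_sub_le {δ : ℝ} (hδ : 0 < δ) (y z : ℂ) :
    ‖truncInv δ y - truncInv δ z‖ ≤ 3 * δ⁻¹ ^ 2 * ‖y - z‖ := by
  have h1 : 0 < max ‖y‖ δ := lt_max_of_lt_right hδ
  have h2 : 0 < max ‖z‖ δ := lt_max_of_lt_right hδ
  have hA : (max ‖y‖ δ)⁻¹ ≤ δ⁻¹ := inv_anti₀ hδ (le_max_right _ _)
  have hB : (max ‖z‖ δ)⁻¹ ≤ δ⁻¹ := inv_anti₀ hδ (le_max_right _ _)
  have hz : ‖z‖ * (max ‖z‖ δ)⁻¹ ≤ 1 := by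
    rw [← div_eq_mul_inv]; exact div_le_one_of_le₀ (le_max_left _ _) h2.le
  have hAB := norm_inv_max_sub_le hδ y z
  have hA0 := (inv_pos.2 h1).le
  have hB0 := (inv_pos.2 h2).le
  unfold truncInv
  set A := (max ‖y‖ δ)⁻¹
  set B := (max ‖z‖ δ)⁻¹
  have hd := inv_pos.2 hδ
  have key : (starRingEnd ℂ y) * (A : ℂ) * (A : ℂ) - (starRingEnd ℂ z) * (B : ℂ) * (B : ℂ) =
      (starRingEnd ℂ (y - z)) * (A : ℂ) * (A : ℂ) +
      (starRingEnd ℂ z) * ((A - B : ℝ) : ℂ) * ((A + B : ℝ) : ℂ) := by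
    rw [map_sub]; push_cast; ring
  rw [key]
  refine (norm_add_le _ _).trans ?_
  simp only [norm_mul, RCLike.norm_conj, Complex.norm_real, Real.norm_eq_abs]
  rw [abs_of_nonneg hA0, abs_of_nonneg (add_nonneg hA0 hB0)]
  have hn := norm_nonneg (y - z)
  have hnz := norm_nonneg z
  have e1 : ‖y - z‖ * A * A ≤ ‖y - z‖ * δ⁻¹ * δ⁻¹ := by gcongr
  have e2 : ‖z‖ * |A - B| * (A + B) ≤ ‖y - z‖ * δ⁻¹ * (δ⁻¹ + δ⁻¹) := by
    have : ‖z‖ * |A - B| ≤ ‖y - z‖ * δ⁻¹ := by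
      calc ‖z‖ * |A - B| ≤ ‖z‖ * (‖y - z‖ * A * B) := by gcongr
        _ = (‖z‖ * B) * (‖y - z‖ * A) := by ring
        _ ≤ 1 * (‖y - z‖ * δ⁻¹) := by gcongr
        _ = _ := one_mul _
    gcongr
  nlinarith

/-- The truncated vector field. -/
def truncField (W : ℝ → ℂ) (δ M r : ℝ) (v : ℂ) : ℂ :=
  2 * clip M v ^ 2 * truncInv δ (W r - r * clip M v)

theorem truncField_eq {W : ℝ → ℂ} {δ M r : ℝ} (hδ : 0 < δ) {v : ℂ} (hv : ‖v‖ ≤ M)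
    (h : δ ≤ ‖W r - r * v‖) : truncField W δ M r v = 2 * v ^ 2 / (W r - r * v) := by
  rw [truncField, clip_eq_self hv, truncInv_eq hδ h, div_eq_mul_inv]

theorem norm_truncField_le {W : ℝ → ℂ} {δ M : ℝ} (hδ : 0 < δ) (hM : 0 ≤ M) (r : ℝ) (v : ℂ) :
    ‖truncField W δ M r v‖ ≤ 8 * M ^ 2 * δ⁻¹ := by
  rw [truncField, norm_mul, norm_mul, norm_pow]
  have h1 := norm_clip_le hM v
  have h2 := norm_truncInv_le hδ (W r - r * clip M v)
  have : ‖(2 : ℂ)‖ = 2 := by simp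
  rw [this]
  calc 2 * ‖clip M v‖ ^ 2 * ‖truncInv δ (W r - r * clip M v)‖ ≤ 2 * (2 * M) ^ 2 * δ⁻¹ := by gcongr
    _ = _ := by ring

theorem norm_truncField_sub_le {W : ℝ → ℂ} {δ M R : ℝ} (hδ : 0 < δ) (hM : 0 ≤ M) {r : ℝ}
    (hr : r ∈ Icc 0 R) (v w : ℂ) :
    ‖truncField W δ M r v - truncField W δ M r w‖ ≤
      (8 * M * δ⁻¹ + 24 * M ^ 2 * δ⁻¹ ^ 2 * R) * ‖v - w‖ := by
  have h1 := norm_clip_le hM v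
  have h2 := norm_clip_le hM w
  have h3 := norm_clip_sub_le M v w
  have h4 := norm_truncInv_le hδ (W r - r * clip M v)
  have h5 := norm_truncInv_sub_le hδ (W r - r * clip M v) (W r - r * clip M w)
  have h6 : ‖(W r - r * clip M v) - (W r - r * clip M w)‖ ≤ R * ‖v - w‖ := by
    have : (W r - r * clip M v) - (W r - r * clip M w) = r * (clip M w - clip M v) := by ring
    rw [this, norm_mul, Complex.norm_real, Real.norm_of_nonneg hr.1, norm_sub_rev]
    exact mul_le_mul hr.2 h3 (norm_nonneg _) (hr.1.trans hr.2)
  unfold truncField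
  set x := clip M v
  set y := clip M w
  set J := truncInv δ (W r - r * x)
  set J' := truncInv δ (W r - r * y)
  have hd := inv_pos.2 hδ
  have key : 2 * x ^ 2 * J - 2 * y ^ 2 * J' =
    2 * (x + y) * (x - y) * J + 2 * y ^ 2 * (J - J') := by ring
  have hn2 : ‖(2 : ℂ)‖ = 2 := by simp
  rw [key]
  refine (norm_add_le _ _).trans ?_
  simp only [norm_mul, norm_pow, hn2]
  have hxy : ‖x + y‖ ≤ 4 * M := (norm_add_le _ _).trans (by linarith)
  have e1 : 2 * ‖x + y‖ * ‖x - y‖ * ‖J‖ ≤ 2 * (4 * M) * ‖v - w‖ * δ⁻¹ := by gcongr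
  have e2 : 2 * ‖y‖ ^ 2 * ‖J - J'‖ ≤ 2 * (2 * M) ^ 2 * (3 * δ⁻¹ ^ 2 * (R * ‖v - w‖)) := by
    have : ‖J - J'‖ ≤ 3 * δ⁻¹ ^ 2 * (R * ‖v - w‖) := h5.trans (by gcongr)
    gcongr
  linarith

theorem continuous_truncInv {δ : ℝ} (hδ : 0 < δ) : Continuous (truncInv δ) := by
  have : LipschitzWith (3 * δ⁻¹ ^ 2).toNNReal (truncInv δ) :=
    LipschitzWith.of_dist_le_mul fun y z => by
      rw [dist_eq_norm, dist_eq_norm, Real.coe_toNNReal _ (by positivity)]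
      exact norm_truncInv_sub_le hδ y z
  exact this.continuous

/-- The truncated field is bounded and globally Lipschitz in v, so Picard–Lindelöf covers all of [0,
R] at once. A priori bounds later show that the truncation is inactive. -/
theorem exists_truncField_solution {W : ℝ → ℂ} (hW : Continuous W) {δ M R : ℝ} (hδ : 0 < δ)
    (hM : 0 ≤ M) {r₀ : ℝ} (hr₀ : r₀ ∈ Icc 0 R) (v₀ : ℂ) :
    ∃ v : ℝ → ℂ, v r₀ = v₀ ∧
      ∀ r ∈ Icc 0 R, HasDerivWithinAt v (truncField W δ M r (v r)) (Icc 0 R) r := by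
  have hR : 0 ≤ R := hr₀.1.trans hr₀.2
  have hL : 0 ≤ 8 * M ^ 2 * δ⁻¹ := by positivity
  have hK : 0 ≤ 8 * M * δ⁻¹ + 24 * M ^ 2 * δ⁻¹ ^ 2 * R := by positivity
  have : IsPicardLindelof (truncField W δ M) (⟨r₀, hr₀⟩ : Icc (0 : ℝ) R) v₀
      ((8 * M ^ 2 * δ⁻¹).toNNReal * R.toNNReal) 0 (8 * M ^ 2 * δ⁻¹).toNNReal
      (8 * M * δ⁻¹ + 24 * M ^ 2 * δ⁻¹ ^ 2 * R).toNNReal := by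
    refine ⟨fun t ht => ?_, fun x _ => ?_, fun t _ x _ => ?_, ?_⟩
    · refine LipschitzOnWith.of_dist_le_mul fun v _ w _ => ?_
      rw [dist_eq_norm, dist_eq_norm, Real.coe_toNNReal _ hK]
      exact norm_truncField_sub_le hδ hM ht v w
    · refine Continuous.continuousOn ?_
      exact continuous_const.mul ((continuous_truncInv hδ).comp
        (hW.sub (Complex.continuous_ofReal.mul continuous_const)))
    · rw [Real.coe_toNNReal _ hL]
      exact norm_truncField_le hδ hM t x
    · rw [NNReal.coe_mul, Real.coe_toNNReal _ hL, Real.coe_toNNReal _ hR, NNReal.coe_zero]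
      simp only [sub_zero]
      refine mul_le_mul_of_nonneg_left (max_le ?_ ?_) hL
      · simpa using hr₀.1
      · simpa using hr₀.2
  exact this.exists_eq_forall_mem_Icc_hasDerivWithinAt₀

/-- `v` solves the Loewner equation in radial variables on `[0, R]`, inside the unit disk. -/
structure IsRadialSolution (W : ℝ → ℂ) (R : ℝ) (v : ℝ → ℂ) : Prop where
  hasDeriv : ∀ r ∈ Icc 0 R, HasDerivWithinAt v (2 * v r ^ 2 / (W r - r * v r)) (Icc 0 R) r
  norm_lt_one : ∀ r ∈ Icc 0 R, ‖(r : ℂ) * v r‖ < 1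

theorem one_sub_norm_le {w u : ℂ} (hw : ‖w‖ = 1) : 1 - ‖u‖ ≤ ‖w - u‖ := by
  have := norm_sub_norm_le w u
  rwa [hw] at this

/-- By compactness both solutions stay bounded and away from the unit circle, so both solve one and
the same truncated Lipschitz equation. -/
theorem IsRadialSolution.unique {W : ℝ → ℂ} (hW : ∀ r, ‖W r‖ = 1) {R : ℝ} (hR : 0 ≤ R)
    {v w : ℝ → ℂ} (hv : IsRadialSolution W R v) (hw : IsRadialSolution W R w) (h0 : v 0 = w 0) :
    v R = w R := by
  have hvc : ContinuousOn v (Icc 0 R) := fun r hr => (hv.hasDeriv r hr).continuousWithinAt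
  have hwc : ContinuousOn w (Icc 0 R) := fun r hr => (hw.hasDeriv r hr).continuousWithinAt
  have bound : ∀ {f : ℝ → ℂ}, IsRadialSolution W R f → ContinuousOn f (Icc 0 R) →
      ∃ q < 1, ∃ M, 0 ≤ M ∧ ∀ r ∈ Icc 0 R, ‖(r : ℂ) * f r‖ ≤ q ∧ ‖f r‖ ≤ M := by
    intro f hf hfc
    obtain ⟨M, hM⟩ := isCompact_Icc.exists_bound_of_continuousOn hfc
    obtain ⟨r, hr, hmax⟩ := isCompact_Icc.exists_isMaxOn (nonempty_Icc.2 hR)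
      (Complex.continuous_ofReal.continuousOn.mul hfc).norm
    exact ⟨_, hf.norm_lt_one r hr, M, (norm_nonneg _).trans (hM r hr), fun x hx => ⟨hmax hx, hM x hx⟩⟩
  obtain ⟨q₁, hq₁, M₁, hM₁, hb₁⟩ := bound hv hvc
  obtain ⟨q₂, hq₂, M₂, hM₂, hb₂⟩ := bound hw hwc
  set M := max M₁ M₂
  set δ := 1 - max q₁ q₂
  have hδ : 0 < δ := sub_pos.2 (max_lt hq₁ hq₂)
  have hM : 0 ≤ M := hM₁.trans (le_max_left _ _)
  have conv : ∀ {f : ℝ → ℂ}, IsRadialSolution W R f →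
      (∀ r ∈ Icc 0 R, ‖(r : ℂ) * f r‖ ≤ max q₁ q₂ ∧ ‖f r‖ ≤ M) →
      ∀ r ∈ Ico 0 R, HasDerivWithinAt f (truncField W δ M r (f r)) (Ici r) r := by
    intro f hf hb r hr
    have hr' := Ico_subset_Icc_self hr
    rw [truncField_eq hδ (hb r hr').2]
    · exact (hf.hasDeriv r hr').mono_of_mem_nhdsWithin (Icc_mem_nhdsGE_of_mem hr)
    · have := one_sub_norm_le (u := (r : ℂ) * f r) (hW r)
      have := (hb r hr').1
      simp only [δ]; linarith
  have hK : 0 ≤ 8 * M * δ⁻¹ + 24 * M ^ 2 * δ⁻¹ ^ 2 * R := by positivity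
  refine ODE_solution_unique_of_mem_Icc_right (v := truncField W δ M) (s := fun _ => univ)
    (K := (8 * M * δ⁻¹ + 24 * M ^ 2 * δ⁻¹ ^ 2 * R).toNNReal) (a := 0) (b := R)
    (fun t ht => ?_) hvc (conv hv fun r hr => ?_) (fun _ _ => mem_univ _) hwc
    (conv hw fun r hr => ?_) (fun _ _ => mem_univ _) h0 (right_mem_Icc.2 hR)
  · refine LipschitzOnWith.of_dist_le_mul fun v _ w _ => ?_
    rw [dist_eq_norm, dist_eq_norm, Real.coe_toNNReal _ hK]
    exact norm_truncField_sub_le hδ hM (Ico_subset_Icc_self ht) v w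
  · exact ⟨(hb₁ r hr).1.trans (le_max_left _ _), (hb₁ r hr).2.trans (le_max_left _ _)⟩
  · exact ⟨(hb₂ r hr).1.trans (le_max_right _ _), (hb₂ r hr).2.trans (le_max_right _ _)⟩

/-- With u = rv the left side is Re((w + u)/(w - u)), the Poisson kernel. -/
theorem one_add_two_mul_re_div {w : ℂ} (hw : ‖w‖ = 1) {r : ℝ} {v : ℂ} (h : w - r * v ≠ 0) :
    1 + 2 * r * (v / (w - r * v)).re = (1 - ‖(r : ℂ) * v‖ ^ 2) / ‖w - r * v‖ ^ 2 := by
  have hn : ‖w - r * v‖ ^ 2 ≠ 0 := pow_ne_zero 2 (norm_ne_zero_iff.2 h)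
  have hw' : w.re * w.re + w.im * w.im = 1 := by
    rw [← Complex.normSq_apply, Complex.normSq_eq_norm_sq, hw]; norm_num
  rw [eq_div_iff hn, Complex.div_re]
  rw [← Complex.normSq_eq_norm_sq] at hn ⊢
  rw [← Complex.normSq_eq_norm_sq]
  field_simp
  simp only [Complex.normSq_apply, Complex.sub_re, Complex.sub_im, Complex.mul_re, Complex.mul_im,
    Complex.ofReal_re, Complex.ofReal_im]
  linear_combination hw'

theorem hasDerivWithinAt_norm_sq_radial {w : ℂ} {v : ℝ → ℂ} {r : ℝ} {S : Set ℝ}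
    (hv : HasDerivWithinAt v (2 * v r ^ 2 / (w - r * v r)) S r) :
    HasDerivWithinAt (fun r => ‖v r‖ ^ 2) (4 * ‖v r‖ ^ 2 * (v r / (w - r * v r)).re) S r := by
  refine hv.norm_sq.congr_deriv ?_
  have h : 2 * v r ^ 2 / (w - r * v r) * (starRingEnd ℂ) (v r) =
      ((2 * Complex.normSq (v r) : ℝ) : ℂ) * (v r / (w - r * v r)) := by
    push_cast
    rw [← Complex.mul_conj]
    ring
  rw [Complex.inner, h, Complex.re_ofReal_mul, Complex.normSq_eq_norm_sq]
  ring

theorem hasDerivWithinAt_sq_norm_sq_radial {w : ℂ} (hw : ‖w‖ = 1) {v : ℝ → ℂ} {r : ℝ} {S : Set ℝ}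
    (h : w - r * v r ≠ 0) (hv : HasDerivWithinAt v (2 * v r ^ 2 / (w - r * v r)) S r) :
    HasDerivWithinAt (fun r => r ^ 2 * ‖v r‖ ^ 2)
      (2 * r * ‖v r‖ ^ 2 * ((1 - ‖(r : ℂ) * v r‖ ^ 2) / ‖w - r * v r‖ ^ 2)) S r := by
  refine (((hasDerivWithinAt_id r S).pow 2).mul (hasDerivWithinAt_norm_sq_radial hv)).congr_deriv ?_
  rw [← one_add_two_mul_re_div hw h]
  simp
  ring

theorem norm_ofReal_mul_sq (r : ℝ) (v : ℂ) : ‖(r : ℂ) * v‖ ^ 2 = r ^ 2 * ‖v‖ ^ 2 := by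
  rw [norm_mul, Complex.norm_real, mul_pow, Real.norm_eq_abs, sq_abs]

/-- A solution cannot reach the unit circle away from the driving point. -/
theorem radial_norm_lt_one_of_bounds {W : ℝ → ℂ} (hW : ∀ r, ‖W r‖ = 1) {R δ M : ℝ} (hR : 0 ≤ R)
    (hδ : 0 < δ) {v : ℝ → ℂ}
    (hv : ∀ r ∈ Icc 0 R, HasDerivWithinAt v (2 * v r ^ 2 / (W r - r * v r)) (Icc 0 R) r)
    (hδv : ∀ r ∈ Icc 0 R, δ ≤ ‖W r - r * v r‖) (hM : ∀ r ∈ Icc 0 R, ‖v r‖ ≤ M)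
    (hlt : ∀ r ∈ Ico 0 R, ‖(r : ℂ) * v r‖ < 1) : ‖(R : ℂ) * v R‖ < 1 := by
  have hM0 : 0 ≤ M := (norm_nonneg _).trans (hM 0 ⟨le_rfl, hR⟩)
  -- C bounds the exponential rate at which 1 - |rv|² can decay, so the product with exp(Cr) is
  -- nondecreasing and remains at least its value 1 at r = 0.
  set C := 2 * R * M ^ 2 / δ ^ 2
  have hd : ∀ r ∈ Icc 0 R, HasDerivWithinAt
      (fun r => (1 - r ^ 2 * ‖v r‖ ^ 2) * Real.exp (C * r))
      ((1 - r ^ 2 * ‖v r‖ ^ 2) * Real.exp (C * r) *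
        (C - 2 * r * ‖v r‖ ^ 2 / ‖W r - r * v r‖ ^ 2)) (Icc 0 R) r := by
    intro r hr
    have hne : W r - r * v r ≠ 0 := norm_pos_iff.1 (hδ.trans_le (hδv r hr))
    have h1 := (hasDerivWithinAt_sq_norm_sq_radial (hW r) hne (hv r hr)).const_sub 1
    have h2 := (((hasDerivWithinAt_id r (Icc 0 R)).const_mul C)).exp
    refine (h1.mul h2).congr_deriv ?_
    rw [norm_ofReal_mul_sq]
    simp only [id]
    ring
  have hmono : MonotoneOn (fun r => (1 - r ^ 2 * ‖v r‖ ^ 2) * Real.exp (C * r)) (Icc 0 R) := by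
    refine monotoneOn_of_hasDerivWithinAt_nonneg (convex_Icc 0 R)
      (fun r hr => (hd r hr).continuousWithinAt)
      (fun r hr => (hd r (interior_subset hr)).mono interior_subset) fun r hr => ?_
    rw [interior_Icc] at hr
    have hr' := Ioo_subset_Icc_self hr
    have h1 := hlt r (Ioo_subset_Ico_self hr)
    have h2 : 0 ≤ 1 - r ^ 2 * ‖v r‖ ^ 2 := by
      rw [← norm_ofReal_mul_sq]; nlinarith [norm_nonneg ((r : ℂ) * v r)]
    refine mul_nonneg (mul_nonneg h2 (Real.exp_pos _).le) (sub_nonneg.2 ?_)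
    have h3 := hδv r hr'
    have h4 := hM r hr'
    have h5 := hr'.1
    have h6 := hr'.2
    simp only [C]
    gcongr
  have h := hmono (left_mem_Icc.2 hR) (right_mem_Icc.2 hR) hR
  simp only [ne_eq, OfNat.ofNat_ne_zero, not_false_eq_true, zero_pow, zero_mul, sub_zero, mul_zero,
    Real.exp_zero, one_mul] at h
  have h1 : 0 < 1 - R ^ 2 * ‖v R‖ ^ 2 := by
    by_contra hcon
    have := mul_nonpos_of_nonpos_of_nonneg (not_lt.1 hcon) (Real.exp_pos (C * R)).le
    linarith
  rw [← norm_ofReal_mul_sq] at h1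
  nlinarith [norm_nonneg ((R : ℂ) * v R)]

/-- A priori bound for solutions for small `r`. -/
theorem radial_norm_le_of_small {W : ℝ → ℂ} (hW : ∀ r, ‖W r‖ = 1) {R b : ℝ} (hb : 1 ≤ b)
    (hRb : R ≤ 1 / (16 * b)) {v : ℝ → ℂ}
    (hv : ∀ r ∈ Icc 0 R, HasDerivWithinAt v (2 * v r ^ 2 / (W r - r * v r)) (Icc 0 R) r)
    (h0 : ‖v 0‖ ≤ b) {r : ℝ} (hr : r ∈ Icc 0 R) : ‖v r‖ ≤ 2 * b := by
  have hb0 : 0 < b := by linarith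
  have hRb' : 16 * b * R ≤ 1 := by
    rw [le_div_iff₀ (by positivity)] at hRb; linarith
  have hB : ∀ x, HasDerivAt (fun x => b + 16 * b ^ 2 * x) (16 * b ^ 2) x := fun x => by
    simpa using ((hasDerivAt_id x).const_mul (16 * b ^ 2)).const_add b
  -- Barrier b + 16b²r, which stays below 2b on [0, R]. On contact |rv| ≤ 1/8, hence |v'| ≤
  -- 8b²/(7/8) < 16b².
  have hle := image_norm_le_of_norm_deriv_right_lt_deriv_boundary (f := v)
    (f' := fun r => 2 * v r ^ 2 / (W r - r * v r)) (a := 0) (b := R)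
    (B := fun x => b + 16 * b ^ 2 * x) (B' := fun _ => 16 * b ^ 2)
    (fun r hr => (hv r hr).continuousWithinAt)
    (fun r hr => (hv r (Ico_subset_Icc_self hr)).mono_of_mem_nhdsWithin
      (Icc_mem_nhdsGE_of_mem hr)) (by simpa using h0) hB ?_ hr
  · refine hle.trans ?_
    have : 16 * b * r ≤ 1 := le_trans (by gcongr; exact hr.2) hRb'
    nlinarith
  · intro r hr heq
    have h1 : 16 * b * r ≤ 1 := le_trans (by gcongr; exact hr.2.le) hRb'
    have h2 : ‖v r‖ ≤ 2 * b := by rw [heq]; nlinarith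
    have h3 : ‖(r : ℂ) * v r‖ ≤ 1 / 8 := by
      rw [norm_mul, Complex.norm_real, Real.norm_of_nonneg hr.1]
      nlinarith [hr.1, norm_nonneg (v r)]
    have h4 := one_sub_norm_le (u := (r : ℂ) * v r) (hW r)
    have h5 : 7 / 8 ≤ ‖W r - r * v r‖ := by linarith
    rw [norm_div, norm_mul, norm_pow, div_lt_iff₀ (by linarith)]
    have : ‖(2 : ℂ)‖ = 2 := by simp
    rw [this]
    have h6 : ‖v r‖ ^ 2 ≤ (2 * b) ^ 2 := by gcongr
    nlinarith

/-- Forward solvability: a solution exists up to `R`, unless it comes `δ`-close to the driving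
point before. -/
theorem exists_radial_forward {W : ℝ → ℂ} (hWc : Continuous W) (hW : ∀ r, ‖W r‖ = 1) {R δ : ℝ}
    (hR : 0 ≤ R) (hδ : 0 < δ) (hδ1 : δ < 1) (z : ℂ) :
    (∃ v, IsRadialSolution W R v ∧ v 0 = z) ∨
      ∃ r ∈ Ioc 0 R, ∃ v, IsRadialSolution W r v ∧ v 0 = z ∧ ‖W r - r * v r‖ ≤ δ ∧
        ‖v r‖ ≤ 16 * (‖z‖ + 1) + 1 := by
  set b := ‖z‖ + 1 with hbdef
  have hb : 1 ≤ b := by linarith [norm_nonneg z]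
  -- Large enough never to be attained: for r ≤ 1/(16b) the barrier gives |v| ≤ 2b, and for larger r
  -- the inequality |rv| < 1 gives |v| < 16b.
  set M := 16 * b + 1 with hMdef
  have hM : 0 ≤ M := by linarith
  obtain ⟨v, hv0, hv⟩ := exists_truncField_solution hWc hδ hM (left_mem_Icc.2 hR) z
  have hvc : ContinuousOn v (Icc 0 R) := fun r hr => (hv r hr).continuousWithinAt
  have hrv : ContinuousOn (fun r : ℝ => (r : ℂ) * v r) (Icc 0 R) :=
    Complex.continuous_ofReal.continuousOn.mul hvc
  have hcont1 : ContinuousOn (fun r : ℝ => ‖W r - r * v r‖) (Icc 0 R) :=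
    (hWc.continuousOn.sub hrv).norm
  -- Parameters violating one of the three strict bounds; before the infimum of this set, the
  -- truncated solution solves the true equation.
  set Bad : Set ℝ := {r | r ∈ Icc 0 R ∧
    0 ≤ max (max (δ - ‖W r - r * v r‖) (‖v r‖ - M)) (‖(r : ℂ) * v r‖ - 1)} with hBad
  have hgood : ∀ r ∈ Icc 0 R, r ∉ Bad →
      δ < ‖W r - r * v r‖ ∧ ‖v r‖ < M ∧ ‖(r : ℂ) * v r‖ < 1 := by
    intro r hr hnb
    have : max (max (δ - ‖W r - r * v r‖) (‖v r‖ - M)) (‖(r : ℂ) * v r‖ - 1) < 0 := by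
      by_contra hcon
      exact hnb ⟨hr, not_lt.1 hcon⟩
    rw [max_lt_iff, max_lt_iff] at this
    exact ⟨by linarith [this.1.1], by linarith [this.1.2], by linarith [this.2]⟩
  by_cases hne : Bad.Nonempty
  · right
    have hclosed : IsClosed Bad :=
      ContinuousOn.preimage_isClosed_of_isClosed
        (ContinuousOn.sup (ContinuousOn.sup (continuousOn_const.sub hcont1)
          (hvc.norm.sub continuousOn_const)) (hrv.norm.sub continuousOn_const))
        isClosed_Icc isClosed_Ici
    have hbdd : BddBelow Bad := ⟨0, fun r hr => hr.1.1⟩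
    set ρ := sInf Bad
    have hρ : ρ ∈ Bad := hclosed.csInf_mem hne hbdd
    have hlt : ∀ r ∈ Ico 0 ρ, r ∉ Bad := fun r hr h => not_le.2 hr.2 (csInf_le hbdd h)
    have hsub : Icc 0 ρ ⊆ Icc 0 R := Icc_subset_Icc_right hρ.1.2
    have h0 : (0 : ℝ) ∉ Bad := by
      intro h
      have := h.2
      rw [le_max_iff, le_max_iff] at this
      simp only [Complex.ofReal_zero, zero_mul, sub_zero, hW, hv0, norm_zero] at this
      rcases this with (h | h) | h <;> linarith [norm_nonneg z]
    have hρ0 : 0 < ρ := lt_of_le_of_ne hρ.1.1 fun h => h0 (h ▸ hρ)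
    have hg := fun r (hr : r ∈ Ico 0 ρ) => hgood r (hsub (Ico_subset_Icc_self hr)) (hlt r hr)
    have hcl : ∀ {f : ℝ → ℝ} {k : ℝ}, ContinuousOn f (Icc 0 R) → (∀ r ∈ Ico 0 ρ, f r ≤ k) →
        ∀ r ∈ Icc 0 ρ, f r ≤ k := by
      intro f k hf hk r hr
      rw [← closure_Ico hρ0.ne] at hr
      refine closure_minimal (s := Ico 0 ρ) (t := Icc 0 ρ ∩ f ⁻¹' Iic k)
        (fun x hx => ⟨Ico_subset_Icc_self hx, hk x hx⟩) ?_ hr |>.2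
      exact (hf.mono hsub).preimage_isClosed_of_isClosed isClosed_Icc isClosed_Iic
    have hδv : ∀ r ∈ Icc 0 ρ, δ ≤ ‖W r - r * v r‖ := fun r hr => by
      have := hcl (f := fun r => -‖W r - r * v r‖) (k := -δ) hcont1.neg
        (fun r hr => neg_le_neg (hg r hr).1.le) r hr
      linarith
    have hMv : ∀ r ∈ Icc 0 ρ, ‖v r‖ ≤ M := hcl hvc.norm fun r hr => (hg r hr).2.1.le
    have hsol : ∀ r ∈ Icc 0 ρ,
        HasDerivWithinAt v (2 * v r ^ 2 / (W r - r * v r)) (Icc 0 ρ) r := fun r hr => by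
      rw [← truncField_eq hδ (hMv r hr) (hδv r hr)]
      exact (hv r (hsub hr)).mono hsub
    have hend := radial_norm_lt_one_of_bounds hW hρ0.le hδ hsol hδv hMv fun r hr => (hg r hr).2.2
    have hdisk : ∀ r ∈ Icc 0 ρ, ‖(r : ℂ) * v r‖ < 1 := fun r hr => by
      rcases eq_or_lt_of_le hr.2 with h | h
      · rw [h]; exact hend
      · exact (hg r ⟨hr.1, h⟩).2.2
    have hvM : ‖v ρ‖ < M := by
      by_cases hs : ρ ≤ 1 / (16 * b)
      · have := radial_norm_le_of_small hW hb hs hsol (by rw [hv0]; linarith)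
          (right_mem_Icc.2 hρ0.le)
        linarith
      · rw [not_le, div_lt_iff₀ (by linarith)] at hs
        rw [norm_mul, Complex.norm_real, Real.norm_of_nonneg hρ0.le] at hend
        by_contra hcon
        rw [not_lt] at hcon
        nlinarith
    -- The bounds on |v| and |rv| are strict at ρ, so the first exit is caused by closeness to the
    -- driving point.
    refine ⟨ρ, ⟨hρ0, hρ.1.2⟩, v, ⟨hsol, hdisk⟩, hv0, ?_, hvM.le⟩
    have := hρ.2
    rw [le_max_iff, le_max_iff] at this
    rcases this with (h | h) | h <;> linarith
  · left
    have hg := fun r (hr : r ∈ Icc 0 R) => hgood r hr fun h => hne ⟨r, h⟩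
    refine ⟨v, ⟨fun r hr => ?_, fun r hr => (hg r hr).2.2⟩, hv0⟩
    rw [← truncField_eq hδ (hg r hr).2.1.le (hg r hr).1.le]
    exact hv r hr

/-- A priori bounds for solutions run backwards from a point of the unit disk. -/
theorem radial_backward_bounds {W : ℝ → ℂ} (hW : ∀ r, ‖W r‖ = 1) {ρ R q δ : ℝ} (hρ : 0 ≤ ρ)
    (hρR : ρ < R) (hq0 : 0 ≤ q) (hq : q < 1) (hδ : 0 < δ) {v : ℝ → ℂ}
    (hv : ∀ r ∈ Icc ρ R, HasDerivWithinAt v (2 * v r ^ 2 / (W r - r * v r)) (Icc ρ R) r)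
    (hδv : ∀ r ∈ Icc ρ R, δ ≤ ‖W r - r * v r‖) (hlt : ∀ r ∈ Icc ρ R, ‖(r : ℂ) * v r‖ ≤ 1)
    (hR : ‖(R : ℂ) * v R‖ ≤ q) :
    ‖(ρ : ℂ) * v ρ‖ ≤ q ∧ ‖v ρ‖ ≤ ‖v R‖ * Real.exp (4 / (1 - q) ^ 2) := by
  have hR0 : 0 < R := hρ.trans_lt hρR
  have hne : ∀ r ∈ Icc ρ R, W r - r * v r ≠ 0 := fun r hr =>
    norm_pos_iff.1 (hδ.trans_le (hδv r hr))
  have hpos : ∀ r ∈ Icc ρ R, 0 ≤ r := fun r hr => hρ.trans hr.1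
  have hU := fun r (hr : r ∈ Icc ρ R) =>
    hasDerivWithinAt_sq_norm_sq_radial (hW r) (hne r hr) (hv r hr)
  -- |u|² = |rv|² increases with r because the Poisson kernel is nonnegative, so the bound q
  -- propagates backward.
  have hmonoU : MonotoneOn (fun r => r ^ 2 * ‖v r‖ ^ 2) (Icc ρ R) := by
    refine monotoneOn_of_hasDerivWithinAt_nonneg (convex_Icc ρ R)
      (fun r hr => (hU r hr).continuousWithinAt)
      (fun r hr => (hU r (interior_subset hr)).mono interior_subset) fun r hr => ?_
    have hr' := interior_subset hr
    have h1 : 0 ≤ 1 - ‖(r : ℂ) * v r‖ ^ 2 := by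
      nlinarith [hlt r hr', norm_nonneg ((r : ℂ) * v r)]
    have := hpos r hr'
    positivity
  have hq_all : ∀ r ∈ Icc ρ R, ‖(r : ℂ) * v r‖ ≤ q := fun r hr => by
    have := hmonoU hr (right_mem_Icc.2 hρR.le) hr.2
    simp only [← norm_ofReal_mul_sq] at this
    exact ((sq_le_sq₀ (norm_nonneg _) (norm_nonneg _)).1 this).trans hR
  refine ⟨hq_all ρ (left_mem_Icc.2 hρR.le), ?_⟩
  -- Harnack-type rate: with x = |rv| ≤ q the Poisson kernel is at least (1 - x)/(1 + x) ≥ (1 -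
  -- q)/2.
  set β := (1 - q) / 2 with hβ
  have hβ0 : 0 < β := by simp only [hβ]; linarith
  have hden : ∀ r ∈ Icc ρ R, 2 * β ≤ ‖W r - r * v r‖ := fun r hr => by
    have h1 := one_sub_norm_le (u := (r : ℂ) * v r) (hW r)
    have h2 := hq_all r hr
    simp only [hβ]; linarith
  have hrate : ∀ r ∈ Icc ρ R, β ≤ (1 - ‖(r : ℂ) * v r‖ ^ 2) / ‖W r - r * v r‖ ^ 2 := by
    intro r hr
    have h1 := hq_all r hr
    have h0 := norm_nonneg ((r : ℂ) * v r)
    have h2 : ‖W r - r * v r‖ ≤ 1 + ‖(r : ℂ) * v r‖ := (norm_sub_le _ _).trans (by rw [hW])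
    rw [le_div_iff₀ (pow_pos (lt_of_lt_of_le (by linarith) (hden r hr)) 2)]
    set x := ‖(r : ℂ) * v r‖
    calc β * ‖W r - r * v r‖ ^ 2 ≤ β * (1 + x) ^ 2 := by gcongr
      _ ≤ 1 - x ^ 2 := by
        simp only [hβ]
        have e1 : (1 - q) / 2 * (1 + x) ≤ 1 - x := by nlinarith
        nlinarith
  have hIoc : Ioc ρ R ⊆ Icc ρ R := Ioc_subset_Icc_self
  have hrpos : ∀ r ∈ Ioc ρ R, 0 < r := fun r hr => hρ.trans_lt hr.1
  have hint : interior (Ioc ρ R) ⊆ Ioc ρ R := interior_subset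
  -- The rate β yields the power decay |u(r)| ≤ (r/R)^β.
  have hdecay : MonotoneOn (fun r => r ^ 2 * ‖v r‖ ^ 2 * r ^ (-(2 * β))) (Ioc ρ R) := by
    have hd : ∀ r ∈ Ioc ρ R, HasDerivWithinAt (fun r => r ^ 2 * ‖v r‖ ^ 2 * r ^ (-(2 * β)))
        (2 * r * ‖v r‖ ^ 2 * r ^ (-(2 * β)) *
          ((1 - ‖(r : ℂ) * v r‖ ^ 2) / ‖W r - r * v r‖ ^ 2 - β)) (Ioc ρ R) r := by
      intro r hr
      have hr0 := hrpos r hr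
      have h1 := (hU r (hIoc hr)).mono hIoc
      have h2 := (Real.hasDerivAt_rpow_const (x := r) (p := -(2 * β))
        (Or.inl hr0.ne')).hasDerivWithinAt (s := Ioc ρ R)
      refine (h1.mul h2).congr_deriv ?_
      rw [Real.rpow_sub_one hr0.ne']
      generalize (1 - ‖(r : ℂ) * v r‖ ^ 2) / ‖W r - r * v r‖ ^ 2 = Z
      field_simp
      ring
    refine monotoneOn_of_hasDerivWithinAt_nonneg (convex_Ioc ρ R)
      (fun r hr => (hd r hr).continuousWithinAt)
      (fun r hr => (hd r (hint hr)).mono hint) fun r hr => ?_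
    have hr0 := hrpos r (hint hr)
    exact mul_nonneg (by positivity) (sub_nonneg.2 (hrate r (hIoc (hint hr))))
  have hux : ∀ r ∈ Ioc ρ R, r * ‖v r‖ ≤ (r / R) ^ β := by
    intro r hr
    have hr0 := hrpos r hr
    have h1 := hdecay hr (right_mem_Ioc.2 hρR) hr.2
    simp only at h1
    have h2 : R ^ 2 * ‖v R‖ ^ 2 ≤ 1 := by
      rw [← norm_ofReal_mul_sq]
      have := hq_all R (right_mem_Icc.2 hρR.le)
      nlinarith [norm_nonneg ((R : ℂ) * v R)]
    have h3 : r ^ 2 * ‖v r‖ ^ 2 * r ^ (-(2 * β)) ≤ R ^ (-(2 * β)) :=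
      h1.trans (mul_le_of_le_one_left (Real.rpow_nonneg hR0.le _) h2)
    rw [← sq_le_sq₀ (by positivity) (by positivity), ← Real.rpow_natCast ((r / R) ^ β) 2,
      ← Real.rpow_mul (by positivity), Real.div_rpow hr0.le hR0.le]
    rw [Real.rpow_neg hr0.le, Real.rpow_neg hR0.le, ← div_eq_mul_inv, ← one_div,
      div_le_div_iff₀ (by positivity) (by positivity)] at h3
    rw [le_div_iff₀ (by positivity)]
    push_cast
    rw [mul_comm β 2, mul_pow]
    linarith
  have hV := fun r (hr : r ∈ Icc ρ R) => hasDerivWithinAt_norm_sq_radial (hv r hr)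
  -- The logarithmic derivative of |v|² is at least -(2/β)|v| ≥ -(2/β)(r/R)^β/r. This bound is
  -- integrable at 0; the exponential weight is built from its integral.
  have hmonoV : MonotoneOn (fun r => ‖v r‖ ^ 2 * Real.exp (2 / β ^ 2 * (r / R) ^ β)) (Icc ρ R) := by
    refine monotoneOn_of_hasDerivWithinAt_nonneg (f' := fun r =>
      ‖v r‖ ^ 2 * Real.exp (2 / β ^ 2 * (r / R) ^ β) *
        (4 * (v r / (W r - r * v r)).re + 2 / β * ((r / R) ^ β / r))) (convex_Icc ρ R)
      (fun r hr => ?_) (fun r hr => ?_) fun r hr => ?_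
    · refine (hV r hr).continuousWithinAt.mul (ContinuousAt.continuousWithinAt ?_)
      exact (continuousAt_const.mul ((continuousAt_id.div_const R).rpow_const
        (Or.inr hβ0.le))).rexp
    · rw [interior_Icc] at hr ⊢
      have hr0 : 0 < r := hρ.trans_lt hr.1
      have h1 := (hV r (Ioo_subset_Icc_self hr)).mono (Ioo_subset_Icc_self (a := ρ) (b := R))
      have h2 := ((((hasDerivAt_id r).div_const R).rpow_const (p := β)
        (Or.inl (by simp only [id]; positivity))).const_mul (2 / β ^ 2)).exp.hasDerivWithinAt
          (s := Ioo ρ R)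
      refine (h1.mul h2).congr_deriv ?_
      simp only [id]
      rw [Real.rpow_sub_one (by positivity)]
      generalize (v r / (W r - r * v r)).re = Z
      field_simp
    · rw [interior_Icc] at hr
      have hr0 : 0 < r := hρ.trans_lt hr.1
      have hr' := Ioo_subset_Icc_self hr
      refine mul_nonneg (by positivity) ?_
      have h1 : -(‖v r‖ / (2 * β)) ≤ (v r / (W r - r * v r)).re := by
        have h2 := (abs_le.1 (Complex.abs_re_le_norm (v r / (W r - r * v r)))).1
        refine le_trans (neg_le_neg ?_) h2
        rw [norm_div]
        have := hden r hr'
        gcongr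
      have h3 : ‖v r‖ ≤ (r / R) ^ β / r := by
        rw [le_div_iff₀ hr0, mul_comm]
        exact hux r ⟨hr.1, hr.2.le⟩
      have h4 : 2 / β * ‖v r‖ ≤ 2 / β * ((r / R) ^ β / r) := by gcongr
      have h5 : 4 * (‖v r‖ / (2 * β)) = 2 / β * ‖v r‖ := by field_simp; ring
      linarith
  have h := hmonoV (left_mem_Icc.2 hρR.le) (right_mem_Icc.2 hρR.le) hρR.le
  simp only [div_self hR0.ne', Real.one_rpow, mul_one] at h
  have h1 : 1 ≤ Real.exp (2 / β ^ 2 * (ρ / R) ^ β) := Real.one_le_exp (by positivity)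
  have h2 : ‖v ρ‖ ^ 2 ≤ ‖v R‖ ^ 2 * Real.exp (2 / β ^ 2) :=
    (le_mul_of_one_le_right (by positivity) h1).trans h
  rw [← sq_le_sq₀ (norm_nonneg _) (by positivity), mul_pow, ← Real.exp_nat_mul]
  have h3 : ((2 : ℕ) : ℝ) * (4 / (1 - q) ^ 2) = 2 / β ^ 2 := by
    simp only [hβ]
    have : (1 - q) ≠ 0 := by linarith
    push_cast
    field_simp
    norm_num
  rwa [h3]

/-- Backward solvability from any point of the unit disk. -/
theorem exists_radial_backward {W : ℝ → ℂ} (hWc : Continuous W) (hW : ∀ r, ‖W r‖ = 1) {R : ℝ}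
    (hR : 0 ≤ R) {v₀ : ℂ} (hv₀ : ‖(R : ℂ) * v₀‖ < 1) :
    ∃ v, IsRadialSolution W R v ∧ v R = v₀ := by
  set q := ‖(R : ℂ) * v₀‖ with hqdef
  have hq0 : 0 ≤ q := norm_nonneg _
  -- Halfway between q and 1, and M below carries an extra 1: the a priori bounds q and M - 1 are
  -- then strictly inside the truncation thresholds.
  set q' := (1 + q) / 2 with hq'
  have hqq' : q < q' := by simp only [hq']; linarith
  have hq'1 : q' < 1 := by simp only [hq']; linarith
  set M := ‖v₀‖ * Real.exp (4 / (1 - q) ^ 2) + 1 with hMdef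
  have hM : 0 ≤ M := by positivity
  set δ := 1 - q' with hδdef
  have hδ : 0 < δ := by simp only [hδdef]; linarith
  obtain ⟨v, hvR, hv⟩ := exists_truncField_solution hWc hδ hM (right_mem_Icc.2 hR) v₀
  have hvc : ContinuousOn v (Icc 0 R) := fun r hr => (hv r hr).continuousWithinAt
  have hrv : ContinuousOn (fun r : ℝ => (r : ℂ) * v r) (Icc 0 R) :=
    Complex.continuous_ofReal.continuousOn.mul hvc
  have hδv : ∀ r : ℝ, ‖(r : ℂ) * v r‖ ≤ q' → δ ≤ ‖W r - r * v r‖ := fun r hr => by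
    have := one_sub_norm_le (u := (r : ℂ) * v r) (hW r)
    simp only [hδdef]; linarith
  set Bad : Set ℝ := {r | r ∈ Icc 0 R ∧ 0 ≤ max (‖v r‖ - M) (‖(r : ℂ) * v r‖ - q')} with hBad
  have hgood : ∀ r ∈ Icc 0 R, r ∉ Bad → ‖v r‖ < M ∧ ‖(r : ℂ) * v r‖ < q' := by
    intro r hr hnb
    have : max (‖v r‖ - M) (‖(r : ℂ) * v r‖ - q') < 0 := by
      by_contra hcon
      exact hnb ⟨hr, not_lt.1 hcon⟩
    rw [max_lt_iff] at this
    exact ⟨by linarith [this.1], by linarith [this.2]⟩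
  -- At the last bad parameter the a priori bounds hold by continuity from the right, and they
  -- contradict badness.
  have hempty : ¬ Bad.Nonempty := by
    intro hne
    have hclosed : IsClosed Bad :=
      ContinuousOn.preimage_isClosed_of_isClosed
        (ContinuousOn.sup (hvc.norm.sub continuousOn_const) (hrv.norm.sub continuousOn_const))
        isClosed_Icc isClosed_Ici
    have hbdd : BddAbove Bad := ⟨R, fun r hr => hr.1.2⟩
    set ρ := sSup Bad
    have hρ : ρ ∈ Bad := hclosed.csSup_mem hne hbdd
    have hlt : ∀ r ∈ Ioc ρ R, r ∉ Bad := fun r hr h => not_le.2 hr.1 (le_csSup hbdd h)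
    have hsub : Icc ρ R ⊆ Icc 0 R := Icc_subset_Icc_left hρ.1.1
    have hv₀M : ‖v₀‖ < M := by
      have h1 : 1 ≤ Real.exp (4 / (1 - q) ^ 2) := Real.one_le_exp (by positivity)
      have := le_mul_of_one_le_right (norm_nonneg v₀) h1
      simp only [hMdef]; linarith
    have hRb : R ∉ Bad := by
      intro h
      have := h.2
      rw [le_max_iff, hvR] at this
      rcases this with h | h <;> linarith
    have hρR : ρ < R := lt_of_le_of_ne hρ.1.2 fun h => hRb (h ▸ hρ)
    have hg := fun r (hr : r ∈ Ioc ρ R) => hgood r (hsub (Ioc_subset_Icc_self hr)) (hlt r hr)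
    have hcl : ∀ {f : ℝ → ℝ} {k : ℝ}, ContinuousOn f (Icc 0 R) → (∀ r ∈ Ioc ρ R, f r ≤ k) →
        ∀ r ∈ Icc ρ R, f r ≤ k := by
      intro f k hf hk r hr
      rw [← closure_Ioc hρR.ne] at hr
      refine closure_minimal (s := Ioc ρ R) (t := Icc ρ R ∩ f ⁻¹' Iic k)
        (fun x hx => ⟨Ioc_subset_Icc_self hx, hk x hx⟩) ?_ hr |>.2
      exact (hf.mono hsub).preimage_isClosed_of_isClosed isClosed_Icc isClosed_Iic
    have hMv : ∀ r ∈ Icc ρ R, ‖v r‖ ≤ M := hcl hvc.norm fun r hr => (hg r hr).1.le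
    have hqv : ∀ r ∈ Icc ρ R, ‖(r : ℂ) * v r‖ ≤ q' := hcl hrv.norm fun r hr => (hg r hr).2.le
    have hb := radial_backward_bounds hW hρ.1.1 hρR hq0 hv₀ hδ (v := v) (fun r hr => by
      rw [← truncField_eq hδ (hMv r hr) (hδv r (hqv r hr))]
      exact (hv r (hsub hr)).mono hsub) (fun r hr => hδv r (hqv r hr))
      (fun r hr => (hqv r hr).trans hq'1.le) (by rw [hvR])
    have := hρ.2
    rw [le_max_iff] at this
    rw [hvR] at hb
    rcases this with h | h
    · linarith [hb.2]
    · linarith [hb.1]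
  have hg := fun r (hr : r ∈ Icc 0 R) => hgood r hr fun h => hempty ⟨r, h⟩
  refine ⟨v, ⟨fun r hr => ?_, fun r hr => (hg r hr).2.trans hq'1⟩, hvR⟩
  rw [← truncField_eq hδ (hg r hr).1.le (hδv r (hg r hr).2.le)]
  exact hv r hr

/-! ### The driving function and the half-plane coordinate -/

/-- `sin α` at time `t`. -/
def sleSin (p T t : ℝ) : ℝ := Real.exp (-p * (T - t))

/-- The angle `α` at time `t`. -/
def sleAngle (p T t : ℝ) : ℝ := Real.arcsin (sleSin p T t)

/-- `tan α` at time `t`. -/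
def sleTan (p T t : ℝ) : ℝ := Real.tan (sleAngle p T t)

/-- The driving angle in terms of `p = -(ρ + 2) / 4`. -/
def sleDriving (p T t : ℝ) : ℝ := (2 + 1 / p) * sleAngle p T t

theorem wholePlaneSLEDriving_eq {ρ : ℝ} (hρ : ρ < -2) (T : ℝ) :
    wholePlaneSLEDriving ρ T 0 = sleDriving (-(ρ + 2) / 4) T := by
  funext t
  have : ρ + 2 ≠ 0 := by linarith
  rw [wholePlaneSLEDriving, sleDriving, sleAngle, sleSin, add_zero]
  congr 1
  · field_simp; ring
  · congr 2; ring

theorem sleSin_pos (p T t : ℝ) : 0 < sleSin p T t := Real.exp_pos _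

theorem sleSin_lt_one {p T t : ℝ} (hp : 0 < p) (ht : t < T) : sleSin p T t < 1 :=
  Real.exp_lt_one_iff.2 (by nlinarith)

theorem sin_sleAngle {p T t : ℝ} (hp : 0 < p) (ht : t < T) :
    Real.sin (sleAngle p T t) = sleSin p T t :=
  Real.sin_arcsin (by linarith [sleSin_pos p T t]) (sleSin_lt_one hp ht).le

theorem sleAngle_pos (p T t : ℝ) : 0 < sleAngle p T t := Real.arcsin_pos.2 (sleSin_pos p T t)

theorem sleAngle_lt {p T t : ℝ} (hp : 0 < p) (ht : t < T) : sleAngle p T t < Real.pi / 2 :=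
  Real.arcsin_lt_pi_div_two.2 (sleSin_lt_one hp ht)

theorem cos_sleAngle_pos {p T t : ℝ} (hp : 0 < p) (ht : t < T) : 0 < Real.cos (sleAngle p T t) :=
  Real.cos_pos_of_mem_Ioo ⟨by linarith [sleAngle_pos p T t, Real.pi_pos], sleAngle_lt hp ht⟩

theorem sleTan_pos {p T t : ℝ} (hp : 0 < p) (ht : t < T) : 0 < sleTan p T t :=
  Real.tan_pos_of_pos_of_lt_pi_div_two (sleAngle_pos p T t) (sleAngle_lt hp ht)

theorem hasDerivAt_sleAngle {p T t : ℝ} (hp : 0 < p) (ht : t < T) :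
    HasDerivAt (sleAngle p T) (p * sleTan p T t) t := by
  have h1 : HasDerivAt (sleSin p T) (sleSin p T t * p) t := by
    have := (((hasDerivAt_id t).const_sub T).const_mul (-p)).exp
    refine this.congr_deriv ?_
    simp [sleSin]
  have h2 := (Real.hasDerivAt_arcsin (x := sleSin p T t) (by linarith [sleSin_pos p T t])
    (sleSin_lt_one hp ht).ne).comp t h1
  refine h2.congr_deriv ?_
  rw [sleTan, Real.tan_eq_sin_div_cos, sin_sleAngle hp ht, sleAngle, Real.cos_arcsin]
  ring

theorem hasDerivAt_sleTan {p T t : ℝ} (hp : 0 < p) (ht : t < T) :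
    HasDerivAt (sleTan p T) (p * sleTan p T t * (1 + sleTan p T t ^ 2)) t := by
  have hc := (cos_sleAngle_pos hp ht).ne'
  have h := (Real.hasDerivAt_tan hc).comp t (hasDerivAt_sleAngle hp ht)
  refine h.congr_deriv ?_
  rw [one_div, ← Real.inv_one_add_tan_sq hc, inv_inv, sleTan]
  ring

theorem tendsto_sleSin_atBot {p : ℝ} (hp : 0 < p) (T : ℝ) :
    Tendsto (sleSin p T) atBot (𝓝 0) := by
  refine Real.tendsto_exp_atBot.comp ?_
  have : Tendsto (fun t : ℝ => p * t + -(p * T)) atBot atBot :=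
    tendsto_atBot_add_const_right _ _ (tendsto_id.const_mul_atBot hp)
  refine this.congr fun t => by ring

theorem tendsto_sleAngle_atBot {p : ℝ} (hp : 0 < p) (T : ℝ) :
    Tendsto (sleAngle p T) atBot (𝓝 0) := by
  have := (Real.continuous_arcsin.tendsto 0).comp (tendsto_sleSin_atBot hp T)
  rwa [Real.arcsin_zero] at this

/-- The half-plane coordinate of the point `u` of the unit disk at time `t`. -/
def sleCoord (p T t : ℝ) (u : ℂ) : ℂ :=
  (1 - Complex.exp (-(Complex.I * (sleAngle p T t / p : ℝ))) * u) /
    (1 + Complex.exp (-(Complex.I * (sleAngle p T t / p : ℝ))) * u)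

theorem norm_exp_neg_I_mul (x : ℝ) : ‖Complex.exp (-(Complex.I * x))‖ = 1 := by
  rw [Complex.norm_exp]; simp

theorem norm_exp_I_mul' (x : ℝ) : ‖Complex.exp (Complex.I * x)‖ = 1 := by
  rw [Complex.norm_exp]; simp

theorem one_add_ne_zero_of_norm_lt {x : ℂ} (h : ‖x‖ < 1) : 1 + x ≠ 0 := fun h0 => by
  have : x = -1 := by linear_combination h0
  rw [this] at h; simp at h

theorem cayley_mem_rightHalfPlane {x : ℂ} (h : ‖x‖ < 1) : (1 - x) / (1 + x) ∈ rightHalfPlane := by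
  have h1 := one_add_ne_zero_of_norm_lt h
  have h2 : 0 < Complex.normSq (1 + x) := Complex.normSq_pos.2 h1
  have h3 : Complex.normSq x < 1 := by
    rw [Complex.normSq_eq_norm_sq]; nlinarith [norm_nonneg x]
  show 0 < ((1 - x) / (1 + x)).re
  rw [Complex.div_re, ← add_div]
  refine div_pos ?_ h2
  rw [Complex.normSq_apply] at h3
  simp
  nlinarith

theorem sleCoord_mem {p T t : ℝ} {u : ℂ} (hu : ‖u‖ < 1) : sleCoord p T t u ∈ rightHalfPlane :=
  cayley_mem_rightHalfPlane (by rw [norm_mul, norm_exp_neg_I_mul, one_mul]; exact hu)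

theorem one_sub_I_mul_ne_zero (x : ℝ) : 1 - Complex.I * x ≠ 0 := fun h => by
  have := congrArg Complex.re h
  simp at this

theorem exp_two_I_mul_sleAngle {p T t : ℝ} (hp : 0 < p) (ht : t < T) :
    Complex.exp (Complex.I * (2 * sleAngle p T t : ℝ)) =
      (1 + Complex.I * sleTan p T t) / (1 - Complex.I * sleTan p T t) := by
  have hc : (Real.cos (sleAngle p T t) : ℂ) ≠ 0 := by
    exact_mod_cast (cos_sleAngle_pos hp ht).ne'
  have h1 : (sleTan p T t : ℂ) * Real.cos (sleAngle p T t) = Real.sin (sleAngle p T t) := by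
    rw [sleTan, ← Complex.ofReal_mul, Real.tan_mul_cos (cos_sleAngle_pos hp ht).ne']
  rw [eq_div_iff (one_sub_I_mul_ne_zero _)]
  have hE : Complex.exp (Complex.I * (2 * sleAngle p T t : ℝ)) =
      Complex.exp (sleAngle p T t * Complex.I) * Complex.exp (sleAngle p T t * Complex.I) := by
    rw [← Complex.exp_add]; congr 1; push_cast; ring
  have hE2 : Complex.exp (sleAngle p T t * Complex.I) =
      Real.cos (sleAngle p T t) + Real.sin (sleAngle p T t) * Complex.I := by
    rw [Complex.exp_mul_I]; push_cast; rfl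
  have hs : (Real.sin (sleAngle p T t) : ℂ) ^ 2 + (Real.cos (sleAngle p T t) : ℂ) ^ 2 = 1 := by
    exact_mod_cast Real.sin_sq_add_cos_sq _
  rw [hE, hE2]
  refine mul_right_cancel₀ hc ?_
  generalize (Real.cos (sleAngle p T t) : ℂ) = C at *
  generalize (Real.sin (sleAngle p T t) : ℂ) = S at *
  generalize (sleTan p T t : ℂ) = x at *
  have e1 : (C + S * Complex.I) * (C + S * Complex.I) * (1 - Complex.I * x) * C =
    (C + S * Complex.I) * (C + S * Complex.I) * (C - S * Complex.I) := by
    linear_combination (-(C + S * Complex.I) * (C + S * Complex.I) * Complex.I) * h1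
  rw [e1]
  linear_combination (C + S * Complex.I) * hs - (C + S * Complex.I) * S ^ 2 * Complex.I_sq -
    Complex.I * h1

theorem exp_I_mul_sleDriving {p T t : ℝ} (hp : 0 < p) (ht : t < T) :
    Complex.exp (Complex.I * (sleDriving p T t : ℝ)) =
      Complex.exp (Complex.I * (sleAngle p T t / p : ℝ)) *
      ((1 + Complex.I * sleTan p T t) / (1 - Complex.I * sleTan p T t)) := by
  rw [← exp_two_I_mul_sleAngle hp ht, ← Complex.exp_add]
  congr 1
  rw [sleDriving]
  push_cast
  ring

theorem exp_neg_mul_exp (x : ℝ) :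
    Complex.exp (-(Complex.I * x)) * Complex.exp (Complex.I * x) = 1 := by
  rw [← Complex.exp_add]; simp

theorem one_add_exp_mul_driving {p T t : ℝ} (hp : 0 < p) (ht : t < T) :
    1 + Complex.exp (-(Complex.I * (sleAngle p T t / p : ℝ))) *
      Complex.exp (Complex.I * (sleDriving p T t : ℝ)) = 2 / (1 - Complex.I * sleTan p T t) := by
  have h := one_sub_I_mul_ne_zero (sleTan p T t)
  rw [exp_I_mul_sleDriving hp ht, ← mul_assoc, exp_neg_mul_exp, one_mul]
  field_simp
  ring

/-- The rotation by -α/p leaves e^{2iα}, which the Cayley transform sends to -i tan α. -/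
theorem sleCoord_driving {p T t : ℝ} (hp : 0 < p) (ht : t < T) :
    sleCoord p T t (Complex.exp (Complex.I * (sleDriving p T t : ℝ))) =
      -(Complex.I * sleTan p T t) := by
  have h := one_sub_I_mul_ne_zero (sleTan p T t)
  rw [sleCoord, one_add_exp_mul_driving hp ht, exp_I_mul_sleDriving hp ht, ← mul_assoc,
    exp_neg_mul_exp, one_mul]
  field_simp
  ring

/-- Since α' = pτ, the rotating factor contributes only -iτ to the logarithmic derivative. The
Loewner equation thus becomes rational in c and τ, in the form required by
`hasDerivWithinAt_sleF_comp`. -/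
theorem hasDerivWithinAt_sleCoord {p T s : ℝ} (hp : 0 < p) (hs : s < T) {u : ℝ → ℂ} {S : Set ℝ}
    (hu1 : ‖u s‖ < 1)
    (hu : HasDerivWithinAt u (u s * ((Complex.exp (Complex.I * (sleDriving p T s : ℂ)) + u s) /
      (Complex.exp (Complex.I * (sleDriving p T s : ℂ)) - u s))) S s) :
    HasDerivWithinAt (fun s => sleCoord p T s (u s))
      ((sleCoord p T s (u s) ^ 2 - 1) * (1 + sleTan p T s ^ 2) /
        (2 * (sleCoord p T s (u s) + Complex.I * sleTan p T s))) S s := by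
  have hpc : (p : ℂ) ≠ 0 := by exact_mod_cast hp.ne'
  have ht1 := one_sub_I_mul_ne_zero (sleTan p T s)
  have hα : HasDerivWithinAt (fun s => Complex.exp (-(Complex.I * (sleAngle p T s / p : ℝ))))
      (Complex.exp (-(Complex.I * (sleAngle p T s / p : ℝ))) * -(Complex.I * sleTan p T s)) S s := by
    have h1 := ((hasDerivAt_sleAngle hp hs).div_const p).ofReal_comp.hasDerivWithinAt (s := S)
    have h2 := ((h1.const_mul Complex.I).neg).cexp
    refine h2.congr_deriv ?_
    simp only [Pi.neg_apply]
    push_cast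
    field_simp
  have hx := hα.mul hu
  set e := Complex.exp (-(Complex.I * (sleAngle p T s / p : ℝ))) with he
  have hnx : ‖e * u s‖ < 1 := by rw [norm_mul, norm_exp_neg_I_mul, one_mul]; exact hu1
  have hne := one_add_ne_zero_of_norm_lt hnx
  have hc := (hx.const_sub 1).div (hx.const_add 1) hne
  refine hc.congr_deriv ?_
  have hW : Complex.exp (Complex.I * (sleDriving p T s : ℂ)) * e =
      (1 + Complex.I * sleTan p T s) / (1 - Complex.I * sleTan p T s) := by
    rw [exp_I_mul_sleDriving hp hs, mul_comm, ← mul_assoc, he, exp_neg_mul_exp, one_mul]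
  have hcoord : sleCoord p T s (u s) = (1 - e * u s) / (1 + e * u s) := rfl
  have hcm : (1 - e * u s) / (1 + e * u s) ∈ rightHalfPlane := cayley_mem_rightHalfPlane hnx
  have hD0 := add_I_mul_ne_zero hcm (sleTan p T s)
  rw [hcoord]
  have he0 : e ≠ 0 := Complex.exp_ne_zero _
  have hratio : (Complex.exp (Complex.I * (sleDriving p T s : ℂ)) + u s) /
      (Complex.exp (Complex.I * (sleDriving p T s : ℂ)) - u s) =
      ((1 + Complex.I * sleTan p T s) + e * u s * (1 - Complex.I * sleTan p T s)) /
      ((1 + Complex.I * sleTan p T s) - e * u s * (1 - Complex.I * sleTan p T s)) := by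
    rw [← mul_div_mul_right _ _ he0, add_mul, sub_mul, hW, ← mul_div_mul_right _ _ ht1, add_mul,
      sub_mul, div_mul_cancel₀ _ ht1, mul_comm (u s) e]
  simp only [Pi.mul_apply]
  rw [hratio, ← he]
  have hD : (1 + Complex.I * sleTan p T s) - e * u s * (1 - Complex.I * sleTan p T s) ≠ 0 := by
    intro h
    apply hD0
    rw [div_add' _ _ _ hne, div_eq_zero_iff]
    left
    linear_combination h
  have hD0' : (1 - e * u s) / (1 + e * u s) + Complex.I * sleTan p T s =
      ((1 + Complex.I * sleTan p T s) - e * u s * (1 - Complex.I * sleTan p T s)) /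
        (1 + e * u s) := by
    rw [div_add' _ _ _ hne]
    congr 1
    ring
  rw [hD0']
  have hx2 : e * (u s * (((1 + Complex.I * sleTan p T s) + e * u s * (1 - Complex.I * sleTan p T s)) /
      ((1 + Complex.I * sleTan p T s) - e * u s * (1 - Complex.I * sleTan p T s)))) =
      e * u s * (((1 + Complex.I * sleTan p T s) + e * u s * (1 - Complex.I * sleTan p T s)) /
      ((1 + Complex.I * sleTan p T s) - e * u s * (1 - Complex.I * sleTan p T s))) := by ring
  have hx1 : e * -(Complex.I * sleTan p T s) * u s = e * u s * -(Complex.I * sleTan p T s) := by ring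
  rw [hx1, hx2]
  generalize (sleTan p T s : ℂ) = x at *
  have hE : ∃ D, D = (1 + Complex.I * x) - e * u s * (1 - Complex.I * x) := ⟨_, rfl⟩
  obtain ⟨D, hDD⟩ := hE
  rw [← hDD] at hD ⊢
  generalize e * u s = ξ at *
  field_simp
  rw [hDD]
  linear_combination (4 * ξ * x ^ 2 * (1 + ξ)) * Complex.I_sq

/-! ### Trajectories and the inverse map -/

theorem tendsto_trajectory_zero {u : ℝ → ℂ} {z : ℂ}
    (h : Tendsto (fun s : ℝ => (Real.exp (-s) : ℂ) * u s) atBot (𝓝 z)) :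
    Tendsto u atBot (𝓝 0) := by
  have h1 : Tendsto (fun s : ℝ => (Real.exp s : ℂ)) atBot (𝓝 0) := by
    have := (Complex.continuous_ofReal.tendsto 0).comp Real.tendsto_exp_atBot
    rw [Complex.ofReal_zero] at this
    exact this
  have h2 := h1.mul h
  rw [zero_mul] at h2
  refine h2.congr fun s => ?_
  rw [← mul_assoc, ← Complex.ofReal_mul, ← Real.exp_add]
  simp

/-- Factoring 1/sin α = e^{p(T-t)} out of 1/τ + iB isolates the growth as t → -∞; what remains tends
to 1 along trajectories. -/
theorem exp_mul_log_sleQ {p T t : ℝ} (hp : 0 < p) (ht : t < T) {c : ℂ}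
    (hc : c ∈ rightHalfPlane) :
    Complex.exp ((1 / p : ℝ) * Complex.log (sleQ p (sleTan p T t) c)) =
      Real.exp (T - t) * Complex.exp ((1 / p : ℝ) *
        Complex.log (Real.cos (sleAngle p T t) + Complex.I * sleSin p T t * sleB p c)) := by
  have hs := sleSin_pos p T t
  have hsc : (sleSin p T t : ℂ) ≠ 0 := by exact_mod_cast hs.ne'
  have hcos := (cos_sleAngle_pos hp ht).ne'
  have hQ : sleQ p (sleTan p T t) c = ((sleSin p T t)⁻¹ : ℝ) *
      (Real.cos (sleAngle p T t) + Complex.I * sleSin p T t * sleB p c) := by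
    rw [sleQ, sleTan, Real.tan_eq_sin_div_cos, sin_sleAngle hp ht, one_div_div]
    push_cast
    field_simp
  have hne : (Real.cos (sleAngle p T t) + Complex.I * sleSin p T t * sleB p c) ≠ 0 := by
    intro h
    have := sleQ_im_pos hp (sleTan p T t) hc
    rw [hQ, h] at this
    simp at this
  rw [hQ, Complex.log_ofReal_mul (inv_pos.2 hs) hne, mul_add, Complex.exp_add]
  congr 1
  rw [Real.log_inv, sleSin, Real.log_exp, ← Complex.ofReal_mul, ← Complex.ofReal_exp]
  congr 2
  field_simp

/-- Here u → 0, α → 0 and c → 1, with 1 - c² = 4x/(1 + x)² for the rotated point x. The prefactor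
e^{-T}/4 and the growth e^{T-s} reduce the expression to e^{-s}u times factors tending to 1. -/
theorem tendsto_sleF_atBot {p T : ℝ} (hp : 0 < p) {t : ℝ} (ht : t < T) {u : ℝ → ℂ} {z : ℂ}
    (hu1 : ∀ s ≤ t, ‖u s‖ < 1)
    (hu : Tendsto (fun s : ℝ => (Real.exp (-s) : ℂ) * u s) atBot (𝓝 z)) :
    Tendsto (fun s => sleF p T (sleTan p T s) (sleCoord p T s (u s))) atBot (𝓝 z) := by
  have hu0 := tendsto_trajectory_zero hu
  have hα := tendsto_sleAngle_atBot hp T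
  have he : Tendsto (fun s => Complex.exp (-(Complex.I * (sleAngle p T s / p : ℝ)))) atBot (𝓝 1) := by
    have h : Continuous fun x : ℝ => Complex.exp (-(Complex.I * (x / p : ℝ))) := by fun_prop
    have := (h.tendsto 0).comp hα
    simp only [zero_div, Complex.ofReal_zero, mul_zero, neg_zero, Complex.exp_zero] at this
    exact this
  have hx : Tendsto (fun s => Complex.exp (-(Complex.I * (sleAngle p T s / p : ℝ))) * u s) atBot
      (𝓝 0) := by simpa using he.mul hu0
  have hc : Tendsto (fun s => sleCoord p T s (u s)) atBot (𝓝 1) := by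
    have := (hx.const_sub 1).div (hx.const_add 1) (by simp)
    simp only [sub_zero, add_zero, div_one] at this
    exact this
  have h1 : (1 : ℂ) ∈ rightHalfPlane := by simp [rightHalfPlane]
  have hB : Tendsto (fun s => sleB p (sleCoord p T s (u s))) atBot (𝓝 1) := by
    obtain ⟨B', hB', -⟩ := hasDerivAt_sleB hp h1
    have := hB'.continuousAt.tendsto.comp hc
    rwa [sleB_one] at this
  have hcos : Tendsto (fun s => ((Real.cos (sleAngle p T s) : ℝ) : ℂ)) atBot (𝓝 1) := by
    have := ((Complex.continuous_ofReal.comp Real.continuous_cos).tendsto 0).comp hα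
    simp only [Function.comp_apply, Real.cos_zero, Complex.ofReal_one] at this
    exact this
  have hsin : Tendsto (fun s => ((sleSin p T s : ℝ) : ℂ)) atBot (𝓝 0) := by
    have := (Complex.continuous_ofReal.tendsto 0).comp (tendsto_sleSin_atBot hp T)
    rw [Complex.ofReal_zero] at this
    exact this
  have hL : Tendsto (fun s => Complex.exp ((1 / p : ℝ) * Complex.log
      (Real.cos (sleAngle p T s) + Complex.I * sleSin p T s * sleB p (sleCoord p T s (u s)))))
      atBot (𝓝 1) := by
    have h := hcos.add (((hsin.const_mul Complex.I)).mul hB)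
    simp only [mul_zero, zero_mul, add_zero] at h
    have h2 := ((h.clog Complex.one_mem_slitPlane).const_mul ((1 / p : ℝ) : ℂ)).cexp
    simpa using h2
  have hmain : Tendsto (fun s => ((Real.exp (-s) : ℂ) * u s) *
      Complex.exp (-(Complex.I * (sleAngle p T s / p : ℝ))) /
      (1 + Complex.exp (-(Complex.I * (sleAngle p T s / p : ℝ))) * u s) ^ 2 *
      Complex.exp ((1 / p : ℝ) * Complex.log
      (Real.cos (sleAngle p T s) + Complex.I * sleSin p T s * sleB p (sleCoord p T s (u s)))))
      atBot (𝓝 z) := by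
    have := ((hu.mul he).div ((hx.const_add 1).pow 2) (by simp)).mul hL
    simpa using this
  refine hmain.congr' ?_
  filter_upwards [eventually_le_atBot t] with s hs
  rw [sleF, exp_mul_log_sleQ hp (hs.trans_lt ht) (sleCoord_mem (hu1 s hs))]
  have hne : 1 + Complex.exp (-(Complex.I * (sleAngle p T s / p : ℝ))) * u s ≠ 0 :=
    one_add_ne_zero_of_norm_lt (by rw [norm_mul, norm_exp_neg_I_mul, one_mul]; exact hu1 s hs)
  generalize Complex.exp ((1 / p : ℝ) * Complex.log
      (Real.cos (sleAngle p T s) + Complex.I * sleSin p T s * sleB p (sleCoord p T s (u s)))) = E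
  have hexp : (Real.exp (-s) : ℂ) = Real.exp (-T) * Real.exp (T - s) := by
    rw [← Complex.ofReal_mul, ← Real.exp_add]; congr 2; ring
  rw [hexp, sleCoord]
  generalize Complex.exp (-(Complex.I * (sleAngle p T s / p : ℝ))) = e at *
  have hcoord : 1 - ((1 - e * u s) / (1 + e * u s)) ^ 2 = 4 * (e * u s) / (1 + e * u s) ^ 2 := by
    field_simp
    ring
  rw [hcoord]
  push_cast
  ring

/-- The inverse of the mapping-out function recovers the starting point of a trajectory. -/
theorem sleF_trajectory {p T : ℝ} (hp : 0 < p) {t : ℝ} (ht : t < T) {u : ℝ → ℂ} {z : ℂ}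
    (hu : IsWholePlaneLoewnerTrajectory (sleDriving p T) t z u) {s : ℝ} (hs : s ≤ t) :
    sleF p T (sleTan p T s) (sleCoord p T s (u s)) = z := by
  have hd : ∀ s ≤ t, HasDerivWithinAt
      (fun s => sleF p T (sleTan p T s) (sleCoord p T s (u s))) 0 (Iic t) s := fun s hs =>
    hasDerivWithinAt_sleF_comp hp T (sleTan_pos hp (hs.trans_lt ht)) (sleCoord_mem (hu.norm_lt_one s hs))
      (hasDerivAt_sleTan hp (hs.trans_lt ht)).hasDerivWithinAt
      (hasDerivWithinAt_sleCoord hp (hs.trans_lt ht) (hu.norm_lt_one s hs) (hu.hasDeriv s hs))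
  have hconst : ∀ r ≤ s, sleF p T (sleTan p T s) (sleCoord p T s (u s)) =
      sleF p T (sleTan p T r) (sleCoord p T r (u r)) := fun r hr => by
    refine constant_of_has_deriv_right_zero (a := r) (b := s)
      (f := fun s => sleF p T (sleTan p T s) (sleCoord p T s (u s))) (fun x hx => ?_)
      (fun x hx => ?_) s (right_mem_Icc.2 hr)
    · exact (hd x (hx.2.trans hs)).continuousWithinAt.mono fun y hy => hy.2.trans hs
    · refine (hd x (hx.2.le.trans hs)).mono_of_mem_nhdsWithin ?_
      exact mem_of_superset (Icc_mem_nhdsGE_of_mem hx) fun y hy => hy.2.trans hs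
  refine tendsto_nhds_unique (tendsto_const_nhds.congr' ?_)
    (tendsto_sleF_atBot hp ht hu.norm_lt_one hu.initial)
  filter_upwards [eventually_le_atBot s] with r hr using hconst r hr

/-! ### Radial variables -/

/-- The driving term as a function of `r = exp s`, extended continuously to `r = 0`. -/
def sleRadialDriving (p T r : ℝ) : ℂ :=
  Complex.exp (Complex.I *
    ((2 + 1 / p) * Real.arcsin (Real.exp (-(p * T)) * r ^ p) : ℝ))

theorem continuous_sleRadialDriving {p : ℝ} (hp : 0 < p) (T : ℝ) :
    Continuous (sleRadialDriving p T) := by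
  have h1 : Continuous fun r : ℝ => r ^ p := Real.continuous_rpow_const hp.le
  have h2 : Continuous fun r : ℝ => (2 + 1 / p) * Real.arcsin (Real.exp (-(p * T)) * r ^ p) :=
    continuous_const.mul (Real.continuous_arcsin.comp (continuous_const.mul h1))
  exact Complex.continuous_exp.comp (continuous_const.mul (Complex.continuous_ofReal.comp h2))

theorem norm_sleRadialDriving (p T r : ℝ) : ‖sleRadialDriving p T r‖ = 1 := norm_exp_I_mul' _

theorem sleRadialDriving_exp (p T s : ℝ) :
    sleRadialDriving p T (Real.exp s) = Complex.exp (Complex.I * (sleDriving p T s : ℂ)) := by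
  rw [sleRadialDriving, sleDriving, sleAngle, sleSin, ← Real.exp_mul, ← Real.exp_add]
  congr 6
  ring

/-- In the variables r = e^s and v = u/r the initial condition at s = -∞ becomes an ordinary initial
value at r = 0. -/
theorem IsRadialSolution.trajectory {p T t : ℝ} {v : ℝ → ℂ}
    (hv : IsRadialSolution (sleRadialDriving p T) (Real.exp t) v) :
    IsWholePlaneLoewnerTrajectory (sleDriving p T) t (v 0)
      (fun s => (Real.exp s : ℂ) * v (Real.exp s)) := by
  have hmem : ∀ s ≤ t, Real.exp s ∈ Icc 0 (Real.exp t) := fun s hs =>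
    ⟨(Real.exp_pos s).le, Real.exp_le_exp.2 hs⟩
  refine ⟨fun s hs => hv.norm_lt_one _ (hmem s hs), fun s hs => ?_, ?_⟩
  · have h1 := (Real.hasDerivAt_exp s).hasDerivWithinAt (s := Iic t)
    have h2 := (hv.hasDeriv _ (hmem s hs)).scomp s h1 fun x hx => hmem x hx
    have h3 := h1.ofReal_comp.mul h2
    refine h3.congr_deriv ?_
    have hlt := hv.norm_lt_one _ (hmem s hs)
    have hne : Complex.exp (Complex.I * (sleDriving p T s : ℂ)) -
        (Real.exp s : ℂ) * v (Real.exp s) ≠ 0 := by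
      have := one_sub_norm_le (u := (Real.exp s : ℂ) * v (Real.exp s))
        (norm_exp_I_mul' (sleDriving p T s))
      exact norm_pos_iff.1 (by linarith)
    rw [sleRadialDriving_exp]
    simp only [Function.comp, Complex.real_smul]
    generalize Complex.exp (Complex.I * (sleDriving p T s : ℂ)) = w at *
    generalize (Real.exp s : ℂ) = e at *
    generalize v (Real.exp s) = y at *
    field_simp
    ring
  · have h0 : ContinuousWithinAt v (Icc 0 (Real.exp t)) 0 :=
      (hv.hasDeriv 0 ⟨le_rfl, (Real.exp_pos t).le⟩).continuousWithinAt
    have h1 : Tendsto Real.exp atBot (𝓝[Icc 0 (Real.exp t)] 0) := by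
      refine tendsto_nhdsWithin_iff.2 ⟨Real.tendsto_exp_atBot, ?_⟩
      filter_upwards [eventually_le_atBot t] with s hs using hmem s hs
    refine (h0.tendsto.comp h1).congr fun s => ?_
    rw [← mul_assoc, ← Complex.ofReal_mul, ← Real.exp_add]
    simp

/-- Every point of the half-plane is reached by a trajectory. -/
theorem exists_trajectory_sleCoord {p T t : ℝ} (hp : 0 < p) {c : ℂ}
    (hc : c ∈ rightHalfPlane) : ∃ v, IsRadialSolution (sleRadialDriving p T) (Real.exp t) v ∧
      sleCoord p T t (Real.exp t * v (Real.exp t)) = c := by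
  have hc0 : 0 < c.re := hc
  -- The Cayley transform is an involution, so (1 - c)/(1 + c), rotated back, is the endpoint from
  -- which to solve backward.
  have h1c : 1 + c ≠ 0 := fun h => by
    have := congrArg Complex.re h
    simp at this; linarith
  set ξ := (1 - c) / (1 + c) with hξ
  have hξ1 : ‖ξ‖ < 1 := by
    rw [hξ, norm_div, div_lt_one (norm_pos_iff.2 h1c), ← sq_lt_sq₀ (norm_nonneg _) (norm_nonneg _),
      ← Complex.normSq_eq_norm_sq, ← Complex.normSq_eq_norm_sq, Complex.normSq_apply,
      Complex.normSq_apply]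
    simp
    nlinarith
  have het : (Real.exp t : ℂ) ≠ 0 := by exact_mod_cast (Real.exp_pos t).ne'
  set v₀ := Complex.exp (Complex.I * (sleAngle p T t / p : ℝ)) * ξ / Real.exp t with hv₀
  have hv₀' : (Real.exp t : ℂ) * v₀ = Complex.exp (Complex.I * (sleAngle p T t / p : ℝ)) * ξ := by
    rw [hv₀, mul_div_cancel₀ _ het]
  obtain ⟨v, hv, hvR⟩ := exists_radial_backward (continuous_sleRadialDriving hp T)
    (norm_sleRadialDriving p T) (Real.exp_pos t).le (v₀ := v₀)
    (by rw [hv₀', norm_mul, norm_exp_I_mul', one_mul]; exact hξ1)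
  refine ⟨v, hv, ?_⟩
  rw [hvR, hv₀', sleCoord, ← mul_assoc, exp_neg_mul_exp, one_mul, hξ]
  field_simp
  ring

theorem sleF_mem_domain {p T t : ℝ} (hp : 0 < p) (ht : t < T) {c : ℂ} (hc : c ∈ rightHalfPlane) :
    sleF p T (sleTan p T t) c ∈ wholePlaneLoewnerDomain (sleDriving p T) t := by
  obtain ⟨v, hv, hvc⟩ := exists_trajectory_sleCoord (T := T) (t := t) hp hc
  have := sleF_trajectory hp ht hv.trajectory le_rfl
  rw [hvc] at this
  rw [this]
  exact ⟨_, hv.trajectory⟩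

theorem wholePlaneLoewnerDomain_eq_image {p T t : ℝ} (hp : 0 < p) (ht : t < T) :
    wholePlaneLoewnerDomain (sleDriving p T) t = sleF p T (sleTan p T t) '' rightHalfPlane := by
  refine Subset.antisymm ?_ ?_
  · rintro z ⟨u, hu⟩
    exact ⟨_, sleCoord_mem (hu.norm_lt_one t le_rfl), sleF_trajectory hp ht hu le_rfl⟩
  · rintro _ ⟨c, hc, rfl⟩
    exact sleF_mem_domain hp ht hc

/-- Points with the same image end trajectories with the same starting point, and forward uniqueness
identifies these at time t. -/
theorem injOn_sleF {p T t : ℝ} (hp : 0 < p) (ht : t < T) :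
    InjOn (sleF p T (sleTan p T t)) rightHalfPlane := by
  intro c hc c' hc' heq
  obtain ⟨v, hv, hvc⟩ := exists_trajectory_sleCoord (T := T) (t := t) hp hc
  obtain ⟨v', hv', hvc'⟩ := exists_trajectory_sleCoord (T := T) (t := t) hp hc'
  have h := sleF_trajectory hp ht hv.trajectory le_rfl
  have h' := sleF_trajectory hp ht hv'.trajectory le_rfl
  rw [hvc] at h
  rw [hvc'] at h'
  have := hv.unique (norm_sleRadialDriving p T) (Real.exp_pos t).le hv' (by rw [← h, ← h', heq])
  rw [← hvc, ← hvc', this]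

/-- The tip of the curve is not in the domain of the mapping-out function. -/
theorem sleTip_notMem_domain {p T s t : ℝ} (hp : 0 < p) (ht : t < T) (hst : s ≤ t) :
    sleTip p T (sleTan p T s) ∉ wholePlaneLoewnerDomain (sleDriving p T) t := by
  rintro ⟨u, hu⟩
  have hs := hst.trans_lt ht
  set τ := sleTan p T s with hτ
  have hτ0 : 0 < τ := sleTan_pos hp hs
  set c₀ := sleCoord p T s (u s) with hc₀
  have hc₀m : c₀ ∈ rightHalfPlane := sleCoord_mem (hu.norm_lt_one s hst)
  have hf : sleF p T τ c₀ = sleTip p T τ := sleF_trajectory hp ht hu hst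
  set b : ℂ := -(Complex.I * τ) with hb
  have hbm : b ∉ rightHalfPlane := by simp [rightHalfPlane, hb]
  have hdist : 0 < dist c₀ b := dist_pos.2 fun h => hbm (h ▸ hc₀m)
  have hdiff : DifferentiableOn ℂ (sleF p T τ) rightHalfPlane := fun c hc => by
    obtain ⟨d, -, hd⟩ := hasDerivAt_sleF hp T hτ0 hc
    exact hd.differentiableAt.differentiableWithinAt
  obtain ⟨d, hd0, hd⟩ := hasDerivAt_sleF hp T hτ0 hc₀m
  have hstrict : HasStrictDerivAt (sleF p T τ) d c₀ := by
    have := (hdiff.analyticAt (isOpen_rightHalfPlane.mem_nhds hc₀m)).hasStrictDerivAt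
    rwa [hd.deriv] at this
  have hmap := hstrict.map_nhds_eq hd0
  -- By openness every value near the tip is attained near c₀; values near the tip are also attained
  -- near b, outside this ball, which contradicts injectivity.
  have hU : Metric.ball c₀ (dist c₀ b / 2) ∩ rightHalfPlane ∈ 𝓝 c₀ :=
    inter_mem (Metric.ball_mem_nhds _ (by positivity)) (isOpen_rightHalfPlane.mem_nhds hc₀m)
  have himg : sleF p T τ '' (Metric.ball c₀ (dist c₀ b / 2) ∩ rightHalfPlane) ∈
      𝓝 (sleTip p T τ) := by
    rw [← hf, ← hmap]
    exact image_mem_map hU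
  have hlim : Tendsto (sleF p T τ) (𝓝[rightHalfPlane] b) (𝓝 (sleTip p T τ)) := by
    refine (tendsto_sleF_tip hp T hτ0).comp (f := fun c : ℂ => (τ, c)) ?_
    refine tendsto_inf.2 ⟨?_, ?_⟩
    · exact (Continuous.tendsto (by fun_prop : Continuous fun c : ℂ => (τ, c)) b).mono_left
        nhdsWithin_le_nhds
    · refine tendsto_principal.2 ?_
      filter_upwards [self_mem_nhdsWithin] with c hc using ⟨mem_univ _, hc⟩
  have hnebot : (𝓝[rightHalfPlane] b).NeBot := by
    refine mem_closure_iff_nhdsWithin_neBot.1 ?_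
    have h1 : Tendsto (fun x : ℝ => b + (x : ℂ)) (𝓝[>] 0) (𝓝 b) := by
      have : Continuous fun x : ℝ => b + (x : ℂ) := by fun_prop
      have := this.tendsto 0
      simp only [Complex.ofReal_zero, add_zero] at this
      exact this.mono_left nhdsWithin_le_nhds
    refine mem_closure_of_tendsto h1 ?_
    filter_upwards [self_mem_nhdsWithin] with x hx
    simpa [rightHalfPlane, hb] using hx
  have hev := (hlim.eventually himg).and (Filter.Eventually.and (self_mem_nhdsWithin)
    (nhdsWithin_le_nhds (Metric.ball_mem_nhds b (show 0 < dist c₀ b / 2 by positivity))))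
  obtain ⟨c, ⟨c', ⟨hc'b, hc'⟩, hcc'⟩, hc, hcb⟩ := hev.exists
  have := injOn_sleF hp hs hc' hc hcc'
  rw [this, Metric.mem_ball] at hc'b
  have h1 : dist c b < dist c₀ b / 2 := hcb
  have := dist_triangle_left c₀ b c
  linarith

/-- A point outside of the curve is in the domain of the mapping-out function. -/
theorem mem_domain_or_eq_sleTip {p T t : ℝ} (hp : 0 < p) (ht : t < T) (z : ℂ) :
    z ∈ wholePlaneLoewnerDomain (sleDriving p T) t ∨ ∃ s ≤ t, sleTip p T (sleTan p T s) = z := by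
  by_contra! hcon
  obtain ⟨hz, hcon⟩ := hcon
  set M := 16 * (‖z‖ + 1) + 1 with hM
  have hM0 : 0 < M := by positivity
  -- The choice δ = 1/(n+2) ≤ 1/2 forces 1/2 ≤ |rv| ≤ rM, which keeps r away from 0, so limits of
  -- the stopping parameters correspond to finite times.
  have hstep : ∀ n : ℕ, ∃ r ∈ Icc (1 / (2 * M)) (Real.exp t), ∃ v : ℝ → ℂ,
      IsRadialSolution (sleRadialDriving p T) r v ∧ v 0 = z ∧
        ‖sleRadialDriving p T r - r * v r‖ ≤ 1 / (n + 2 : ℝ) := by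
    intro n
    have hδ : (0 : ℝ) < 1 / (n + 2 : ℝ) := by positivity
    have hδ2 : 1 / (n + 2 : ℝ) ≤ 1 / 2 := by
      apply one_div_le_one_div_of_le <;> linarith [(Nat.cast_nonneg n : (0 : ℝ) ≤ n)]
    rcases exists_radial_forward (continuous_sleRadialDriving hp T) (norm_sleRadialDriving p T)
      (Real.exp_pos t).le hδ (by linarith) z with ⟨v, hv, hv0⟩ | ⟨r, hr, v, hv, hv0, hclose, hvM⟩
    · exact absurd ⟨_, hv0 ▸ hv.trajectory⟩ hz
    · refine ⟨r, ⟨?_, hr.2⟩, v, hv, hv0, hclose⟩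
      have h1 := one_sub_norm_le (u := (r : ℂ) * v r) (norm_sleRadialDriving p T r)
      rw [norm_mul, Complex.norm_real, Real.norm_of_nonneg hr.1.le] at h1
      rw [div_le_iff₀ (by positivity)]
      have h2 : r * ‖v r‖ ≤ r * M := mul_le_mul_of_nonneg_left hvM hr.1.le
      linarith
  choose r hr v hv hv0 hclose using hstep
  obtain ⟨ρ, hρ, φ, hφ, hlim⟩ := isCompact_Icc.tendsto_subseq hr
  have hρ0 : 0 < ρ := lt_of_lt_of_le (by positivity) hρ.1
  have hr0 : ∀ n, 0 < r n := fun n => lt_of_lt_of_le (by positivity) (hr n).1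
  set s := Real.log ρ with hs
  have hst : s ≤ t := by rw [hs, Real.log_le_iff_le_exp hρ0]; exact hρ.2
  have hsT := hst.trans_lt ht
  set σ : ℕ → ℝ := fun n => Real.log (r (φ n)) with hσ
  have hσt : ∀ n, σ n ≤ t := fun n => by
    simp only [hσ]; rw [Real.log_le_iff_le_exp (hr0 _)]; exact (hr _).2
  have hσlim : Tendsto σ atTop (𝓝 s) := (Real.continuousAt_log hρ0.ne').tendsto.comp hlim
  set U : ℕ → ℂ := fun n => (r (φ n) : ℂ) * v (φ n) (r (φ n)) with hU
  have hexpσ : ∀ n, Real.exp (σ n) = r (φ n) := fun n => Real.exp_log (hr0 _)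
  have htraj : ∀ n, IsWholePlaneLoewnerTrajectory (sleDriving p T) (σ n) z
      (fun s => (Real.exp s : ℂ) * v (φ n) (Real.exp s)) := fun n => by
    have h := hv (φ n)
    rw [← hexpσ n] at h
    have := h.trajectory
    rwa [hv0] at this
  have hU1 : ∀ n, ‖U n‖ < 1 := fun n =>
    (hv (φ n)).norm_lt_one _ (right_mem_Icc.2 (hr0 _).le)
  have hF : ∀ n, sleF p T (sleTan p T (σ n)) (sleCoord p T (σ n) (U n)) = z := fun n => by
    have := sleF_trajectory hp ((hσt n).trans_lt ht) (htraj n) le_rfl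
    simpa only [hexpσ] using this
  have hUlim : Tendsto U atTop (𝓝 (Complex.exp (Complex.I * (sleDriving p T s : ℂ)))) := by
    have h1 : Tendsto (fun n => sleRadialDriving p T (r (φ n))) atTop
        (𝓝 (sleRadialDriving p T ρ)) :=
      ((continuous_sleRadialDriving hp T).tendsto ρ).comp hlim
    have h2 : Tendsto (fun n => sleRadialDriving p T (r (φ n)) - U n) atTop (𝓝 0) := by
      refine squeeze_zero_norm (a := fun n => 1 / ((φ n : ℝ) + 2)) (fun n => hclose (φ n)) ?_
      have h3 : Tendsto (fun n : ℕ => (φ n : ℝ) + 2) atTop atTop :=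
        tendsto_atTop_add_const_right _ _ (tendsto_natCast_atTop_atTop.comp hφ.tendsto_atTop)
      simp only [one_div]
      exact h3.inv_tendsto_atTop
    have h4 := h1.sub h2
    rw [sub_zero, ← Real.exp_log hρ0, sleRadialDriving_exp] at h4
    refine h4.congr fun n => by ring
  have hclim : Tendsto (fun n => sleCoord p T (σ n) (U n)) atTop
      (𝓝 (-(Complex.I * sleTan p T s))) := by
    rw [← sleCoord_driving hp hsT]
    have he : Tendsto (fun n => Complex.exp (-(Complex.I * (sleAngle p T (σ n) / p : ℝ)))) atTop
        (𝓝 (Complex.exp (-(Complex.I * (sleAngle p T s / p : ℝ))))) := by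
      have h : Continuous fun x : ℝ => Complex.exp (-(Complex.I * (x / p : ℝ))) := by fun_prop
      exact (h.tendsto _).comp ((hasDerivAt_sleAngle hp hsT).continuousAt.tendsto.comp hσlim)
    have hx := he.mul hUlim
    refine (hx.const_sub 1).div (hx.const_add 1) ?_
    rw [one_add_exp_mul_driving hp hsT]
    exact div_ne_zero two_ne_zero (one_sub_I_mul_ne_zero _)
  -- The inverse maps take the constant value z along the sequence, so the joint boundary limit
  -- identifies z with a tip.
  have htip := (tendsto_sleF_tip hp T (sleTan_pos hp hsT)).comp
    (f := fun n => (sleTan p T (σ n), sleCoord p T (σ n) (U n))) (x := atTop)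
    (tendsto_inf.2 ⟨((hasDerivAt_sleTan hp hsT).continuousAt.tendsto.comp hσlim).prodMk_nhds hclim,
      tendsto_principal.2 (Eventually.of_forall fun n => ⟨mem_univ _, sleCoord_mem (hU1 n)⟩)⟩)
  simp only [Function.comp_def, hF] at htip
  exact hcon s hst (tendsto_nhds_unique htip tendsto_const_nhds)

theorem wholePlaneLoewnerDomain_eq_compl {p T t : ℝ} (hp : 0 < p) (ht : t < T) :
    wholePlaneLoewnerDomain (sleDriving p T) t =
      ((fun s => sleTip p T (sleTan p T s)) '' Iic t)ᶜ := by
  refine Subset.antisymm ?_ ?_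
  · rintro z hz ⟨s, hs, rfl⟩
    exact sleTip_notMem_domain hp ht hs hz
  · intro z hz
    rcases mem_domain_or_eq_sleTip hp ht z with h | ⟨s, hs, h⟩
    · exact h
    · exact absurd ⟨s, hs, h⟩ hz

/-! ### The explicit curve and its injectivity -/

/-- The argument of `x + i y` for `y > 0`. -/
def upperArg (y x : ℝ) : ℝ := Real.pi / 2 - Real.arctan (x / y)

theorem upperArg_pos (y x : ℝ) : 0 < upperArg y x := by
  have := Real.arctan_lt_pi_div_two (x / y)
  unfold upperArg; linarith

theorem upperArg_lt_pi (y x : ℝ) : upperArg y x < Real.pi := by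
  have := Real.neg_pi_div_two_lt_arctan (x / y)
  unfold upperArg; linarith

theorem add_mul_I_eq_polar {y : ℝ} (hy : 0 < y) (x : ℝ) :
    (x : ℂ) + y * Complex.I = ((y * √(1 + (x / y) ^ 2) : ℝ) : ℂ) *
      (Real.cos (upperArg y x) + Real.sin (upperArg y x) * Complex.I) := by
  have hs : (0 : ℝ) < √(1 + (x / y) ^ 2) := Real.sqrt_pos.2 (by positivity)
  rw [upperArg, Real.cos_pi_div_two_sub, Real.sin_pi_div_two_sub, Real.sin_arctan, Real.cos_arctan,
    mul_add, ← mul_assoc, ← Complex.ofReal_mul, ← Complex.ofReal_mul]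
  congr 3
  · field_simp
  · field_simp

theorem arg_add_mul_I {y : ℝ} (hy : 0 < y) (x : ℝ) :
    Complex.arg ((x : ℂ) + y * Complex.I) = upperArg y x := by
  rw [add_mul_I_eq_polar hy]
  push_cast
  have := Complex.arg_mul_cos_add_sin_mul_I (r := y * √(1 + (x / y) ^ 2)) (θ := upperArg y x)
    (mul_pos hy (Real.sqrt_pos.2 (by positivity)))
    ⟨by linarith [upperArg_pos y x, Real.pi_pos], (upperArg_lt_pi y x).le⟩
  push_cast at this
  exact this

theorem norm_add_mul_I {y : ℝ} (hy : 0 < y) (x : ℝ) :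
    ‖(x : ℂ) + y * Complex.I‖ = y * √(1 + (x / y) ^ 2) := by
  have h : ‖(x : ℂ) + y * Complex.I‖ ^ 2 = (y * √(1 + (x / y) ^ 2)) ^ 2 := by
    rw [← Complex.normSq_eq_norm_sq, mul_pow, Real.sq_sqrt (by positivity), Complex.normSq_apply]
    simp
    field_simp
    ring
  exact (pow_left_inj₀ (norm_nonneg _) (by positivity) two_ne_zero).1 h

/-- The image of the horizontal line at height `y` under `z ↦ z ^ a`. -/
def powCurve (y a x : ℝ) : ℂ := ((x : ℂ) + y * Complex.I) ^ (a : ℂ)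

theorem powCurve_eq {y : ℝ} (hy : 0 < y) (a x : ℝ) : powCurve y a x =
    ((‖(x : ℂ) + y * Complex.I‖ ^ a : ℝ) : ℂ) * Complex.exp (Complex.I * (a * upperArg y x : ℝ)) := by
  have hne := add_mul_I_ne_zero x hy
  rw [powCurve, Complex.cpow_def_of_ne_zero hne, Complex.log, arg_add_mul_I hy,
    Real.rpow_def_of_pos (norm_pos_iff.2 hne), Complex.ofReal_exp, ← Complex.exp_add]
  congr 1
  push_cast
  ring

theorem norm_powCurve {y : ℝ} (hy : 0 < y) (a x : ℝ) :
    ‖powCurve y a x‖ = ‖(x : ℂ) + y * Complex.I‖ ^ a := by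
  rw [powCurve_eq hy, norm_mul, norm_exp_I_mul', mul_one, Complex.norm_real,
    Real.norm_of_nonneg (by positivity)]

theorem powCurve_ne_zero {y : ℝ} (hy : 0 < y) (a x : ℝ) : powCurve y a x ≠ 0 := by
  rw [powCurve, Complex.cpow_def_of_ne_zero (add_mul_I_ne_zero x hy)]
  exact Complex.exp_ne_zero _

theorem eq_or_eq_neg_of_norm_powCurve_eq {y a : ℝ} (hy : 0 < y) (ha : 0 < a) {x x' : ℝ}
    (h : ‖powCurve y a x‖ = ‖powCurve y a x'‖) : x = x' ∨ x = -x' := by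
  rw [norm_powCurve hy, norm_powCurve hy] at h
  have h1 := (Real.rpow_left_inj (norm_nonneg _) (norm_nonneg _) ha.ne').1 h
  have h2 : ‖(x : ℂ) + y * Complex.I‖ ^ 2 = ‖(x' : ℂ) + y * Complex.I‖ ^ 2 := by rw [h1]
  rw [← Complex.normSq_eq_norm_sq, ← Complex.normSq_eq_norm_sq, Complex.normSq_apply,
    Complex.normSq_apply] at h2
  simp at h2
  exact mul_self_eq_mul_self_iff.1 h2

/-- Equal moduli leave x = -x' as the only alternative. The arguments then differ by 2·arctan(x/y)/p
up to sign, which must be a multiple of 2π but is smaller than 2π in absolute value by the two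
hypotheses; hence x = 0. -/
theorem eq_of_powCurve_eq {y p : ℝ} (hy : 0 < y) (hp : 0 < p) {x x' : ℝ}
    (hx : Real.arctan (-x / y) < Real.pi * p) (hx' : Real.arctan (-x' / y) < Real.pi * p)
    (h : powCurve y (1 / p) x = powCurve y (1 / p) x') : x = x' := by
  rcases eq_or_eq_neg_of_norm_powCurve_eq hy (by positivity : 0 < 1 / p) (congrArg norm h)
    with h1 | h1
  · exact h1
  have hn : ‖(x : ℂ) + y * Complex.I‖ ^ (1 / p) = ‖(x' : ℂ) + y * Complex.I‖ ^ (1 / p) := by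
    rw [← norm_powCurve hy, ← norm_powCurve hy, h]
  have hne : ((‖(x' : ℂ) + y * Complex.I‖ ^ (1 / p) : ℝ) : ℂ) ≠ 0 := by
    have := norm_pos_iff.2 (add_mul_I_ne_zero x' hy)
    exact_mod_cast (Real.rpow_pos_of_pos this _).ne'
  rw [powCurve_eq hy, powCurve_eq hy, hn] at h
  have h2 := mul_left_cancel₀ hne h
  rw [Complex.exp_eq_exp_iff_exists_int] at h2
  obtain ⟨n, hn⟩ := h2
  have h3 : 1 / p * upperArg y x = 1 / p * upperArg y x' + n * (2 * Real.pi) := by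
    have := congrArg Complex.im hn
    simpa using this
  have e1 : Real.arctan (x' / y) = -Real.arctan (x / y) := by
    rw [← Real.arctan_neg, h1]; congr 1; ring
  have e2 : Real.arctan (-x / y) = -Real.arctan (x / y) := by
    rw [← Real.arctan_neg]; congr 1; ring
  have e3 : Real.arctan (-x' / y) = Real.arctan (x / y) := by
    rw [h1]
  rw [e2] at hx
  rw [e3] at hx'
  unfold upperArg at h3
  rw [e1] at h3
  field_simp at h3
  have hpi := Real.pi_pos
  have hn0 : n = 0 := by
    have hlt : |(n : ℝ)| < 1 := by
      rw [abs_lt]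
      have hpp : 0 < Real.pi * p := by positivity
      constructor
      · by_contra hcon
        rw [not_lt] at hcon
        nlinarith
      · by_contra hcon
        rw [not_lt] at hcon
        nlinarith
    have : |n| < 1 := by exact_mod_cast hlt
    exact Int.abs_lt_one_iff.1 this
  rw [hn0] at h3
  have h4 : Real.arctan (x / y) = 0 := by
    push_cast at h3
    linarith
  rw [Real.arctan_eq_zero_iff] at h4
  have hx0 : x = 0 := by
    rcases div_eq_zero_iff.1 h4 with h | h
    · exact h
    · exact absurd h hy.ne'
  rw [hx0] at h1
  rw [hx0]; linarith

/-- The abscissa at time `t` of the image of the tip under `z ↦ z ^ p`. -/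
def sleAbscissa (p T t : ℝ) : ℝ := sleX p T (sleTan p T t)

/-- The Loewner curve. -/
def sleCurve (p T t : ℝ) : ℂ := powCurve (sleY p T) (1 / p) (sleAbscissa p T t)

theorem hasDerivAt_sleAbscissa {p T t : ℝ} (hp : 0 < p) (ht : t < T) :
    ∃ d < 0, HasDerivAt (sleAbscissa p T) d t := by
  have hτ := sleTan_pos hp ht
  refine ⟨_, ?_, (hasDerivAt_sleX p T hτ).comp t (hasDerivAt_sleTan hp ht)⟩
  rw [neg_mul, neg_lt_zero]
  positivity

theorem continuousOn_sleAbscissa {p : ℝ} (hp : 0 < p) (T : ℝ) :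
    ContinuousOn (sleAbscissa p T) (Iio T) := fun t ht => by
  obtain ⟨d, -, hd⟩ := hasDerivAt_sleAbscissa hp ht
  exact hd.continuousAt.continuousWithinAt

theorem strictAntiOn_sleAbscissa {p : ℝ} (hp : 0 < p) (T : ℝ) :
    StrictAntiOn (sleAbscissa p T) (Iio T) := by
  refine strictAntiOn_of_deriv_neg (convex_Iio T) (continuousOn_sleAbscissa hp T) fun t ht => ?_
  rw [interior_Iio] at ht
  obtain ⟨d, hd0, hd⟩ := hasDerivAt_sleAbscissa hp ht
  rwa [hd.deriv]

theorem tendsto_sleAbscissa_atBot {p : ℝ} (hp : 0 < p) (T : ℝ) :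
    Tendsto (sleAbscissa p T) atBot atTop := by
  have hτ : Tendsto (sleTan p T) atBot (𝓝[>] 0) := by
    refine tendsto_nhdsWithin_iff.2 ⟨?_, ?_⟩
    · have h : ContinuousAt Real.tan 0 := Real.continuousAt_tan.2 (by simp)
      have := h.tendsto.comp (tendsto_sleAngle_atBot hp T)
      rwa [Real.tan_zero] at this
    · filter_upwards [eventually_lt_atBot T] with t ht using sleTan_pos hp ht
  have hX : Tendsto (sleX p T) (𝓝[>] 0) atTop := by
    refine Tendsto.const_mul_atTop (by positivity) ?_
    have hI : Tendsto (fun τ => 2 * p * sleI p τ) (𝓝[>] 0) (𝓝 (2 * p * sleI p 0)) :=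
      ((hasDerivAt_sleI p 0).continuousAt.tendsto.const_mul _).mono_left nhdsWithin_le_nhds
    have hinv : Tendsto (fun τ : ℝ => (1 + τ ^ 2) ^ p / τ) (𝓝[>] 0) atTop := by
      refine tendsto_atTop_mono' _ ?_ tendsto_inv_nhdsGT_zero
      filter_upwards [self_mem_nhdsWithin] with τ hτ
      have hτ0 : 0 < τ := hτ
      rw [inv_eq_one_div]
      gcongr
      exact Real.one_le_rpow (by nlinarith [sq_nonneg τ]) hp.le
    simpa only [sub_eq_add_neg] using hinv.atTop_add hI.neg
  exact hX.comp hτ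

theorem exists_sleAbscissa_eq {p T t : ℝ} (hp : 0 < p) (ht : t < T) {x : ℝ}
    (hx : sleAbscissa p T t ≤ x) : ∃ s ≤ t, sleAbscissa p T s = x := by
  obtain ⟨s₀, hs₀, hs₀'⟩ := ((tendsto_sleAbscissa_atBot hp T).eventually_ge_atTop x).and
    (eventually_le_atBot t) |>.exists
  obtain ⟨s, hs, hsx⟩ := intermediate_value_Icc' hs₀'
    ((continuousOn_sleAbscissa hp T).mono fun s hs => hs.2.trans_lt ht) ⟨hx, hs₀⟩
  exact ⟨s, hs.2, hsx⟩

theorem domain_eq_compl_sleCurve {p T t : ℝ} (hp : 0 < p) (ht : t < T) :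
    wholePlaneLoewnerDomain (sleDriving p T) t = (sleCurve p T '' Iic t)ᶜ :=
  wholePlaneLoewnerDomain_eq_compl hp ht

theorem isPreconnected_domain {p T t : ℝ} (hp : 0 < p) (ht : t < T) :
    IsPreconnected (wholePlaneLoewnerDomain (sleDriving p T) t) := by
  rw [wholePlaneLoewnerDomain_eq_image hp ht]
  refine convex_rightHalfPlane.isPreconnected.image _ fun c hc => ?_
  obtain ⟨d, -, hd⟩ := hasDerivAt_sleF hp T (sleTan_pos hp ht) hc
  exact hd.continuousAt.continuousWithinAt

/-- Auxiliary function separating the inside of the closed curve traced by `powCurve` over one full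
turn from its outside. -/
def loopFun (p : ℝ) (w : ℂ) : ℝ := ‖w‖ ^ p * Real.cos (p * Real.arccos (w.re / ‖w‖))

/-- The arccosine is |arg w|, continuous across the negative axis where arg jumps; at 0 the factor
‖w‖^p wins. -/
theorem continuous_loopFun {p : ℝ} (hp : 0 < p) : Continuous (loopFun p) := by
  rw [continuous_iff_continuousAt]
  intro w
  by_cases hw : w = 0
  · subst hw
    have h0 : loopFun p 0 = 0 := by simp [loopFun, Real.zero_rpow hp.ne']
    rw [ContinuousAt, h0]
    have h1 : Tendsto (fun w : ℂ => ‖w‖ ^ p) (𝓝 0) (𝓝 0) := by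
      have : Continuous fun w : ℂ => ‖w‖ ^ p := (Real.continuous_rpow_const hp.le).comp continuous_norm
      have := this.tendsto 0
      rwa [norm_zero, Real.zero_rpow hp.ne'] at this
    refine squeeze_zero_norm (fun w => ?_) h1
    rw [loopFun, norm_mul, Real.norm_of_nonneg (by positivity)]
    exact mul_le_of_le_one_right (by positivity) (Real.abs_cos_le_one _)
  · have h1 : ContinuousAt (fun w : ℂ => w.re / ‖w‖) w :=
      Complex.continuous_re.continuousAt.div continuous_norm.continuousAt (norm_ne_zero_iff.2 hw)
    have h2 : ContinuousAt (fun w : ℂ => ‖w‖ ^ p) w :=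
      ((Real.continuous_rpow_const hp.le).comp continuous_norm).continuousAt
    exact h2.mul (Real.continuous_cos.continuousAt.comp
      (continuousAt_const.mul (Real.continuous_arccos.continuousAt.comp h1)))

theorem loopFun_eq {p : ℝ} {w : ℂ} (hw : w ≠ 0) :
    loopFun p w = ‖w‖ ^ p * Real.cos (p * w.arg) := by
  rw [loopFun, ← Complex.cos_arg hw]
  congr 1
  rcases le_total 0 w.arg with h | h
  · rw [Real.arccos_cos h (Complex.arg_le_pi w)]
  · rw [← Real.cos_neg w.arg, Real.arccos_cos (by linarith) (by linarith [Complex.neg_pi_lt_arg w]),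
      mul_neg, Real.cos_neg]

/-- The level set is one turn of the power curve rotated by -π/(2p), with parameter x = -y tan(p arg
w). The tangent is finite because p < 1/2. -/
theorem exists_powCurve_of_loopFun_eq {p y : ℝ} (hp : 0 < p) (hp2 : p < 1 / 2) (hy : 0 < y) {w : ℂ}
    (hw : loopFun p w = y) : ∃ x, Real.arctan (-x / y) ≤ Real.pi * p ∧
      powCurve y (1 / p) x = w * Complex.exp (Complex.I * (1 / p * (Real.pi / 2) : ℝ)) := by
  have hw0 : w ≠ 0 := by
    rintro rfl
    simp [loopFun, Real.zero_rpow hp.ne'] at hw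
    exact hy.ne hw
  rw [loopFun_eq hw0] at hw
  have hpi := Real.pi_pos
  have harg1 := Complex.neg_pi_lt_arg w
  have harg2 := Complex.arg_le_pi w
  have hθ : p * w.arg ∈ Ioo (-(Real.pi / 2)) (Real.pi / 2) := by
    constructor <;> nlinarith
  have hcos := Real.cos_pos_of_mem_Ioo hθ
  have hwn := norm_pos_iff.2 hw0
  refine ⟨-(y * Real.tan (p * w.arg)), ?_, ?_⟩
  · rw [neg_neg, mul_div_cancel_left₀ _ hy.ne', Real.arctan_tan hθ.1 hθ.2]
    nlinarith
  · have harg : upperArg y (-(y * Real.tan (p * w.arg))) = Real.pi / 2 + p * w.arg := by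
      rw [upperArg, neg_div, mul_div_cancel_left₀ _ hy.ne', Real.arctan_neg,
        Real.arctan_tan hθ.1 hθ.2]
      ring
    have hnorm : ‖((-(y * Real.tan (p * w.arg)) : ℝ) : ℂ) + y * Complex.I‖ = ‖w‖ ^ p := by
      rw [norm_add_mul_I hy, neg_div, mul_div_cancel_left₀ _ hy.ne', neg_sq]
      have h1 : 1 + Real.tan (p * w.arg) ^ 2 = (Real.cos (p * w.arg))⁻¹ ^ 2 := by
        rw [inv_pow, ← Real.inv_one_add_tan_sq hcos.ne', inv_inv]
      rw [h1, Real.sqrt_sq (inv_pos.2 hcos).le, ← hw]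
      field_simp
    rw [powCurve_eq hy, harg, hnorm, ← Real.rpow_mul hwn.le, mul_one_div_cancel hp.ne',
      Real.rpow_one]
    have h2 : Complex.I * ((1 / p * (Real.pi / 2 + p * w.arg) : ℝ) : ℂ) =
        w.arg * Complex.I + Complex.I * ((1 / p * (Real.pi / 2) : ℝ) : ℂ) := by
      have : 1 / p * (Real.pi / 2 + p * w.arg) = w.arg + 1 / p * (Real.pi / 2) := by
        field_simp
        ring
      rw [this]; push_cast; ring
    rw [h2, Complex.exp_add, ← mul_assoc, Complex.norm_mul_exp_arg_mul_I]

/-- The curve ends before it would close up. -/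
theorem arctan_sleAbscissa_lt {p T t : ℝ} (hp : 0 < p) (ht : t < T) :
    Real.arctan (-sleAbscissa p T t / sleY p T) < Real.pi * p := by
  have hy := sleY_pos hp T
  have hpi := Real.pi_pos
  -- For p ≥ 1/2 the bound is automatic, since the arctangent is below π/2.
  by_cases hp2 : 1 / 2 ≤ p
  · have := Real.arctan_lt_pi_div_two (-sleAbscissa p T t / sleY p T)
    nlinarith
  rw [not_le] at hp2
  by_contra hcon
  rw [not_lt] at hcon
  -- A slightly later time makes the inequality strict, so the curve up to t₁ covers the whole level
  -- set.
  obtain ⟨t₁, ht₁, ht₁T⟩ := exists_between ht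
  have hx := strictAntiOn_sleAbscissa hp T ht ht₁T ht₁
  have hlt : Real.pi * p < Real.arctan (-sleAbscissa p T t₁ / sleY p T) := by
    refine hcon.trans_lt (Real.arctan_strictMono ?_)
    gcongr
  set e := Complex.exp (Complex.I * (1 / p * (Real.pi / 2) : ℝ)) with he
  have hne : ‖e‖ = 1 := norm_exp_I_mul' _
  have he0 : e ≠ 0 := Complex.exp_ne_zero _
  set D := wholePlaneLoewnerDomain (sleDriving p T) t₁ with hD
  have hDc : D = (sleCurve p T '' Iic t₁)ᶜ := domain_eq_compl_sleCurve hp ht₁T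
  have hnot : ∀ z ∈ D, loopFun p (z * e⁻¹) ≠ sleY p T := by
    intro z hz heq
    obtain ⟨x, hx1, hx2⟩ := exists_powCurve_of_loopFun_eq hp hp2 hy heq
    rw [← he, mul_assoc, inv_mul_cancel₀ he0, mul_one] at hx2
    have h1 := Real.arctan_strictMono.lt_iff_lt.1 (hx1.trans_lt hlt)
    rw [div_lt_div_iff_of_pos_right hy, neg_lt_neg_iff] at h1
    obtain ⟨s, hs, hsx⟩ := exists_sleAbscissa_eq hp ht₁T h1.le
    rw [hDc] at hz
    exact hz ⟨s, hs, by rw [sleCurve, hsx, hx2]⟩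
  have h0D : (0 : ℂ) ∈ D := by
    rw [hDc]
    rintro ⟨s, -, hs⟩
    exact powCurve_ne_zero hy _ _ hs
  have hcont : Continuous fun z : ℂ => loopFun p (z * e⁻¹) :=
    (continuous_loopFun hp).comp (continuous_id.mul continuous_const)
  -- The domain is connected, contains 0 and misses the level set, so it lies inside the loop.
  have hlt' : ∀ z ∈ D, loopFun p (z * e⁻¹) < sleY p T := by
    intro z hz
    by_contra hge
    rw [not_lt] at hge
    have h0 : loopFun p (0 * e⁻¹) ≤ sleY p T := by
      rw [zero_mul]
      simp [loopFun, Real.zero_rpow hp.ne', hy.le]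
    obtain ⟨z', hz', hz'e⟩ := (isPreconnected_domain hp ht₁T).intermediate_value h0D hz
      hcont.continuousOn ⟨h0, hge⟩
    exact hnot z' hz' hz'e
  have hcosp : 0 < Real.cos (p * Real.pi) :=
    Real.cos_pos_of_mem_Ioo ⟨by nlinarith, by nlinarith⟩
  -- The largest modulus on the loop, reached at argument π: on this circle the separating function
  -- is at least `sleY p T`, so the circle lies in the hull.
  set r := (sleY p T / Real.cos (p * Real.pi)) ^ (1 / p) with hr
  have hr0 : 0 < r := by positivity
  have hon : ∀ z : ℂ, ‖z‖ = r → ∃ x, powCurve (sleY p T) (1 / p) x = z := by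
    intro z hz
    have hz' : z ∉ D := by
      intro hzD
      have h1 := hlt' z hzD
      have hnz : ‖z * e⁻¹‖ = r := by rw [norm_mul, norm_inv, hne, hz]; simp
      have hz0 : z * e⁻¹ ≠ 0 := norm_pos_iff.1 (by rw [hnz]; exact hr0)
      rw [loopFun_eq hz0, hnz, hr, ← Real.rpow_mul (by positivity), one_div_mul_cancel hp.ne',
        Real.rpow_one, div_mul_eq_mul_div, div_lt_iff₀ hcosp] at h1
      have h2 := lt_of_mul_lt_mul_left h1 hy.le
      refine absurd h2 (not_lt.2 ?_)
      rw [← Real.cos_abs (p * (z * e⁻¹).arg), abs_mul, abs_of_pos hp]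
      refine Real.cos_le_cos_of_nonneg_of_le_pi (by positivity) (by nlinarith) ?_
      have := Complex.abs_arg_le_pi (z * e⁻¹)
      gcongr
    rw [hDc, mem_compl_iff, not_not] at hz'
    obtain ⟨s, -, hs⟩ := hz'
    exact ⟨_, hs⟩
  -- Three distinct points of the circle need three parameters, but a given modulus allows only ±x.
  obtain ⟨x₁, h₁⟩ := hon r (by rw [Complex.norm_real, Real.norm_of_nonneg hr0.le])
  obtain ⟨x₂, h₂⟩ := hon (-r) (by rw [norm_neg, Complex.norm_real, Real.norm_of_nonneg hr0.le])
  obtain ⟨x₃, h₃⟩ := hon (r * Complex.I)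
    (by rw [norm_mul, Complex.norm_real, Real.norm_of_nonneg hr0.le, Complex.norm_I, mul_one])
  have hp1 : 0 < 1 / p := by positivity
  have n12 : x₁ ≠ x₂ := by
    rintro rfl
    have := congrArg Complex.re (h₁.symm.trans h₂)
    simp at this; linarith
  have n13 : x₁ ≠ x₃ := by
    rintro rfl
    have := congrArg Complex.re (h₁.symm.trans h₃)
    simp at this; linarith
  have n23 : x₂ ≠ x₃ := by
    rintro rfl
    have := congrArg Complex.re (h₂.symm.trans h₃)
    simp at this; linarith
  have e12 := eq_or_eq_neg_of_norm_powCurve_eq hy hp1 (x := x₁) (x' := x₂) (by rw [h₁, h₂]; simp)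
  have e13 := eq_or_eq_neg_of_norm_powCurve_eq hy hp1 (x := x₁) (x' := x₃) (by rw [h₁, h₃]; simp)
  rcases e12 with h | h
  · exact n12 h
  rcases e13 with h' | h'
  · exact n13 h'
  exact n23 (by linarith)

theorem injOn_sleCurve {p : ℝ} (hp : 0 < p) (T : ℝ) : InjOn (sleCurve p T) (Iio T) := by
  intro s hs t ht h
  exact (strictAntiOn_sleAbscissa hp T).injOn hs ht (eq_of_powCurve_eq (sleY_pos hp T) hp
    (arctan_sleAbscissa_lt hp hs) (arctan_sleAbscissa_lt hp ht) h)

theorem hasDerivAt_powCurve {y : ℝ} (hy : 0 < y) (a x : ℝ) : HasDerivAt (powCurve y a)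
    (a * ((x : ℂ) + y * Complex.I) ^ ((a : ℂ) - 1)) x := by
  have hs : (x : ℂ) + y * Complex.I ∈ Complex.slitPlane :=
    Complex.mem_slitPlane_iff.2 (Or.inr (by simpa using hy.ne'))
  have h1 : HasDerivAt (fun x : ℝ => (x : ℂ) + y * Complex.I) 1 x :=
    (Complex.ofRealCLM.hasDerivAt (x := x)).add_const _
  have h2 := HasDerivAt.comp x (h₂ := fun z : ℂ => z ^ (a : ℂ))
    (h := fun x : ℝ => (x : ℂ) + y * Complex.I)
    ((hasDerivAt_id ((x : ℂ) + y * Complex.I)).cpow_const (c := (a : ℂ)) hs) h1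
  refine h2.congr_deriv ?_
  simp

theorem isWholePlaneLoewnerCurve_sleCurve {p : ℝ} (hp : 0 < p) (T : ℝ) :
    IsWholePlaneLoewnerCurve (sleDriving p T) T (sleCurve p T) := by
  have hy := sleY_pos hp T
  refine ⟨?_, injOn_sleCurve hp T, ?_, fun t ht => domain_eq_compl_sleCurve hp ht⟩
  · intro t ht
    exact (hasDerivAt_powCurve hy _ _).continuousAt.comp_continuousWithinAt
      (continuousOn_sleAbscissa hp T t ht)
  · have h1 := (tendsto_rpow_atTop (show 0 < 1 / p by positivity)).comp
      (tendsto_sleAbscissa_atBot hp T)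
    refine tendsto_atTop_mono' _ ?_ h1
    filter_upwards [(tendsto_sleAbscissa_atBot hp T).eventually_ge_atTop 0] with t ht
    rw [sleCurve, norm_powCurve hy]
    refine Real.rpow_le_rpow ht ?_ (by positivity)
    have := Complex.re_le_norm ((sleAbscissa p T t : ℂ) + sleY p T * Complex.I)
    simpa using this

/-- The domains determine every initial segment. If γ(t) were γ'(s) with s < t, the segment of γ up
to s would already contain γ(t), against injectivity. -/
theorem eq_of_isWholePlaneLoewnerCurve {w : ℝ → ℝ} {T : ℝ} {γ γ' : ℝ → ℂ}
    (h : IsWholePlaneLoewnerCurve w T γ) (h' : IsWholePlaneLoewnerCurve w T γ') {t : ℝ}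
    (ht : t < T) : γ t = γ' t := by
  have himg : ∀ t < T, γ '' Iic t = γ' '' Iic t := fun t ht =>
    compl_injective ((h.domain_eq t ht).symm.trans (h'.domain_eq t ht))
  obtain ⟨s, hs, hse⟩ : γ t ∈ γ' '' Iic t := himg t ht ▸ mem_image_of_mem γ self_mem_Iic
  rcases eq_or_lt_of_le (show s ≤ t from hs) with rfl | hlt
  · exact hse.symm
  · obtain ⟨r, hr, hre⟩ : γ' s ∈ γ '' Iic s :=
      (himg s (hlt.trans ht)).symm ▸ mem_image_of_mem γ' self_mem_Iic
    have hrt : r < t := lt_of_le_of_lt hr hlt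
    have := h.injOn (hrt.trans ht) ht (hre.trans hse)
    exact absurd this hrt.ne

/-! ### The length of a `C¹` curve -/

theorem eVariationOn_le_of_edist_le {f : ℝ → ℂ} {g : ℝ → ℝ} {s : Set ℝ}
    (h : ∀ x ∈ s, ∀ y ∈ s, edist (f x) (f y) ≤ edist (g x) (g y)) :
    eVariationOn f s ≤ eVariationOn g s :=
  iSup_le fun u => (Finset.sum_le_sum fun _ _ => h _ (u.2.2.2 _) _ (u.2.2.2 _)).trans
    (eVariationOn.sum_le u.2.2.1 u.2.2.2)

/-- Increments of the variation V lie between |Δf| and those of the integral L of the speed. Both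
bounds have right derivative |f'|, so V - L has right derivative zero. -/
theorem eVariationOn_Icc_eq_integral {f f' : ℝ → ℂ} (hf : ∀ x, HasDerivAt f (f' x) x)
    (hf' : Continuous f') {a b : ℝ} (hab : a ≤ b) :
    eVariationOn f (Icc a b) = ENNReal.ofReal (∫ x in a..b, ‖f' x‖) := by
  have hint : ∀ x y, IntervalIntegrable (fun x => ‖f' x‖) MeasureTheory.volume x y :=
    fun x y => hf'.norm.intervalIntegrable x y
  set L : ℝ → ℝ := fun x => ∫ u in a..x, ‖f' u‖ with hL
  have hLd : ∀ x, HasDerivAt L ‖f' x‖ x := fun x =>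
    intervalIntegral.integral_hasDerivAt_right (hint _ _)
      hf'.norm.aestronglyMeasurable.stronglyMeasurableAtFilter hf'.norm.continuousAt
  have hLsub : ∀ x y, L y - L x = ∫ u in x..y, ‖f' u‖ := fun x y =>
    intervalIntegral.integral_interval_sub_left (hint _ _) (hint _ _)
  have hmono : Monotone L := monotone_of_deriv_nonneg (fun x => (hLd x).differentiableAt)
    fun x => by rw [(hLd x).deriv]; exact norm_nonneg _
  have hle : ∀ x y, x ≤ y → ‖f y - f x‖ ≤ L y - L x := fun x y hxy => by
    rw [hLsub, ← intervalIntegral.integral_eq_sub_of_hasDerivAt (fun u _ => hf u)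
      (hf'.intervalIntegrable _ _)]
    exact intervalIntegral.norm_integral_le_integral_norm hxy
  have hvar : ∀ x y, x ≤ y → eVariationOn f (Icc x y) ≤ ENNReal.ofReal (L y - L x) := by
    intro x y hxy
    have h1 : eVariationOn f (Icc x y) ≤ eVariationOn L (Icc x y) := by
      refine eVariationOn_le_of_edist_le fun u _ v _ => ?_
      rw [edist_dist, edist_dist]
      refine ENNReal.ofReal_le_ofReal ?_
      rcases le_total u v with h | h
      · rw [dist_comm, dist_comm (L u), dist_eq_norm, Real.dist_eq]
        exact (hle u v h).trans (le_abs_self _)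
      · rw [dist_eq_norm, Real.dist_eq]
        exact (hle v u h).trans (le_abs_self _)
    have h2 := (hmono.monotoneOn (Icc x y)).eVariationOn_eq (left_mem_Icc.2 hxy)
        (right_mem_Icc.2 hxy)
    rw [inter_self] at h2
    exact h1.trans h2.le
  have hfin : ∀ x y, x ≤ y → eVariationOn f (Icc x y) ≠ ⊤ := fun x y hxy =>
    ((hvar x y hxy).trans_lt ENNReal.ofReal_lt_top).ne
  set V : ℝ → ℝ := fun x => (eVariationOn f (Icc a x)).toReal with hV
  have hVsub : ∀ x y, a ≤ x → x ≤ y → V y - V x = (eVariationOn f (Icc x y)).toReal := by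
    intro x y hax hxy
    have := eVariationOn.Icc_add_Icc f hax hxy (mem_univ x)
    simp only [univ_inter] at this
    simp only [hV]
    rw [← this, ENNReal.toReal_add (hfin _ _ hax) (hfin _ _ hxy)]
    ring
  have hbd : ∀ x y, a ≤ x → x ≤ y → ‖f y - f x‖ ≤ V y - V x ∧ V y - V x ≤ L y - L x := by
    intro x y hax hxy
    rw [hVsub x y hax hxy]
    constructor
    · have h1 := eVariationOn.edist_le f (right_mem_Icc.2 hxy) (left_mem_Icc.2 hxy)
      rw [edist_dist, dist_eq_norm] at h1
      exact (ENNReal.ofReal_le_iff_le_toReal (hfin _ _ hxy)).1 h1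
    · exact ENNReal.toReal_le_of_le_ofReal (sub_nonneg.2 (hmono hxy)) (hvar x y hxy)
  have hconst : V b - L b = V a - L a := by
    refine constant_of_has_deriv_right_zero (f := fun x => V x - L x) (a := a) (b := b) ?_ ?_ b
      (right_mem_Icc.2 hab)
    · refine ContinuousOn.sub ?_ fun x _ => (hLd x).continuousAt.continuousWithinAt
      have hLc : Continuous L := continuous_iff_continuousAt.2 fun x => (hLd x).continuousAt
      refine Metric.continuousOn_iff.2 fun x hx ε hε => ?_
      obtain ⟨δ, hδ, h⟩ := Metric.continuous_iff.1 hLc x ε hε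
      refine ⟨δ, hδ, fun y hy hyx => lt_of_le_of_lt ?_ (h y hyx)⟩
      rcases le_total x y with hxy | hxy
      · have := hbd x y hx.1 hxy
        rw [Real.dist_eq, Real.dist_eq, abs_of_nonneg ((norm_nonneg _).trans this.1)]
        exact this.2.trans (le_abs_self _)
      · have := hbd y x hy.1 hxy
        rw [dist_comm, dist_comm (L y), Real.dist_eq, Real.dist_eq,
          abs_of_nonneg ((norm_nonneg _).trans this.1)]
        exact this.2.trans (le_abs_self _)
    · intro x hx
      rw [hasDerivWithinAt_iff_isLittleO]
      have h1 := (hasDerivAt_iff_isLittleO.1 (hLd x)).mono (nhdsWithin_le_nhds (s := Ici x))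
      have h2 := (hasDerivAt_iff_isLittleO.1 (hf x)).mono (nhdsWithin_le_nhds (s := Ici x))
      refine Asymptotics.IsBigO.trans_isLittleO ?_ (h1.norm_left.add h2.norm_left)
      refine Asymptotics.IsBigO.of_bound 1 ?_
      filter_upwards [self_mem_nhdsWithin] with y hy
      have hxy : x ≤ y := hy
      have h3 := hbd x y hx.1 hxy
      have h4 : ‖(y - x) • f' x‖ - ‖f y - f x - (y - x) • f' x‖ ≤ ‖f y - f x‖ := by
        have := norm_sub_norm_le ((y - x) • f' x) (-(f y - f x - (y - x) • f' x))
        rwa [norm_neg, sub_neg_eq_add, add_sub_cancel] at this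
      rw [norm_smul, Real.norm_of_nonneg (sub_nonneg.2 hxy)] at h4
      have h5 : L y - L x - (y - x) * ‖f' x‖ ≤ ‖L y - L x - (y - x) • ‖f' x‖‖ := le_abs_self _
      rw [one_mul, smul_zero, sub_zero, Real.norm_eq_abs, abs_le, Real.norm_of_nonneg (by positivity)]
      have h6 := norm_nonneg (L y - L x - (y - x) • ‖f' x‖)
      have h7 := norm_nonneg (f y - f x - (y - x) • f' x)
      constructor <;> linarith [h3.1, h3.2]
  have hVa : V a = 0 := by
    simp only [hV, Icc_self]
    rw [eVariationOn.subsingleton f subsingleton_singleton]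
    rfl
  have hLa : L a = 0 := by simp [hL]
  have hVb : V b = L b := by linarith
  rw [← ENNReal.ofReal_toReal (hfin a b hab)]
  exact congrArg ENNReal.ofReal hVb

/-! ### Arc length along the curve -/

/-- The derivative of `powCurve`. -/
def powCurveDeriv (y a x : ℝ) : ℂ := a * ((x : ℂ) + y * Complex.I) ^ ((a : ℂ) - 1)

theorem continuous_powCurveDeriv {y : ℝ} (hy : 0 < y) (a : ℝ) : Continuous (powCurveDeriv y a) := by
  rw [continuous_iff_continuousAt]
  intro x
  have hs : (x : ℂ) + y * Complex.I ∈ Complex.slitPlane :=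
    Complex.mem_slitPlane_iff.2 (Or.inr (by simpa using hy.ne'))
  exact continuousAt_const.mul (ContinuousAt.cpow
    (by fun_prop : Continuous fun x : ℝ => (x : ℂ) + y * Complex.I).continuousAt
    continuousAt_const hs)

theorem powCurveDeriv_eq {y : ℝ} (hy : 0 < y) (a x : ℝ) : powCurveDeriv y a x =
    ((a * ‖(x : ℂ) + y * Complex.I‖ ^ (a - 1) : ℝ) : ℂ) *
      Complex.exp (Complex.I * ((a - 1) * upperArg y x : ℝ)) := by
  have := powCurve_eq hy (a - 1) x
  rw [powCurve] at this
  rw [powCurveDeriv, Complex.ofReal_mul, mul_assoc, ← this]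
  push_cast
  rfl

theorem norm_powCurveDeriv {y a : ℝ} (hy : 0 < y) (ha : 0 < a) (x : ℝ) : ‖powCurveDeriv y a x‖ =
    a * ‖(x : ℂ) + y * Complex.I‖ ^ (a - 1) := by
  rw [powCurveDeriv_eq hy, norm_mul, norm_exp_I_mul', mul_one, Complex.norm_real,
    Real.norm_of_nonneg (by positivity)]

theorem norm_powCurveDeriv_pos {y a : ℝ} (hy : 0 < y) (ha : 0 < a) (x : ℝ) :
    0 < ‖powCurveDeriv y a x‖ := by
  rw [norm_powCurveDeriv hy ha]
  exact mul_pos ha (Real.rpow_pos_of_pos (norm_pos_iff.2 (add_mul_I_ne_zero x hy)) _)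

/-- The signed length of `powCurve` from the parameter `0`. -/
def powCurveLength (y a x : ℝ) : ℝ := ∫ u in (0 : ℝ)..x, ‖powCurveDeriv y a u‖

theorem hasStrictDerivAt_powCurveLength {y : ℝ} (hy : 0 < y) (a x : ℝ) :
    HasStrictDerivAt (powCurveLength y a) ‖powCurveDeriv y a x‖ x :=
  intervalIntegral.integral_hasStrictDerivAt_right
    ((continuous_powCurveDeriv hy a).norm.intervalIntegrable _ _)
    (continuous_powCurveDeriv hy a).norm.aestronglyMeasurable.stronglyMeasurableAtFilter
    (continuous_powCurveDeriv hy a).norm.continuousAt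

theorem strictMono_powCurveLength {y a : ℝ} (hy : 0 < y) (ha : 0 < a) :
    StrictMono (powCurveLength y a) :=
  strictMono_of_deriv_pos fun x => by
    rw [(hasStrictDerivAt_powCurveLength hy a x).hasDerivAt.deriv]
    exact norm_powCurveDeriv_pos hy ha x

theorem eVariationOn_powCurve {y : ℝ} (hy : 0 < y) (a : ℝ) {x x' : ℝ} (h : x ≤ x') :
    eVariationOn (powCurve y a) (Icc x x') =
      ENNReal.ofReal (powCurveLength y a x' - powCurveLength y a x) := by
  have hint : ∀ x y', IntervalIntegrable (fun x => ‖powCurveDeriv y a x‖) MeasureTheory.volume x y' :=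
    fun x y' => (continuous_powCurveDeriv hy a).norm.intervalIntegrable x y'
  rw [eVariationOn_Icc_eq_integral (hasDerivAt_powCurve hy a) (continuous_powCurveDeriv hy a) h,
    powCurveLength, powCurveLength, intervalIntegral.integral_interval_sub_left (hint _ _) (hint _ _)]
  rfl

/-- The inverse of the length function. -/
def powCurveParam (y a : ℝ) : ℝ → ℝ := Function.invFun (powCurveLength y a)

theorem powCurveParam_length {y a : ℝ} (hy : 0 < y) (ha : 0 < a) (x : ℝ) :
    powCurveParam y a (powCurveLength y a x) = x :=
  Function.leftInverse_invFun (strictMono_powCurveLength hy ha).injective x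

theorem hasDerivAt_powCurveParam {y a : ℝ} (hy : 0 < y) (ha : 0 < a) (x : ℝ) :
    HasDerivAt (powCurveParam y a) ‖powCurveDeriv y a x‖⁻¹ (powCurveLength y a x) :=
  ((hasStrictDerivAt_powCurveLength hy a x).to_local_left_inverse (norm_powCurveDeriv_pos hy ha x).ne'
    (Eventually.of_forall (powCurveParam_length hy ha))).hasDerivAt

theorem sleAbscissa_image_Icc {p T s t : ℝ} (hp : 0 < p) (hst : s ≤ t) (ht : t < T) :
    sleAbscissa p T '' (Iio T ∩ Icc s t) = Icc (sleAbscissa p T t) (sleAbscissa p T s) := by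
  have hsub : Icc s t ⊆ Iio T := fun r hr => hr.2.trans_lt ht
  rw [inter_eq_right.2 hsub]
  refine Subset.antisymm ?_ (intermediate_value_Icc' hst ((continuousOn_sleAbscissa hp T).mono hsub))
  rintro _ ⟨r, hr, rfl⟩
  have h := (strictAntiOn_sleAbscissa hp T).antitoneOn
  exact ⟨h (hsub hr) ht hr.2, h (hst.trans_lt ht) (hsub hr) hr.1⟩

/-- The length of a reparametrization of the curve. -/
theorem eVariationOn_reparam {p T : ℝ} (hp : 0 < p) {f : ℝ → ℂ} {σ : ℝ → ℝ} {J : Set ℝ}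
    (hσ : StrictMonoOn σ (Iio T)) (hJ : σ '' Iio T = J) (hf : ∀ t < T, f (σ t) = sleCurve p T t)
    {s t : ℝ} (hst : s ≤ t) (ht : t < T) : eVariationOn f (J ∩ Icc (σ s) (σ t)) =
      ENNReal.ofReal (powCurveLength (sleY p T) (1 / p) (sleAbscissa p T s) -
        powCurveLength (sleY p T) (1 / p) (sleAbscissa p T t)) := by
  have hanti := (strictAntiOn_sleAbscissa hp T).antitoneOn
  rw [← hJ, ← eVariationOn.comp_inter_Icc_eq_of_monotoneOn f σ hσ.monotoneOn (hst.trans_lt ht) ht,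
    ← eVariationOn_powCurve (sleY_pos hp T) _ (hanti (hst.trans_lt ht) ht hst),
    ← sleAbscissa_image_Icc hp hst ht,
    ← eVariationOn.comp_eq_of_antitoneOn _ _ (hanti.mono inter_subset_left)]
  exact eVariationOn.congr fun r hr => hf r hr.1

/-! ### Half-lines with an extended real endpoint -/

theorem isOpen_belowEReal (S : EReal) : IsOpen (belowEReal S) :=
  isOpen_Iio.preimage continuous_coe_real_ereal

theorem mem_belowEReal_of_le {S : EReal} {s t : ℝ} (hst : s ≤ t) (ht : t ∈ belowEReal S) :
    s ∈ belowEReal S :=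
  (EReal.coe_le_coe_iff.2 hst).trans_lt ht

theorem belowEReal_sSup {A : Set ℝ} (h : ∀ s ∈ A, ∀ r < s, r ∈ A) (h' : ∀ s ∈ A, ∃ r ∈ A, s < r) :
    belowEReal (sSup ((fun s : ℝ => (s : EReal)) '' A)) = A := by
  ext s
  constructor
  · intro hs
    obtain ⟨_, ⟨r, hr, rfl⟩, hsr⟩ := lt_sSup_iff.1 (show (s : EReal) < _ from hs)
    exact h r hr s (EReal.coe_lt_coe_iff.1 hsr)
  · intro hs
    obtain ⟨r, hr, hsr⟩ := h' s hs
    exact (EReal.coe_lt_coe_iff.2 hsr).trans_le (le_sSup ⟨r, hr, rfl⟩)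

theorem setOf_sInf_lt {A : Set ℝ} (h : ∀ s ∈ A, ∀ r > s, r ∈ A) (h' : ∀ s ∈ A, ∃ r ∈ A, r < s) :
    {x : ℝ | sInf ((fun s : ℝ => (s : EReal)) '' A) < x} = A := by
  ext s
  constructor
  · intro hs
    obtain ⟨_, ⟨r, hr, rfl⟩, hsr⟩ := sInf_lt_iff.1 (show _ < (s : EReal) from hs)
    exact h r hr s (EReal.coe_lt_coe_iff.1 hsr)
  · intro hs
    obtain ⟨r, hr, hsr⟩ := h' s hs
    exact (sInf_le (mem_image_of_mem _ hr)).trans_lt (EReal.coe_lt_coe_iff.2 hsr)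

/-! ### The arc-length parametrizations -/

theorem tendsto_norm_powCurve {y a : ℝ} (hy : 0 < y) (ha : 0 < a) :
    Tendsto (fun x => ‖powCurve y a x‖) atTop atTop := by
  refine tendsto_atTop_mono' _ ?_ (tendsto_rpow_atTop ha)
  filter_upwards [eventually_ge_atTop 0] with x hx
  rw [norm_powCurve hy]
  refine Real.rpow_le_rpow hx ?_ ha.le
  simpa using Complex.re_le_norm ((x : ℂ) + y * Complex.I)

theorem tendsto_powCurveLength {y a : ℝ} (hy : 0 < y) (ha : 0 < a) :
    Tendsto (powCurveLength y a) atTop atTop := by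
  have h := tendsto_atTop_add_const_right _
    (-‖powCurve y a 0‖ + powCurveLength y a 0) (tendsto_norm_powCurve hy ha)
  refine tendsto_atTop_mono' _ ?_ h
  filter_upwards [eventually_ge_atTop 0] with x hx
  have h1 := eVariationOn.edist_le (powCurve y a) (right_mem_Icc.2 hx) (left_mem_Icc.2 hx)
  rw [eVariationOn_powCurve hy a hx, edist_dist, dist_eq_norm, ENNReal.ofReal_le_ofReal_iff
    (sub_nonneg.2 ((strictMono_powCurveLength hy ha).monotone hx))] at h1
  linarith [norm_sub_norm_le (powCurve y a x) (powCurve y a 0)]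

/-- The Loewner curve has an arc-length parametrization. -/
theorem exists_unitSpeed_sleCurve {p : ℝ} (hp : 0 < p) (T : ℝ) :
    ∃ (S : EReal) (η : ℝ → ℂ) (σ : ℝ → ℝ), HasUnitSpeedOn η (belowEReal S) ∧
      StrictMonoOn σ (Iio T) ∧ σ '' Iio T = belowEReal S ∧
      ∀ t < T, η (σ t) = sleCurve p T t := by
  have hy := sleY_pos hp T
  have ha : 0 < 1 / p := by positivity
  have hL := strictMono_powCurveLength hy ha
  set L := powCurveLength (sleY p T) (1 / p) with hLdef
  -- The sign compensates for the abscissa decreasing in time.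
  set σ : ℝ → ℝ := fun t => -L (sleAbscissa p T t) with hσdef
  have hσ : StrictMonoOn σ (Iio T) := fun s hs t ht hst =>
    neg_lt_neg (hL (strictAntiOn_sleAbscissa hp T hs ht hst))
  have hσc : ContinuousOn σ (Iio T) := fun t ht =>
    ((hasStrictDerivAt_powCurveLength hy (1 / p) _).hasDerivAt.continuousAt.comp_continuousWithinAt
      (continuousOn_sleAbscissa hp T t ht)).neg
  have hσb : Tendsto σ atBot atBot :=
    tendsto_neg_atTop_atBot.comp ((tendsto_powCurveLength hy ha).comp
      (tendsto_sleAbscissa_atBot hp T))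
  have hJ := belowEReal_sSup (A := σ '' Iio T) (by
    rintro _ ⟨t, ht, rfl⟩ r hr
    obtain ⟨t₀, h1, h2⟩ := ((hσb.eventually_le_atBot r).and (eventually_le_atBot t)).exists
    obtain ⟨q, hq, hqr⟩ := intermediate_value_Icc h2
      (hσc.mono fun q hq => hq.2.trans_lt ht) ⟨h1, hr.le⟩
    exact ⟨q, hq.2.trans_lt ht, hqr⟩) (by
    rintro _ ⟨t, ht, rfl⟩
    obtain ⟨r, htr, hr⟩ := exists_between (show t < T from ht)
    exact ⟨_, ⟨r, hr, rfl⟩, hσ ht hr htr⟩)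
  have hf : ∀ t < T, powCurve (sleY p T) (1 / p) (powCurveParam (sleY p T) (1 / p) (-σ t)) =
      sleCurve p T t := fun t _ => by
    simp only [hσdef, neg_neg, hLdef]
    rw [powCurveParam_length hy ha, sleCurve]
  refine ⟨_, fun s => powCurve (sleY p T) (1 / p) (powCurveParam (sleY p T) (1 / p) (-s)), σ, ?_,
    hσ, hJ.symm, hf⟩
  rw [hJ]
  rintro _ ⟨s, hs, rfl⟩ _ ⟨t, ht, rfl⟩
  rw [NNReal.coe_one, one_mul]
  rcases le_or_gt s t with hst | hst
  · rw [eVariationOn_reparam hp hσ rfl hf hst ht]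
    congr 1
    simp only [hσdef]
    ring
  · rw [Icc_eq_empty (not_le.2 (hσ ht hs hst)), inter_empty,
      ENNReal.ofReal_of_nonpos (sub_nonpos.2 (hσ ht hs hst).le)]
    exact eVariationOn.subsingleton _ subsingleton_empty

/-- Every arc-length parametrization of the Loewner curve is the explicit one up to a shift. -/
theorem exists_abscissa_of_unitSpeed {p T : ℝ} (hp : 0 < p) {η : ℝ → ℂ} {σ : ℝ → ℝ} {J : Set ℝ}
    (hη : HasUnitSpeedOn η J) (hσ : StrictMonoOn σ (Iio T)) (hJ : σ '' Iio T = J)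
    (hJb : ∀ t ∈ J, ∀ s ≤ t, s ∈ J) (hf : ∀ t < T, η (σ t) = sleCurve p T t) :
    ∃ X : ℝ → ℝ, (∀ s ∈ J, η s = powCurve (sleY p T) (1 / p) (X s)) ∧
      (∀ s ∈ J, HasDerivAt X (-‖powCurveDeriv (sleY p T) (1 / p) (X s)‖⁻¹) s) ∧
      Tendsto X atBot atTop ∧ X '' J = sleAbscissa p T '' Iio T := by
  have hy := sleY_pos hp T
  have ha : 0 < 1 / p := by positivity
  have hL := strictMono_powCurveLength hy ha
  have hanti := strictAntiOn_sleAbscissa hp T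
  have hmem : ∀ {t}, t < T → σ t ∈ J := fun {t} ht => by rw [← hJ]; exact ⟨t, ht, rfl⟩
  have hdiff : ∀ s t, s ≤ t → t < T → σ t - σ s =
      powCurveLength (sleY p T) (1 / p) (sleAbscissa p T s) -
        powCurveLength (sleY p T) (1 / p) (sleAbscissa p T t) := by
    intro s t hst ht
    have hs := hst.trans_lt ht
    have h1 := hη (hmem hs) (hmem ht)
    rw [eVariationOn_reparam hp hσ hJ hf hst ht, NNReal.coe_one, one_mul,
      ENNReal.ofReal_eq_ofReal_iff (sub_nonneg.2 (hL.monotone (hanti.antitoneOn hs ht hst)))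
        (sub_nonneg.2 (hσ.monotoneOn hs ht hst))] at h1
    exact h1.symm
  -- The shift constant; T - 1 is an arbitrary reference time before T.
  set C := σ (T - 1) + powCurveLength (sleY p T) (1 / p) (sleAbscissa p T (T - 1)) with hC
  have hlen : ∀ t < T, C - σ t = powCurveLength (sleY p T) (1 / p) (sleAbscissa p T t) := by
    intro t ht
    rcases le_total t (T - 1) with h | h
    · linarith [hdiff _ _ h (by linarith)]
    · linarith [hdiff _ _ h ht]
  have hX : ∀ t < T, powCurveParam (sleY p T) (1 / p) (C - σ t) = sleAbscissa p T t :=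
    fun t ht => by rw [hlen t ht, powCurveParam_length hy ha]
  refine ⟨fun s => powCurveParam (sleY p T) (1 / p) (C - s), ?_, ?_, ?_, ?_⟩
  · rw [← hJ]
    rintro _ ⟨t, ht, rfl⟩
    simp only [hX t ht, hf t ht, sleCurve]
  · rw [← hJ]
    rintro _ ⟨t, ht, rfl⟩
    have h1 := hasDerivAt_powCurveParam hy ha (sleAbscissa p T t)
    rw [← hlen t ht] at h1
    have h2 := h1.comp_const_sub C (σ t)
    simp only [hX t ht]
    exact h2
  · refine tendsto_atTop.2 fun M => ?_
    obtain ⟨t, htM, htT⟩ := (((tendsto_sleAbscissa_atBot hp T).eventually_ge_atTop M).and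
      (eventually_lt_atBot T)).exists
    filter_upwards [eventually_le_atBot (σ t)] with s hs
    have hsJ := hJb _ (hmem htT) s hs
    rw [← hJ] at hsJ
    obtain ⟨r, hr, rfl⟩ := hsJ
    rw [hX r hr]
    exact htM.trans (hanti.antitoneOn hr htT ((hσ.le_iff_le hr htT).1 hs))
  · rw [← hJ, image_image]
    exact image_congr fun t ht => hX t ht

/-! ### Lifts to the logarithmic Riemann surface -/

theorem continuous_upperArg (y : ℝ) : Continuous (upperArg y) :=
  continuous_const.sub (Real.continuous_arctan.comp (continuous_id.div_const y))

theorem tendsto_upperArg {y : ℝ} (hy : 0 < y) : Tendsto (upperArg y) atTop (𝓝 0) := by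
  have h1 : Tendsto (fun x => Real.arctan (x / y)) atTop (𝓝 (Real.pi / 2)) :=
    (Real.tendsto_arctan_atTop.mono_right nhdsWithin_le_nhds).comp (tendsto_id.atTop_div_const hy)
  have h2 := h1.const_sub (Real.pi / 2)
  rwa [sub_self] at h2

/-- The curve is traversed with x decreasing, which adds π to the direction (a - 1)·arg of the power
map. -/
theorem hasDerivAt_powCurve_comp {y a : ℝ} (hy : 0 < y) (ha : 0 < a) {X : ℝ → ℝ} {s : ℝ}
    (hX : HasDerivAt X (-‖powCurveDeriv y a (X s)‖⁻¹) s) :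
    HasDerivAt (fun s => powCurve y a (X s))
      (Complex.exp (Complex.I * ((a - 1) * upperArg y (X s) + Real.pi : ℝ))) s := by
  have h := (hasDerivAt_powCurve hy a (X s)).scomp s hX
  refine h.congr_deriv ?_
  have hne : (‖powCurveDeriv y a (X s)‖ : ℂ) ≠ 0 := by
    exact_mod_cast (norm_powCurveDeriv_pos hy ha (X s)).ne'
  change (-‖powCurveDeriv y a (X s)‖⁻¹) • powCurveDeriv y a (X s) = _
  have h1 : powCurveDeriv y a (X s) = (‖powCurveDeriv y a (X s)‖ : ℂ) *
      Complex.exp (Complex.I * ((a - 1) * upperArg y (X s) : ℝ)) := by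
    rw [norm_powCurveDeriv hy ha]
    exact powCurveDeriv_eq hy a (X s)
  rw [Complex.ofReal_add, mul_add, Complex.exp_add, mul_comm Complex.I (Real.pi : ℂ),
    Complex.exp_pi_mul_I, Complex.real_smul, Complex.ofReal_neg, Complex.ofReal_inv]
  generalize Complex.exp _ = e at h1 ⊢
  generalize ‖powCurveDeriv y a (X s)‖ = r at *
  rw [h1, ← mul_assoc, neg_mul, inv_mul_cancel₀ hne]
  ring

theorem exists_lift_powCurve {y a : ℝ} (hy : 0 < y) {X : ℝ → ℝ} {η : ℝ → ℂ} {J : Set ℝ}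
    (hX : ContinuousOn X J) (hXb : Tendsto X atBot atTop) (hη : ∀ s ∈ J, η s = powCurve y a (X s)) :
    ∃ η' : ℝ → LogSurface, IsLiftOn η' η J ∧ Tendsto (fun s => (η' s).arg) atBot (𝓝 0) := by
  have hpos : ∀ x : ℝ, 0 < ‖(x : ℂ) + y * Complex.I‖ ^ a := fun x =>
    Real.rpow_pos_of_pos (norm_pos_iff.2 (add_mul_I_ne_zero x hy)) _
  have hc : Continuous fun x : ℝ => ‖(x : ℂ) + y * Complex.I‖ ^ a := by
    refine Continuous.rpow_const (by fun_prop) fun x => Or.inl ?_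
    exact norm_ne_zero_iff.2 (add_mul_I_ne_zero x hy)
  refine ⟨fun s => (⟨_, hpos (X s)⟩, a * upperArg y (X s)), ⟨?_, fun s hs => ?_⟩, ?_⟩
  · have h : Continuous fun x : ℝ =>
        ((⟨_, hpos x⟩, a * upperArg y x) : LogSurface) :=
      (hc.subtype_mk _).prodMk (continuous_const.mul (continuous_upperArg y))
    exact h.comp_continuousOn hX
  · rw [hη s hs, powCurve_eq hy]
    rfl
  · simpa [LogSurface.arg] using ((tendsto_upperArg hy).comp hXb).const_mul a

/-- A lift whose argument tends to `0` is determined. -/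
theorem arg_eq_of_isLiftOn {y a : ℝ} (hy : 0 < y) {X : ℝ → ℝ} {η : ℝ → ℂ}
    {η' : ℝ → LogSurface} {J : Set ℝ} (hJb : ∀ t ∈ J, ∀ s ≤ t, s ∈ J)
    (hX : ContinuousOn X J) (hXb : Tendsto X atBot atTop) (hη : ∀ s ∈ J, η s = powCurve y a (X s))
    (hη' : IsLiftOn η' η J) (h0 : Tendsto (fun s => (η' s).arg) atBot (𝓝 0)) {s : ℝ} (hs : s ∈ J) :
    (η' s).arg = a * upperArg y (X s) := by
  set d : ℝ → ℝ := fun s => (η' s).arg - a * upperArg y (X s) with hd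
  have hdc : ContinuousOn d J :=
    (continuous_snd.comp_continuousOn hη'.1).sub
      (continuousOn_const.mul ((continuous_upperArg y).comp_continuousOn hX))
  have hd0 : Tendsto d atBot (𝓝 0) := by
    simpa using h0.sub (((tendsto_upperArg hy).comp hXb).const_mul a)
  have hint : ∀ s ∈ J, ∃ n : ℤ, d s = n * (2 * Real.pi) := by
    intro s hs
    have h1 := hη'.2 s hs
    rw [hη s hs] at h1
    have hn : ((η' s).1 : ℝ) = ‖powCurve y a (X s)‖ := by
      rw [← h1, LogSurface.proj, norm_mul, norm_exp_I_mul', mul_one, Complex.norm_real,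
        Real.norm_of_nonneg (η' s).1.2.le]
    rw [powCurve_eq hy, ← norm_powCurve hy, ← hn, LogSurface.proj] at h1
    have h2 := mul_left_cancel₀ (by exact_mod_cast (η' s).1.2.ne') h1
    obtain ⟨n, hn⟩ := Complex.exp_eq_exp_iff_exists_int.1 h2
    refine ⟨n, ?_⟩
    have h3 := congrArg Complex.im hn
    simp at h3
    simp only [hd, LogSurface.arg]
    linarith
  have hpi := Real.pi_pos
  obtain ⟨r, hr, hrs⟩ := ((hd0.abs.eventually_lt_const (by simpa using hpi)).and
    (eventually_le_atBot s)).exists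
  -- The difference d takes values in 2πℤ, so |d| can never cross π; being small near -∞ it stays
  -- below π and is therefore 0.
  have hne : ∀ q ∈ J, |d q| ≠ Real.pi := by
    intro q hq h
    obtain ⟨n, hn⟩ := hint q hq
    rw [hn, abs_mul, abs_of_pos (by positivity : 0 < 2 * Real.pi)] at h
    have h1 : 2 * |(n : ℝ)| = 1 := by
      have := mul_right_cancel₀ hpi.ne' (show 2 * |(n : ℝ)| * Real.pi = 1 * Real.pi by linarith)
      exact this
    have h2 : 2 * |n| = 1 := by exact_mod_cast h1
    omega
  have hlt : |d s| < Real.pi := by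
    by_contra hcon
    rw [not_lt] at hcon
    obtain ⟨q, hq, hqe⟩ := intermediate_value_Icc hrs
      ((hdc.mono fun q hq => hJb s hs q hq.2).abs) ⟨hr.le, hcon⟩
    exact hne q (hJb s hs q hq.2) hqe
  obtain ⟨n, hn⟩ := hint s hs
  have hn0 : n = 0 := by
    rw [hn, abs_mul, abs_of_pos (by positivity : 0 < 2 * Real.pi)] at hlt
    have h1 : |(n : ℝ)| < 1 := by nlinarith
    exact Int.abs_lt_one_iff.1 (by exact_mod_cast h1)
  rw [hn0, Int.cast_zero, zero_mul] at hn
  simp only [hd] at hn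
  linarith

/-- The lift has argument a·arg(X + iy), so `hk` turns the direction angle (a - 1)·arg(X + iy) + π
into the field value at the lifted point. -/
theorem isFlowLineOn_of_isLiftOn {y a : ℝ} (hy : 0 < y) (ha : 0 < a) {X : ℝ → ℝ} {η : ℝ → ℂ}
    {η' : ℝ → LogSurface} {J : Set ℝ} (hJo : IsOpen J) (hJb : ∀ t ∈ J, ∀ s ≤ t, s ∈ J)
    (hX : ∀ s ∈ J, HasDerivAt X (-‖powCurveDeriv y a (X s)‖⁻¹) s)
    (hXb : Tendsto X atBot atTop) (hη : ∀ s ∈ J, η s = powCurve y a (X s))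
    (hη' : IsLiftOn η' η J) (h0 : Tendsto (fun s => (η' s).arg) atBot (𝓝 0)) {k : ℝ}
    (hk : k * a = a - 1) :
    IsFlowLineOn (fun q => k * q.arg + Real.pi) η' J := by
  have hXc : ContinuousOn X J := fun s hs => (hX s hs).continuousAt.continuousWithinAt
  have hderiv : ∀ s ∈ J, HasDerivAt (fun s => (η' s).proj)
      (Complex.exp (Complex.I * ((k * (η' s).arg + Real.pi : ℝ) : ℂ))) s := by
    intro s hs
    rw [arg_eq_of_isLiftOn hy hJb hXc hXb hη hη' h0 hs, ← mul_assoc, hk]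
    refine (hasDerivAt_powCurve_comp hy ha (hX s hs)).congr_of_eventuallyEq ?_
    filter_upwards [hJo.mem_nhds hs] with r hr
    rw [hη'.2 r hr, hη r hr]
  refine ⟨hη'.1, ?_, hderiv⟩
  refine (contDiffOn_one_iff_derivWithin hJo.uniqueDiffOn).2
    ⟨fun s hs => (hderiv s hs).differentiableAt.differentiableWithinAt, ?_⟩
  have hc : ContinuousOn (fun s => Complex.exp (Complex.I *
      ((k * (η' s).arg + Real.pi : ℝ) : ℂ))) J := by
    have h1 : Continuous fun q : LogSurface => Complex.exp (Complex.I *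
      ((k * q.arg + Real.pi : ℝ) : ℂ)) := by
      have : Continuous LogSurface.arg := continuous_snd
      fun_prop
    exact h1.comp_continuousOn hη'.1
  exact hc.congr fun s hs => (hderiv s hs).hasDerivWithinAt.derivWithin (hJo.uniqueDiffOn s hs)

end

/-- For `ρ < -2` the whole-plane SLE₀(ρ) is a curve possessing an arc-length parametrization, and
every arc-length parametrization `η` of it, started in the direction `1`, has a lift to `M₀` whose
argument tends to `0` at `-∞`; this lift is a flow line of `(6 + ρ)/4 · arg + π`; and `η` traces the
image of a half-line `{x + i y₀ : x > x₀}` under `z ↦ z^(-4/(2+ρ)) = exp (-4/(2+ρ) · log z)`, whose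
argument `Im (-4/(2+ρ) · log (x + i y₀))` tends to `0` as `x → +∞`. -/
theorem proposition4p9 (ρ : ℝ) (hρ : ρ < -2) (T : ℝ) :
    (∃ (S : EReal) (η : ℝ → ℂ), IsArcLengthWholePlaneSLE ρ T 0 S η) ∧
    ∀ (S : EReal) (η : ℝ → ℂ), IsArcLengthWholePlaneSLE ρ T 0 S η →
      (∃ η' : ℝ → LogSurface, IsLiftOn η' η (belowEReal S) ∧
        Tendsto (fun s => (η' s).arg) atBot (𝓝 0)) ∧
      (∀ η' : ℝ → LogSurface, IsLiftOn η' η (belowEReal S) →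
        Tendsto (fun s => (η' s).arg) atBot (𝓝 0) →
        IsFlowLineOn (fun p => (6 + ρ) / 4 * p.arg + Real.pi) η' (belowEReal S)) ∧
      ∃ (y₀ : ℝ) (x₀ : EReal), 0 < y₀ ∧ x₀ < ⊤ ∧
        Tendsto (fun x : ℝ => (((-4 / (2 + ρ) : ℝ) : ℂ) *
          Complex.log ((x : ℂ) + (y₀ : ℂ) * Complex.I)).im) atTop (𝓝 0) ∧
        η '' belowEReal S =
          (fun x : ℝ => ((x : ℂ) + (y₀ : ℂ) * Complex.I) ^ ((-4 / (2 + ρ) : ℝ) : ℂ)) ''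
            {x : ℝ | x₀ < (x : EReal)} := by
  obtain ⟨p, hp, hρp⟩ : ∃ p : ℝ, 0 < p ∧ p = -(ρ + 2) / 4 := ⟨_, by linarith, rfl⟩
  have ha : 0 < 1 / p := by positivity
  have hexp : -4 / (2 + ρ) = 1 / p := by
    have h1 : 2 + ρ ≠ 0 := by linarith
    have h2 : ρ + 2 ≠ 0 := by linarith
    rw [hρp]
    field_simp
    ring
  have hk : (6 + ρ) / 4 * (1 / p) = 1 / p - 1 := by
    have : (6 + ρ) / 4 = 1 - p := by rw [hρp]; ring
    rw [this]
    field_simp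
  have hcurve := isWholePlaneLoewnerCurve_sleCurve hp T
  have hw : wholePlaneSLEDriving ρ T 0 = sleDriving p T := by
    rw [wholePlaneSLEDriving_eq hρ, hρp]
  have hy := sleY_pos hp T
  refine ⟨?_, ?_⟩
  · obtain ⟨S, η, σ, hη, hσ, hJ, hf⟩ := exists_unitSpeed_sleCurve hp T
    exact ⟨S, η, hη, _, σ, hw ▸ hcurve, hσ, hJ, hf⟩
  rintro S η ⟨hη, γ, σ, hγ, hσ, hJ, hf⟩
  rw [hw] at hγ
  have hJb : ∀ t ∈ belowEReal S, ∀ s ≤ t, s ∈ belowEReal S := fun t ht s hst =>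
    mem_belowEReal_of_le hst ht
  obtain ⟨X, hX, hXd, hXb, hXJ⟩ := exists_abscissa_of_unitSpeed hp hη hσ hJ hJb
    fun t ht => (hf t ht).trans (eq_of_isWholePlaneLoewnerCurve hγ hcurve ht)
  have hXc : ContinuousOn X (belowEReal S) := fun s hs =>
    (hXd s hs).continuousAt.continuousWithinAt
  refine ⟨exists_lift_powCurve hy hXc hXb hX, fun η' hη' h0 =>
    isFlowLineOn_of_isLiftOn hy ha (isOpen_belowEReal S) hJb hXd hXb hX hη' h0 hk,
    -- The abscissas form an upward closed set without minimum, hence an open half-line from their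
    -- infimum, possibly -∞.
    sleY p T, sInf ((fun x : ℝ => (x : EReal)) '' (sleAbscissa p T '' Iio T)), hy, ?_, ?_, ?_⟩
  · have h : sleAbscissa p T (T - 1) ∈ sleAbscissa p T '' Iio T := ⟨T - 1, sub_one_lt T, rfl⟩
    exact lt_of_le_of_lt (sInf_le (mem_image_of_mem (fun x : ℝ => (x : EReal)) h))
      (EReal.coe_lt_top _)
  · have h := (tendsto_upperArg hy).const_mul (1 / p)
    rw [mul_zero] at h
    refine h.congr fun x => ?_
    rw [hexp, Complex.im_ofReal_mul, Complex.log_im, arg_add_mul_I hy]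
  · rw [setOf_sInf_lt, ← hXJ, image_image, hexp]
    · exact image_congr hX
    · rintro _ ⟨t, ht, rfl⟩ x hx
      obtain ⟨s, hs, hsx⟩ := exists_sleAbscissa_eq hp ht (le_of_lt hx)
      exact ⟨s, hs.trans_lt ht, hsx⟩
    · rintro _ ⟨t, ht, rfl⟩
      obtain ⟨r, htr, hr⟩ := exists_between (show t < T from ht)
      exact ⟨_, ⟨r, hr, rfl⟩, strictAntiOn_sleAbscissa hp T ht hr htr⟩
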